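/- **Theorem (Thin Fatgraph Theorem).** Let $F_k$ be the free group on a fixed set of $k\ge 2$ free generators, and let $X$ be the corresponding rose. *Definitions.* A *tagged loop* is a cyclically reduced cyclic word $\gamma$ in the generators and their inverses, of length $|\gamma|\ge 1$, together with a set of *tags*: at some of its vertices (the points between consecutive letters) the germ of one further edge is attached, labeled by a generator or its inverse, such that the three directions at a tagged vertex are distinct. Distances between tags are measured along $\gamma$; the *density* of the tags is their number divided by $|\gamma|$. The loop $\gamma$ is *$(T,\epsilon)$-pseudorandom* if $|\gamma|\ge T$ and, whenever a cyclic conjugate of $\gamma$ is written as $w_1w_2\cdots w_Mv$ with $|w_i|=T$ and $|v|<T$, every reduced word $\sigma$ of length $T$ satisfies $$1-\epsilon\le \frac{\#\{i : w_i=\sigma\}}{M}\cdot (2k)(2k-1)^{T-1}\le 1+\epsilon .$$ A finite collection of tagged loops is *homologically trivial* if its classes in $H_1(X)=\mathbb Z^k$ sum to $0$. A finite fatgraph $Y$ over $X$ with tags (germs of edges attached at some corners of its vertices) has as oriented boundary $\partial S(Y)$ of its fattening a collection of cyclic words with tags. It is *trivalent* if, counting tags, all its vertices have valence $3$ (apart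 from the valence $2$ subdivision points in the interiors of edges) and no component is a circle without a trivalent vertex; its *edges* are the arcs between consecutive trivalent vertices, where a vertex with a tag counts as a trivalent vertex. Lengths are numbers of letters. *Statement.* For every integer $L>0$ there is $T_0$ (depending on $L$ and $k$) such that for every integer $T\ge T_0$ and every function $\rho$ with $\rho(\epsilon)=o(\epsilon)$ as $\epsilon\to 0^+$ there is $\epsilon_0>0$ such that the following holds for all $0<\epsilon<\epsilon_0$. Let $\Gamma$ be a homologically trivial finite collection of tagged loops such that for each loop $\gamma$ in $\Gamma$: 1. no two tags in $\gamma$ are closer than $4L$; 2. the density of the tags in $\gamma$ is at most $\rho(\epsilon)$; 3. $\gamma$ is $(T,\epsilon)$-pseudorandom. Then there is a trivalent fatgraph $Y$ over $X$ with every edge of length at least $L$ such that $\partial S(Y)$ is equal, as a collection of tagged loops, to $N$ disjoint copies of $\Gamma$, where $N=20L$. If $k=2$, the same holds with $N=1$. -/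

import Mathlib

open scoped Topology Asymptotics

namespace ThinFatgraph

/-- The letters of the free group `F_k`: `(i, true)` is the generator `x_i` and `(i, false)` its
inverse, as in `FreeGroup (Fin k)`. They are also the oriented edges of the rose `X`, and the
directions in which one can leave its vertex. -/
abbrev Letter (k : ℕ) : Type := Fin k × Bool

/-- The inverse of a letter. -/
def Letter.inv {k : ℕ} (x : Letter k) : Letter k := (x.1, !x.2)

/-- A cyclically reduced cyclic word with tags. The letters are placed around a circle, indexed
by the residues modulo the length. A tag is the germ of an edge attached to the loop at a vertex;
`tag i = some t` says that there is a tag at the vertex between `letter (i - 1)` and `letter i`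
and that the germ leaves this vertex in the direction `t`. The three directions at a tagged vertex
are distinct (the tagged word is reduced). -/
structure TaggedLoop (k : ℕ) where
  length : ℕ
  length_pos : 0 < length
  letter : ZMod length → Letter k
  tag : ZMod length → Option (Letter k)
  reduced : ∀ i, letter (i + 1) ≠ (letter i).inv
  tag_reduced : ∀ i t, tag i = some t → t ≠ (letter (i - 1)).inv ∧ t ≠ letter i

namespace TaggedLoop

variable {k : ℕ}

/-- No two tags of the loop are closer than `r`, measured along the loop. The quantifiers are
symmetric in `i` and `j`, so both arcs between two tags have length at least `r`. -/
def TagsSeparated (γ : TaggedLoop k) (r : ℕ) : Prop :=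
  ∀ i j : ZMod γ.length, γ.tag i ≠ none → γ.tag j ≠ none → i ≠ j → r ≤ (j - i).val

/-- The density of the tags: their number divided by the length of the loop. -/
noncomputable def tagDensity (γ : TaggedLoop k) : ℝ :=
  ({i | γ.tag i ≠ none} : Set (ZMod γ.length)).ncard / (γ.length : ℝ)

/-- The `i`-th block of length `T` of the cyclic conjugate of the loop that starts at `s`. -/
def block (γ : TaggedLoop k) (T : ℕ) (s : ZMod γ.length) (i : ℕ) : Fin T → Letter k :=
  fun j => γ.letter (s + ((i * T + (j : ℕ) : ℕ) : ZMod γ.length))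

/-- `(T, ε)`-pseudorandomness. For every cyclic conjugate `w_0 w_1 ⋯ w_{N-1} v` with `|w_i| = T`
and `|v| < T`, every reduced word `σ` of length `T` occurs among the `w_i` with the expected
frequency, up to a multiplicative error `1 ± ε`. There has to be at least one block. -/
def IsPseudorandom (γ : TaggedLoop k) (T : ℕ) (ε : ℝ) : Prop :=
  T ≤ γ.length ∧
  ∀ (s : ZMod γ.length) (σ : Fin T → Letter k), FreeGroup.IsReduced (List.ofFn σ) →
    let N : ℕ := γ.length / T
    let frequency : ℝ := (({i | i < N ∧ γ.block T s i = σ} : Set ℕ).ncard : ℝ) / (N : ℝ)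
    1 - ε ≤ frequency * ((2 * k : ℝ) * (2 * k - 1 : ℝ) ^ (T - 1)) ∧
      frequency * ((2 * k : ℝ) * (2 * k - 1 : ℝ) ^ (T - 1)) ≤ 1 + ε

/-- The class of the loop in `H_1(X) = ℤ^k`: the vector of its exponent sums. -/
noncomputable def homologyClass (γ : TaggedLoop k) : Fin k → ℤ := fun g =>
  (({i | γ.letter i = (g, true)} : Set (ZMod γ.length)).ncard : ℤ)
    - (({i | γ.letter i = (g, false)} : Set (ZMod γ.length)).ncard : ℤ)

end TaggedLoop

/-- A finite collection of loops is homologically trivial. -/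
def HomologicallyTrivial {k m : ℕ} (Γ : Fin m → TaggedLoop k) : Prop :=
  ∑ i, (Γ i).homologyClass = 0

/-- `N` disjoint copies of a collection. -/
def copies {k m : ℕ} (N : ℕ) (Γ : Fin m → TaggedLoop k) : Fin N × Fin m → TaggedLoop k :=
  fun p => Γ p.2

/-- A finite fatgraph with tags, together with a simplicial map to the rose. The graph is
subdivided so that each of its edges maps to one edge of the rose. A dart is an oriented edge;
`flip` reverses it, `label` is the oriented edge of the rose to which it is mapped, and a dart is
incident to its initial vertex. The cycles of `next` are the vertices, each with its cyclic order
on the darts leaving it. `tag d = some t` says that the germ of a further edge, with direction `t`,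
is attached to the initial vertex of `d`, just before `d` in the cyclic order. -/
structure Fatgraph (k : ℕ) where
  Dart : Type
  finite_dart : Finite Dart
  flip : Dart → Dart
  flip_flip : ∀ d, flip (flip d) = d
  flip_ne : ∀ d, flip d ≠ d
  next : Equiv.Perm Dart
  label : Dart → Letter k
  label_flip : ∀ d, label (flip d) = (label d).inv
  tag : Dart → Option (Letter k)

namespace Fatgraph

variable {k : ℕ}

/-- The dart that follows `d` on the oriented boundary of the fattening `S(Y)`: the boundary runs
along `d` to its terminal vertex and leaves it along the next dart in the cyclic order. -/
def boundaryNext (Y : Fatgraph k) (d : Y.Dart) : Y.Dart := Y.next (Y.flip d)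

/-- The valence of the initial vertex of `d`, where the tags at this vertex are counted. -/
noncomputable def valence (Y : Fatgraph k) (d : Y.Dart) : ℕ :=
  ({e | Y.next.SameCycle d e} : Set Y.Dart).ncard
    + ({e | Y.next.SameCycle d e ∧ Y.tag e ≠ none} : Set Y.Dart).ncard

/-- The fatgraph is (a subdivision of) a trivalent one, where tags are counted as trivalent
vertices: all vertices have valence 3, except for subdivision points in the interior of edges,
which have valence 2, and there is no circle without a trivalent vertex. -/
def IsTrivalent (Y : Fatgraph k) : Prop :=
  (∀ d, Y.valence d = 2 ∨ Y.valence d = 3) ∧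
  (∀ d, ∃ j : ℕ, Y.valence (Y.boundaryNext^[j] d) = 3)

/-- Every edge of the trivalent fatgraph has length at least `L`: when one leaves a trivalent vertex
(or a tag) along a dart `d` and follows the edge, one does not meet a trivalent vertex (or a tag)
after `1, …, L - 1` steps. At a vertex of valence 2, following the edge and following the
boundary are the same. -/
def EdgesLong (Y : Fatgraph k) (L : ℕ) : Prop :=
  ∀ d, Y.valence d = 3 → ∀ j : ℕ, 0 < j → j < L → Y.valence (Y.boundaryNext^[j] d) ≠ 3

/-- `∂S(Y)` is equal to the given collection of tagged loops: the darts correspond to the letters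
of the collection, in such a way that the boundary components of `S(Y)`, with their
orientations, labels and tags, become the loops of the collection. -/
def Bounds (Y : Fatgraph k) {ι : Type} (Γ : ι → TaggedLoop k) : Prop :=
  ∃ e : Y.Dart ≃ (Σ i, ZMod (Γ i).length),
    (∀ d, e (Y.boundaryNext d) = ⟨(e d).1, (e d).2 + 1⟩) ∧
    (∀ d, Y.label d = (Γ (e d).1).letter (e d).2) ∧
    (∀ d, Y.tag d = (Γ (e d).1).tag (e d).2)

end Fatgraph

/-- The collection bounds a trivalent fatgraph all of whose edges have length at least `L`. -/
def BoundsThinFatgraph {k : ℕ} (L : ℕ) {ι : Type} (Γ : ι → TaggedLoop k) : Prop :=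
  ∃ Y : Fatgraph k, Y.IsTrivalent ∧ Y.EdgesLong L ∧ Y.Bounds Γ

end ThinFatgraph

/-! The fatgraph is built by gluing a subword `u` of the loops to a disjoint occurrence of its
inverse. Gluing splits one loop into two, or merges two loops into one, and at each end of the glued
edge a corner of a remaining loop becomes a vertex to which an edge is attached. Such a corner
behaves exactly like a tag, so both are recorded as marks on loops. `Good L M` says that the marked
loops `M` can be used up by such gluings along edges in which ends and marks are at distance at
least `L`. By `bounds_of_good` a good collection bounds the required fatgraph, and disjoint unions
of good collections are good. Hence it suffices to show that `Γ` itself is good, whatever the number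
of copies.

Algebra. Modulo good collections, the one-mark loop of a cyclically reduced word defines a class
that is compatible with rotation, inversion, splitting and merging. Since there are at least four
directions at the vertex of the rose, these relations force the class to be a linear function of the
exponent sums (`IsClassFun.exists_linear`). So a homologically trivial collection of words becomes
good after adding a good collection (`exists_goodWords_of_hom`). There are finitely many tame loops,
and the monoid of their homologically trivial combinations is finitely generated. Therefore one
fixed good collection `B` suffices: a number of copies of `B` linear in the size of a homologically
trivial collection makes it good (`exists_absorber`, and `exists_loop_absorber` for loops of any
length).

Supply of `B`. There are words `Q`, `R` of equal length that fit into the same places of a reduced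
word, such that the loop left over when `Q` faces the inverse of `R` can be cut into a copy of `B`
and loops that cancel (`exists_exchange`). So gluing two words that are inverse up to replacing some
`Q` by `R` releases copies of `B`. The opposite replacement leaves the mirror image of that loop,
which is good by itself.

Geometry. Each loop is divided into blocks of length `T`, and each half of a block contains a long
core. Swapping `Q` and `R` in fixed slots and inverting is an injective map on reduced words, hence
a bijection on the cores of given length (`exists_partner`). By pseudorandomness all reduced words
occur in each half with nearly the same frequency, so nearly every core of a first half can be
matched with its partner among the cores of the second halves (`exists_matching`); few blocks
contain tags. What remains outside the cores has length about `8 * L` per block, while the cores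
have so many slots that about fourteen copies of `B` per block are released. As exchange loops are
null-homologous, the remainder is homologically trivial, and `B` absorbs it (`exists_good_of_cores`,
`count_estimate`). -/

namespace ThinFatgraph

/-! ### Marked loops and the calculus of cuts -/

/-- The inverse of a word. -/
def wordInv {k : ℕ} (w : List (Letter k)) : List (Letter k) := (w.map Letter.inv).reverse

/-- A word as a marked list without marks. -/
def plain {k : ℕ} (w : List (Letter k)) : List (Letter k × Bool) := w.map fun x => (x, false)

/-- Put a mark at the initial vertex of a marked list. -/
def tick {k : ℕ} : List (Letter k × Bool) → List (Letter k × Bool)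
  | [] => []
  | x :: l => (x.1, true) :: l

/-- The labels of a marked list. -/
def labels {k : ℕ} (l : List (Letter k × Bool)) : List (Letter k) := l.map Prod.fst

/-- The unmarked inverse of a marked list. -/
def bar {k : ℕ} (u : List (Letter k × Bool)) : List (Letter k × Bool) := plain (wordInv (labels u))

/-- The `i`-th vertex of a marked list carries a mark. -/
def Marked {k : ℕ} (u : List (Letter k × Bool)) (i : ℕ) : Prop := ∃ x, u[i]? = some (x, true)

/-- The end points and the marked vertices of a marked list. -/
def IsSpec {k : ℕ} (u : List (Letter k × Bool)) (i : ℕ) : Prop :=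
  i = 0 ∨ i = u.length ∨ Marked u i

/-- The initial vertex is unmarked, and the end points and marked vertices have pairwise distance
at least `L`. -/
structure Sep {k : ℕ} (L : ℕ) (u : List (Letter k × Bool)) : Prop where
  ne_nil : u ≠ []
  head : ¬ Marked u 0
  sep : ∀ i j, i < j → j ≤ u.length → IsSpec u i → IsSpec u j → L ≤ j - i

/-- Collections of cyclic marked words that are reduced to nothing by cutting along edges of
length at least `L`. -/
inductive Good {k : ℕ} (L : ℕ) : Multiset (List (Letter k × Bool)) → Prop
  | zero : Good L 0
  | rot (a b M) : Good L ((a ++ b) ::ₘ M) → Good L ((b ++ a) ::ₘ M)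
  -- An annulus glued from two inverse loops. The single mark of the second loop makes the base
  -- point a trivalent vertex, so that no circle without vertices arises.
  | ann (u M) : Sep L u → Good L M → Good L (u ::ₘ tick (bar u) ::ₘ M)
  -- The ends of `u` become trivalent vertices; `tick` records on each remaining loop the corner at
  -- which the glued edge arrives. A mark already present at such a corner would give valence four,
  -- whence the conditions on the heads.
  | split (u A B M) : Sep L u → A ≠ [] → B ≠ [] → ¬ Marked A 0 → ¬ Marked B 0 →
      Good L (tick A ::ₘ tick B ::ₘ M) → Good L ((u ++ A ++ bar u ++ B) ::ₘ M)
  | merge (u A B M) : Sep L u → A ≠ [] → B ≠ [] → ¬ Marked A 0 → ¬ Marked B 0 →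
      Good L ((tick A ++ tick B) ::ₘ M) → Good L ((u ++ A) ::ₘ (bar u ++ B) ::ₘ M)

@[simp] theorem Letter.inv_inv {k : ℕ} (x : Letter k) : x.inv.inv = x := by
  simp [Letter.inv]

theorem Letter.inv_ne {k : ℕ} (x : Letter k) : x.inv ≠ x := by
  simp [Letter.inv, Prod.ext_iff]

/-! ### Gluing two antiparallel runs of darts -/

/-- A fatgraph structure without short edges on a system of marked loops, given by the
successor `s` on the set `X` of darts. -/
def Thin {k : ℕ} (L : ℕ) {D : Type} (X : Set D) (s : D → D) (lab : D → Letter k) (mk : D → Prop) :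
    Prop :=
  ∃ φ : D → D,
    (∀ d ∈ X, φ d ∈ X ∧ φ (φ d) = d ∧ lab (φ d) = (lab d).inv) ∧
    -- The vertices are the orbits of `s ∘ φ`: either two darts with at most one mark, or three
    -- darts without marks.
    (∀ d ∈ X, s (φ d) ≠ d ∧
      ((s (φ (s (φ d))) = d ∧ ¬ (mk d ∧ mk (s (φ d)))) ∨
       (s (φ (s (φ d))) ≠ d ∧ s (φ (s (φ (s (φ d))))) = d ∧
         ¬ mk d ∧ ¬ mk (s (φ d)) ∧ ¬ mk (s (φ (s (φ d))))))) ∧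
    (∀ d ∈ X, (s (φ (s (φ d))) ≠ d ∨ mk d ∨ mk (s (φ d))) → ∀ j, 0 < j → j < L →
      ¬ (s (φ (s (φ (s^[j] d)))) ≠ s^[j] d ∨ mk (s^[j] d) ∨ mk (s (φ (s^[j] d))))) ∧
    (∀ d ∈ X, ∃ j, (s (φ (s (φ (s^[j] d)))) ≠ s^[j] d ∨ mk (s^[j] d) ∨ mk (s (φ (s^[j] d)))))

/-- The data of a pair of antiparallel runs of darts `p 0, …, p (n-1)` and `q 0, …, q (n-1)` in a
system of marked loops, which are to be glued. -/
structure Runs {k : ℕ} (L : ℕ) {D : Type} (X : Set D) (s : D → D) (lab : D → Letter k)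
    (mk : D → Prop) (n : ℕ) (p q : ℕ → D) : Prop where
  pos : 0 < n
  maps : ∀ d ∈ X, s d ∈ X
  inj : Set.InjOn s X
  p_mem : ∀ i < n, p i ∈ X
  q_mem : ∀ i < n, q i ∈ X
  p_inj : ∀ i < n, ∀ j < n, p i = p j → i = j
  q_inj : ∀ i < n, ∀ j < n, q i = q j → i = j
  pq : ∀ i < n, ∀ j < n, p i ≠ q j
  p_succ : ∀ i < n, s (p i) = p (i + 1)
  q_succ : ∀ i < n, s (q i) = q (i + 1)
  lab_q : ∀ i < n, lab (q (n - 1 - i)) = (lab (p i)).inv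
  -- Marks inside the glued edge lie on the side of `p` only. The dart `q 0` is left free, because
  -- it carries the mark when an annulus is glued.
  q_unmarked : ∀ i, 0 < i → i < n → ¬ mk (q i)
  p_unmarked : ¬ mk (p 0)
  sep : ∀ i j, i < j → j ≤ n → (i = 0 ∨ mk (p i)) → (j = n ∨ mk (p j)) → L ≤ j - i

namespace Runs

variable {k L : ℕ} {D : Type} {X : Set D} {s : D → D} {lab : D → Letter k} {mk : D → Prop}
  {n : ℕ} {p q : ℕ → D}

theorem exists_flip (h : Runs L X s lab mk n p q) (ψ : D → D) : ∃ φ : D → D,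
    (∀ i < n, φ (p i) = q (n - 1 - i)) ∧ (∀ i < n, φ (q i) = p (n - 1 - i)) ∧
    (∀ d, (∀ i < n, d ≠ p i) → (∀ i < n, d ≠ q i) → φ d = ψ d) := by
  classical
  refine ⟨fun d => if h : ∃ i, i < n ∧ d = p i then q (n - 1 - h.choose) else
    if h : ∃ i, i < n ∧ d = q i then p (n - 1 - h.choose) else ψ d, ?_, ?_, ?_⟩
  · intro i hi
    have hex : ∃ j, j < n ∧ p i = p j := ⟨i, hi, rfl⟩
    have := h.p_inj _ hi _ hex.choose_spec.1 hex.choose_spec.2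
    simp only [hex, dif_pos]
    rw [← this]
  · intro i hi
    have hno : ¬ ∃ j, j < n ∧ q i = p j := fun ⟨j, hj, e⟩ => h.pq j hj i hi e.symm
    have hex : ∃ j, j < n ∧ q i = q j := ⟨i, hi, rfl⟩
    have := h.q_inj _ hi _ hex.choose_spec.1 hex.choose_spec.2
    simp only [hno, hex, dif_pos, dif_neg, not_false_eq_true]
    rw [← this]
  · intro d h1 h2
    have hno : ¬ ∃ j, j < n ∧ d = p j := fun ⟨j, hj, e⟩ => h1 j hj e
    have hno' : ¬ ∃ j, j < n ∧ d = q j := fun ⟨j, hj, e⟩ => h2 j hj e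
    simp [hno, hno']

theorem iterate_p (h : Runs L X s lab mk n p q) : ∀ j i, i + j ≤ n → s^[j] (p i) = p (i + j)
  | 0, i, _ => rfl
  | j + 1, i, hi => by
    rw [Function.iterate_succ_apply', iterate_p h j i (by omega), h.p_succ _ (by omega)]
    rfl

theorem iterate_q (h : Runs L X s lab mk n p q) : ∀ j i, i + j ≤ n → s^[j] (q i) = q (i + j)
  | 0, i, _ => rfl
  | j + 1, i, hi => by
    rw [Function.iterate_succ_apply', iterate_q h j i (by omega), h.q_succ _ (by omega)]
    rfl

variable {φ : D → D}

theorem next_p (h : Runs L X s lab mk n p q) (hp : ∀ i < n, φ (p i) = q (n - 1 - i)) {i : ℕ}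
    (hi : i < n) : s (φ (p i)) = q (n - i) := by
  rw [hp i hi, h.q_succ _ (by omega)]
  congr 1
  omega

theorem next_q (h : Runs L X s lab mk n p q) (hq : ∀ i < n, φ (q i) = p (n - 1 - i)) {i : ℕ}
    (hi : i < n) : s (φ (q i)) = p (n - i) := by
  rw [hq i hi, h.p_succ _ (by omega)]
  congr 1
  omega

end Runs

end ThinFatgraph

namespace ThinFatgraph
namespace Runs

variable {k L : ℕ} {D : Type} {X : Set D} {s : D → D} {lab : D → Letter k} {mk : D → Prop}
  {n : ℕ} {p q : ℕ → D} {φ : D → D}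

theorem flip_facts (h : Runs L X s lab mk n p q) (hp : ∀ i < n, φ (p i) = q (n - 1 - i))
    (hq : ∀ i < n, φ (q i) = p (n - 1 - i)) :
    (∀ i < n, φ (p i) ∈ X ∧ φ (φ (p i)) = p i ∧ lab (φ (p i)) = (lab (p i)).inv) ∧
    (∀ i < n, φ (q i) ∈ X ∧ φ (φ (q i)) = q i ∧ lab (φ (q i)) = (lab (q i)).inv) := by
  have e : ∀ i < n, n - 1 - (n - 1 - i) = i := fun i hi => by omega
  refine ⟨fun i hi => ⟨?_, ?_, ?_⟩, fun i hi => ⟨?_, ?_, ?_⟩⟩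
  · rw [hp i hi]; exact h.q_mem _ (by omega)
  · rw [hp i hi, hq _ (by omega), e i hi]
  · rw [hp i hi, h.lab_q i hi]
  · rw [hq i hi]; exact h.p_mem _ (by omega)
  · rw [hq i hi, hp _ (by omega), e i hi]
  · rw [hq i hi]
    have := h.lab_q (n - 1 - i) (by omega)
    rw [e i hi] at this
    rw [this, Letter.inv_inv]

/-- The vertices in the interior of a glued edge. -/
theorem interior_vertex (h : Runs L X s lab mk n p q) (hp : ∀ i < n, φ (p i) = q (n - 1 - i))
    (hq : ∀ i < n, φ (q i) = p (n - 1 - i)) {i : ℕ} (h0 : 0 < i) (hi : i < n) :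
    (s (φ (p i)) = q (n - i) ∧ s (φ (s (φ (p i)))) = p i) ∧
    (s (φ (q i)) = p (n - i) ∧ s (φ (s (φ (q i)))) = q i) := by
  have e : n - (n - i) = i := by omega
  refine ⟨⟨h.next_p hp hi, ?_⟩, h.next_q hq hi, ?_⟩
  · rw [h.next_p hp hi, h.next_q hq (by omega), e]
  · rw [h.next_q hq hi, h.next_p hp (by omega), e]

/-- Two antiparallel runs can be glued if the result of the surgery bounds. -/
theorem thin_surgery (h : Runs L X s lab mk n p q) (hL : 0 < L)
    {X' : Set D} (hX' : ∀ d, d ∈ X' ↔ d ∈ X ∧ (∀ i < n, d ≠ p i) ∧ (∀ i < n, d ≠ q i))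
    (hpn : p n ∈ X') (hqn : q n ∈ X') (mpn : ¬ mk (p n)) (mqn : ¬ mk (q n)) (mq0 : ¬ mk (q 0))
    {s' : D → D} (hs1 : ∀ d ∈ X', s d = p 0 → s' d = q n)
    (hs2 : ∀ d ∈ X', s d = q 0 → s' d = p n)
    (hs3 : ∀ d ∈ X', s d ≠ p 0 → s d ≠ q 0 → s' d = s d)
    {mk' : D → Prop} (hmk : ∀ d, mk' d ↔ mk d ∨ d = p n ∨ d = q n)
    (ht : Thin L X' s' lab mk') : Thin L X s lab mk := by
  classical
  have hn := h.pos
  obtain ⟨ψ, ψ1, ψ2, ψ3, ψ4⟩ := ht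
  obtain ⟨φ, hp, hq, hφ⟩ := h.exists_flip ψ
  obtain ⟨fp, fq⟩ := h.flip_facts hp hq
  have hφ' : ∀ d ∈ X', φ d = ψ d := fun d hd => hφ d ((hX' d).1 hd).2.1 ((hX' d).1 hd).2.2
  have hXX : ∀ d ∈ X', d ∈ X := fun d hd => ((hX' d).1 hd).1
  have p0 : ∀ i < n, p i ∉ X' := fun i hi hm => ((hX' _).1 hm).2.1 i hi rfl
  have q0 : ∀ i < n, q i ∉ X' := fun i hi hm => ((hX' _).1 hm).2.2 i hi rfl
  have cases : ∀ d ∈ X, d ∈ X' ∨ (∃ i < n, d = p i) ∨ (∃ i < n, d = q i) := by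
    intro d hd
    by_cases h1 : ∃ i < n, d = p i
    · exact .inr (.inl h1)
    by_cases h2 : ∃ i < n, d = q i
    · exact .inr (.inr h2)
    push Not at h1 h2
    exact .inl ((hX' d).2 ⟨hd, h1, h2⟩)
  -- Injectivity of `s` carries the disjointness of the runs one step beyond their ends.
  have pqn : p n ≠ q n := by
    intro e
    have e1 := h.p_succ (n - 1) (by omega)
    have e2 := h.q_succ (n - 1) (by omega)
    rw [Nat.sub_add_cancel hn] at e1 e2
    exact h.pq _ (by omega) _ (by omega)
      (h.inj (h.p_mem (n - 1) (by omega)) (h.q_mem (n - 1) (by omega)) (by rw [e1, e2, e]))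
  -- A surviving dart can enter a run only at its beginning: all later darts of the runs, and also
  -- `p n` and `q n`, have their unique predecessor inside the runs.
  have tri : ∀ e ∈ X', (s e = p 0 ∧ s' e = q n) ∨ (s e = q 0 ∧ s' e = p n) ∨
      (s e = s' e ∧ s' e ∈ X' ∧ s' e ≠ p n ∧ s' e ≠ q n) := by
    intro e he
    by_cases h1 : s e = p 0
    · exact .inl ⟨h1, hs1 e he h1⟩
    by_cases h2 : s e = q 0
    · exact .inr (.inl ⟨h2, hs2 e he h2⟩)
    have h3 := hs3 e he h1 h2
    have np : ∀ i ≤ n, s e ≠ p i := by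
      intro i hi hc
      rcases i with _ | i
      · exact h1 hc
      · rw [← h.p_succ i (by omega)] at hc
        exact p0 i (by omega) (h.inj (hXX e he) (h.p_mem i (by omega)) hc ▸ he)
    have nq : ∀ i ≤ n, s e ≠ q i := by
      intro i hi hc
      rcases i with _ | i
      · exact h2 hc
      · rw [← h.q_succ i (by omega)] at hc
        exact q0 i (by omega) (h.inj (hXX e he) (h.q_mem i (by omega)) hc ▸ he)
    rw [h3]
    exact .inr (.inr ⟨rfl, (hX' _).2 ⟨h.maps e (hXX e he), fun i hi => np i hi.le,
      fun i hi => nq i hi.le⟩, np n le_rfl, nq n le_rfl⟩)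
  have s'X : ∀ e ∈ X', s' e ∈ X' := by
    intro e he
    rcases tri e he with ⟨_, h2⟩ | ⟨_, h2⟩ | ⟨_, h2, _⟩
    · rwa [h2]
    · rwa [h2]
    · exact h2
  have nx : ∀ d ∈ X', (s (φ d) = p 0 ∧ s' (ψ d) = q n) ∨ (s (φ d) = q 0 ∧ s' (ψ d) = p n) ∨
      (s (φ d) = s' (ψ d) ∧ s' (ψ d) ≠ p n ∧ s' (ψ d) ≠ q n) := by
    intro d hd
    rw [hφ' d hd]
    rcases tri _ (ψ1 d hd).1 with h1 | h1 | h1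
    · exact .inl h1
    · exact .inr (.inl h1)
    · exact .inr (.inr ⟨h1.1, h1.2.2⟩)
  have nxX : ∀ d ∈ X', s' (ψ d) ∈ X' := fun d hd => s'X _ (ψ1 d hd).1
  have np0 : s (φ (p 0)) = q n := h.next_p hp hn
  have nq0 : s (φ (q 0)) = p n := h.next_q hq hn
  -- the two new trivalent vertices
  have hnew : ∀ a b x : D, (a = q n ∧ b = p n ∧ x = p 0) ∨ (a = p n ∧ b = q n ∧ x = q 0) →
      ∃ z ∈ X', z ≠ a ∧ s (φ a) = z ∧ s (φ z) = x ∧ ¬ mk z := by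
    intro a b x hax
    have haX : a ∈ X' := by rcases hax with ⟨h1, _, _⟩ | ⟨h1, _, _⟩ <;> rwa [h1]
    have ma : mk' a := (hmk a).2 (by rcases hax with ⟨h1, _, _⟩ | ⟨h1, _, _⟩ <;> simp [h1])
    obtain ⟨v1, v2⟩ := ψ2 a haX
    -- The corner at `a` is newly marked, so its vertex in the smaller system consists of two darts
    -- and this mark; the glued edge takes the place of the mark.
    rcases v2 with ⟨v2, v3⟩ | ⟨_, _, v3, _⟩
    swap
    · exact absurd ma v3
    have mz : ¬ mk' (s' (ψ a)) := fun hm => v3 ⟨ma, hm⟩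
    rw [hmk] at mz
    push Not at mz
    have e1 : s (φ a) = s' (ψ a) := by
      rcases nx a haX with h1 | h1 | h1
      · exact absurd h1.2 mz.2.2
      · exact absurd h1.2 mz.2.1
      · exact h1.1
    refine ⟨s' (ψ a), nxX a haX, v1, e1, ?_, mz.1⟩
    have h2 := nx _ (nxX a haX)
    rw [v2] at h2
    rcases hax with ⟨rfl, rfl, rfl⟩ | ⟨rfl, rfl, rfl⟩
    · rcases h2 with h2 | h2 | h2
      · exact h2.1
      · exact absurd h2.2.symm pqn
      · exact absurd rfl h2.2.2
    · rcases h2 with h2 | h2 | h2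
      · exact absurd h2.2 pqn
      · exact h2.1
      · exact absurd rfl h2.2.1
  obtain ⟨zp, zpX, zp1, zp2, zp3, zp4⟩ := hnew _ _ _ (.inl ⟨rfl, rfl, rfl⟩)
  obtain ⟨zq, zqX, zq1, zq2, zq3, zq4⟩ := hnew _ _ _ (.inr ⟨rfl, rfl, rfl⟩)
  -- old vertices
  have old : ∀ d ∈ X', (s (φ d) ≠ d ∧
      ((s (φ (s (φ d))) = d ∧ ¬ (mk d ∧ mk (s (φ d)))) ∨
       (s (φ (s (φ d))) ≠ d ∧ s (φ (s (φ (s (φ d))))) = d ∧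
         ¬ mk d ∧ ¬ mk (s (φ d)) ∧ ¬ mk (s (φ (s (φ d))))))) ∧
      ((s (φ (s (φ d))) ≠ d ∨ mk d ∨ mk (s (φ d))) ↔
        (s' (ψ (s' (ψ d))) ≠ d ∨ mk' d ∨ mk' (s' (ψ d)))) := by
    intro d hd
    by_cases hdq : d = q n
    · subst hdq
      have hz : zp ≠ p 0 := fun e => p0 0 hn (e ▸ zpX)
      have hz' : p 0 ≠ q n := fun e => p0 0 hn (e ▸ hd)
      rw [zp2, zp3, np0]
      exact ⟨⟨zp1, .inr ⟨hz', rfl, mqn, zp4, h.p_unmarked⟩⟩,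
        ⟨fun _ => .inr (.inl ((hmk _).2 (by simp))), fun _ => .inl hz'⟩⟩
    by_cases hdp : d = p n
    · subst hdp
      have hz' : q 0 ≠ p n := fun e => q0 0 hn (e ▸ hd)
      rw [zq2, zq3, nq0]
      exact ⟨⟨zq1, .inr ⟨hz', rfl, mpn, zq4, mq0⟩⟩,
        ⟨fun _ => .inr (.inl ((hmk _).2 (by simp))), fun _ => .inl hz'⟩⟩
    have md : mk' d ↔ mk d := by rw [hmk]; simp [hdq, hdp]
    obtain ⟨v1, v2⟩ := ψ2 d hd
    have back : ∀ y ∈ X', s' (ψ y) = d → s (φ y) = d := by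
      intro y hy e
      rcases nx y hy with h1 | h1 | h1
      · exact absurd (e.symm.trans h1.2) hdq
      · exact absurd (e.symm.trans h1.2) hdp
      · exact h1.1.trans e
    rcases nx d hd with ⟨h1, h2⟩ | ⟨h1, h2⟩ | ⟨h1, h2, h3⟩
    · rw [h2] at v1 v2 ⊢
      have mb : mk' (q n) := (hmk _).2 (by simp)
      rcases v2 with ⟨v2, v3⟩ | ⟨_, _, _, v3, _⟩
      swap
      · exact absurd mb v3
      have := back _ hqn v2
      have e0 : p 0 ≠ d := fun e => p0 0 hn (e ▸ hd)
      rw [h1, np0, this]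
      refine ⟨⟨e0, .inr ⟨v1, rfl, fun hm => v3 ⟨md.2 hm, mb⟩, h.p_unmarked, mqn⟩⟩,
        ⟨fun _ => .inr (.inr mb), fun _ => .inl v1⟩⟩
    · rw [h2] at v1 v2 ⊢
      have mb : mk' (p n) := (hmk _).2 (by simp)
      rcases v2 with ⟨v2, v3⟩ | ⟨_, _, _, v3, _⟩
      swap
      · exact absurd mb v3
      have := back _ hpn v2
      have e0 : q 0 ≠ d := fun e => q0 0 hn (e ▸ hd)
      rw [h1, nq0, this]
      refine ⟨⟨e0, .inr ⟨v1, rfl, fun hm => v3 ⟨md.2 hm, mb⟩, mq0, mpn⟩⟩,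
        ⟨fun _ => .inr (.inr mb), fun _ => .inl v1⟩⟩
    · have md2 : mk' (s' (ψ d)) ↔ mk (s' (ψ d)) := by rw [hmk]; simp [h2, h3]
      rcases v2 with ⟨v2, v3⟩ | ⟨w1, w2, w3, w4, w5⟩
      · have := back _ (nxX d hd) v2
        rw [h1, this, v2, md, md2]
        rw [md, md2] at v3
        exact ⟨⟨v1, .inl ⟨rfl, v3⟩⟩, Iff.rfl⟩
      · have md3 := w5
        rw [hmk] at md3
        push Not at md3
        have e3 : s (φ (s' (ψ d))) = s' (ψ (s' (ψ d))) := by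
          rcases nx _ (nxX d hd) with h1 | h1 | h1
          · exact absurd h1.2 md3.2.2
          · exact absurd h1.2 md3.2.1
          · exact h1.1
        have := back _ (nxX _ (nxX d hd)) w2
        rw [h1, e3, this]
        exact ⟨⟨v1, .inr ⟨w1, rfl, fun hm => w3 (md.2 hm), fun hm => w4 (md2.2 hm), md3.1⟩⟩,
          ⟨fun _ => .inl w1, fun _ => .inl w1⟩⟩
  have specp : ∀ i < n, (s (φ (s (φ (p i)))) ≠ p i ∨ mk (p i) ∨ mk (s (φ (p i)))) →
      i = 0 ∨ mk (p i) := by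
    intro i hi hsp
    rcases Nat.eq_zero_or_pos i with rfl | h0
    · exact .inl rfl
    obtain ⟨⟨e1, e2⟩, -⟩ := h.interior_vertex hp hq h0 hi
    rw [e2, e1] at hsp
    rcases hsp with hsp | hsp | hsp
    · exact absurd rfl hsp
    · exact .inr hsp
    · exact absurd hsp (h.q_unmarked _ (by omega) (by omega))
  -- The vertex at position `i` of `q` is the one at position `n - i` of `p`, where all marks inside
  -- the edge are visible.
  have specq : ∀ i < n, (s (φ (s (φ (q i)))) ≠ q i ∨ mk (q i) ∨ mk (s (φ (q i)))) →
      n - i = n ∨ mk (p (n - i)) := by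
    intro i hi hsp
    rcases Nat.eq_zero_or_pos i with rfl | h0
    · exact .inl rfl
    obtain ⟨-, ⟨e1, e2⟩⟩ := h.interior_vertex hp hq h0 hi
    rw [e2, e1] at hsp
    rcases hsp with hsp | hsp | hsp
    · exact absurd rfl hsp
    · exact absurd hsp (h.q_unmarked _ (by omega) (by omega))
    · exact .inr hsp
  -- The two boundary walks differ only where the smaller one arrives at `p n` or `q n`. These are
  -- marked there, hence are not reached in fewer than `L` steps from a trivalent vertex.
  have walk : ∀ d ∈ X', (s (φ (s (φ d))) ≠ d ∨ mk d ∨ mk (s (φ d))) → ∀ j, j < L →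
      s^[j] d = s'^[j] d ∧ s^[j] d ∈ X' := by
    intro d hd hsp j
    induction j with
    | zero => exact fun _ => ⟨rfl, hd⟩
    | succ j ih =>
      intro hj
      obtain ⟨e1, e2⟩ := ih (by omega)
      have hno := ψ3 d hd ((old d hd).2.1 hsp) (j + 1) (by omega) hj
      rw [Function.iterate_succ_apply', ← e1] at hno
      rw [Function.iterate_succ_apply', Function.iterate_succ_apply', ← e1]
      rcases tri _ e2 with ⟨_, h2⟩ | ⟨_, h2⟩ | ⟨h1, h2, _⟩
      · exact absurd (.inr (.inl ((hmk _).2 (by rw [h2]; simp)))) hno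
      · exact absurd (.inr (.inl ((hmk _).2 (by rw [h2]; simp)))) hno
      · exact ⟨h1, h1 ▸ h2⟩
  refine ⟨φ, ?_, ?_, ?_, ?_⟩
  · intro d hd
    rcases cases d hd with h1 | ⟨i, hi, rfl⟩ | ⟨i, hi, rfl⟩
    · obtain ⟨e1, e2, e3⟩ := ψ1 d h1
      rw [hφ' d h1, hφ' _ e1]
      exact ⟨hXX _ e1, e2, e3⟩
    · exact fp i hi
    · exact fq i hi
  · intro d hd
    rcases cases d hd with h1 | ⟨i, hi, rfl⟩ | ⟨i, hi, rfl⟩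
    · exact (old d h1).1
    · rcases Nat.eq_zero_or_pos i with rfl | h0
      · rw [np0, zp2, zp3]
        exact ⟨fun e => p0 0 hn (e ▸ hqn), .inr ⟨fun e => p0 0 hn (e ▸ zpX), rfl, h.p_unmarked,
          mqn, zp4⟩⟩
      · obtain ⟨⟨e1, e2⟩, -⟩ := h.interior_vertex hp hq h0 hi
        rw [e2, e1]
        exact ⟨fun e => h.pq _ hi _ (by omega) e.symm,
          .inl ⟨rfl, fun hm => h.q_unmarked _ (by omega) (by omega) hm.2⟩⟩
    · rcases Nat.eq_zero_or_pos i with rfl | h0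
      · rw [nq0, zq2, zq3]
        exact ⟨fun e => q0 0 hn (e ▸ hpn), .inr ⟨fun e => q0 0 hn (e ▸ zqX), rfl, mq0,
          mpn, zq4⟩⟩
      · obtain ⟨-, ⟨e1, e2⟩⟩ := h.interior_vertex hp hq h0 hi
        rw [e2, e1]
        exact ⟨fun e => h.pq _ (by omega) _ hi e,
          .inl ⟨rfl, fun hm => h.q_unmarked _ h0 hi hm.1⟩⟩
  · intro d hd hsp j j0 jL
    rcases cases d hd with h1 | ⟨i, hi, rfl⟩ | ⟨i, hi, rfl⟩
    · obtain ⟨e1, e2⟩ := walk d h1 hsp j jL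
      rw [(old _ e2).2, e1]
      exact ψ3 d h1 ((old d h1).2.1 hsp) j j0 jL
    · have hi' := specp i hi hsp
      have hlt : i + j < n := by
        have := h.sep i n hi le_rfl hi' (.inl rfl)
        omega
      rw [h.iterate_p j i hlt.le]
      intro hsp2
      rcases specp _ hlt hsp2 with h0 | h0
      · omega
      · have := h.sep i (i + j) (by omega) hlt.le hi' (.inr h0)
        omega
    · have hi' := specq i hi hsp
      have hlt : i + j < n := by
        have := h.sep 0 (n - i) (by omega) (by omega) (.inl rfl) hi'
        omega
      rw [h.iterate_q j i hlt.le]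
      intro hsp2
      rcases specq _ hlt hsp2 with h0 | h0
      · omega
      · have := h.sep (n - (i + j)) (n - i) (by omega) (by omega) (.inr h0) hi'
        omega
  -- Following the walk of the smaller system, either its trivalent vertex is reached or a cut is
  -- met first, and the cut is itself a new trivalent vertex.
  · have circ : ∀ j, ∀ d ∈ X', (s' (ψ (s' (ψ (s'^[j] d)))) ≠ s'^[j] d ∨ mk' (s'^[j] d) ∨
        mk' (s' (ψ (s'^[j] d)))) →
        ∃ j, (s (φ (s (φ (s^[j] d)))) ≠ s^[j] d ∨ mk (s^[j] d) ∨ mk (s (φ (s^[j] d)))) := by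
      intro j
      induction j with
      | zero => exact fun d hd hsp => ⟨0, (old d hd).2.2 hsp⟩
      | succ j ih =>
        intro d hd hsp
        rcases tri d hd with ⟨h1, _⟩ | ⟨h1, _⟩ | ⟨h1, h2, _⟩
        · refine ⟨1, .inl ?_⟩
          rw [Function.iterate_one, h1, np0, zp2]
          exact fun e => p0 0 hn (e ▸ zpX)
        · refine ⟨1, .inl ?_⟩
          rw [Function.iterate_one, h1, nq0, zq2]
          exact fun e => q0 0 hn (e ▸ zqX)
        · obtain ⟨j', hj'⟩ := ih (s' d) h2 (by simpa [Function.iterate_succ_apply] using hsp)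
          refine ⟨j' + 1, ?_⟩
          rw [Function.iterate_succ_apply, h1]
          exact hj'
    intro d hd
    rcases cases d hd with h1 | ⟨i, hi, rfl⟩ | ⟨i, hi, rfl⟩
    · obtain ⟨j, hj⟩ := ψ4 d h1
      exact circ j d h1 hj
    · refine ⟨n - i, ?_⟩
      rw [h.iterate_p _ _ (by omega), show i + (n - i) = n by omega]
      exact (old _ hpn).2.2 (.inr (.inl ((hmk _).2 (by simp))))
    · refine ⟨n - i, ?_⟩
      rw [h.iterate_q _ _ (by omega), show i + (n - i) = n by omega]
      exact (old _ hqn).2.2 (.inr (.inl ((hmk _).2 (by simp))))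

/-- Two antiparallel loops can be glued if there is a single mark at the common base point and
the remaining loops bound. -/
theorem thin_annulus (h : Runs L X s lab mk n p q)
    {X' : Set D} (hX' : ∀ d, d ∈ X' ↔ d ∈ X ∧ (∀ i < n, d ≠ p i) ∧ (∀ i < n, d ≠ q i))
    (hpn : p n = p 0) (hqn : q n = q 0) (mq0 : mk (q 0))
    (ht : Thin L X' s lab mk) : Thin L X s lab mk := by
  classical
  have hn := h.pos
  obtain ⟨ψ, ψ1, ψ2, ψ3, ψ4⟩ := ht
  obtain ⟨φ, hp, hq, hφ⟩ := h.exists_flip ψ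
  obtain ⟨fp, fq⟩ := h.flip_facts hp hq
  have hφ' : ∀ d ∈ X', φ d = ψ d := fun d hd => hφ d ((hX' d).1 hd).2.1 ((hX' d).1 hd).2.2
  have hXX : ∀ d ∈ X', d ∈ X := fun d hd => ((hX' d).1 hd).1
  have p0 : ∀ i < n, p i ∉ X' := fun i hi hm => ((hX' _).1 hm).2.1 i hi rfl
  have q0 : ∀ i < n, q i ∉ X' := fun i hi hm => ((hX' _).1 hm).2.2 i hi rfl
  have cases : ∀ d ∈ X, d ∈ X' ∨ (∃ i < n, d = p i) ∨ (∃ i < n, d = q i) := by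
    intro d hd
    by_cases h1 : ∃ i < n, d = p i
    · exact .inr (.inl h1)
    by_cases h2 : ∃ i < n, d = q i
    · exact .inr (.inr h2)
    push Not at h1 h2
    exact .inl ((hX' d).2 ⟨hd, h1, h2⟩)
  have sX : ∀ e ∈ X', s e ∈ X' := by
    intro e he
    refine (hX' _).2 ⟨h.maps e (hXX e he), ?_, ?_⟩
    · intro i hi hc
      have : ∃ i' < n, s (p i') = p i := by
        rcases i with _ | i
        · refine ⟨n - 1, by omega, ?_⟩
          rw [h.p_succ _ (by omega), Nat.sub_add_cancel hn, hpn]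
        · exact ⟨i, by omega, h.p_succ _ (by omega)⟩
      obtain ⟨i', hi', e'⟩ := this
      exact p0 i' hi' (h.inj (hXX e he) (h.p_mem i' hi') (hc.trans e'.symm) ▸ he)
    · intro i hi hc
      have : ∃ i' < n, s (q i') = q i := by
        rcases i with _ | i
        · refine ⟨n - 1, by omega, ?_⟩
          rw [h.q_succ _ (by omega), Nat.sub_add_cancel hn, hqn]
        · exact ⟨i, by omega, h.q_succ _ (by omega)⟩
      obtain ⟨i', hi', e'⟩ := this
      exact q0 i' hi' (h.inj (hXX e he) (h.q_mem i' hi') (hc.trans e'.symm) ▸ he)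
  have np0 : s (φ (p 0)) = q 0 := (h.next_p hp hn).trans hqn
  have nq0 : s (φ (q 0)) = p 0 := (h.next_q hq hn).trans hpn
  have nx : ∀ d ∈ X', s (φ d) = s (ψ d) := fun d hd => by rw [hφ' d hd]
  have nxX : ∀ d ∈ X', s (ψ d) ∈ X' := fun d hd => sX _ (ψ1 d hd).1
  have specp : ∀ i < n, (s (φ (s (φ (p i)))) ≠ p i ∨ mk (p i) ∨ mk (s (φ (p i)))) →
      i = 0 ∨ mk (p i) := by
    intro i hi hsp
    rcases Nat.eq_zero_or_pos i with rfl | h0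
    · exact .inl rfl
    obtain ⟨⟨e1, e2⟩, -⟩ := h.interior_vertex hp hq h0 hi
    rw [e2, e1] at hsp
    rcases hsp with hsp | hsp | hsp
    · exact absurd rfl hsp
    · exact .inr hsp
    · exact absurd hsp (h.q_unmarked _ (by omega) (by omega))
  have specq : ∀ i < n, (s (φ (s (φ (q i)))) ≠ q i ∨ mk (q i) ∨ mk (s (φ (q i)))) →
      n - i = n ∨ mk (p (n - i)) := by
    intro i hi hsp
    rcases Nat.eq_zero_or_pos i with rfl | h0
    · exact .inl rfl
    obtain ⟨-, ⟨e1, e2⟩⟩ := h.interior_vertex hp hq h0 hi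
    rw [e2, e1] at hsp
    rcases hsp with hsp | hsp | hsp
    · exact absurd rfl hsp
    · exact absurd hsp (h.q_unmarked _ (by omega) (by omega))
    · exact .inr hsp
  have itX : ∀ j, ∀ d ∈ X', s^[j] d ∈ X' := by
    intro j
    induction j with
    | zero => exact fun d hd => hd
    | succ j ih => exact fun d hd => ih _ (sX d hd)
  refine ⟨φ, ?_, ?_, ?_, ?_⟩
  · intro d hd
    rcases cases d hd with h1 | ⟨i, hi, rfl⟩ | ⟨i, hi, rfl⟩
    · obtain ⟨e1, e2, e3⟩ := ψ1 d h1
      rw [hφ' d h1, hφ' _ e1]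
      exact ⟨hXX _ e1, e2, e3⟩
    · exact fp i hi
    · exact fq i hi
  · intro d hd
    rcases cases d hd with h1 | ⟨i, hi, rfl⟩ | ⟨i, hi, rfl⟩
    · have := ψ2 d h1
      rwa [nx d h1, nx _ (nxX d h1), nx _ (nxX _ (nxX d h1))]
    · rcases Nat.eq_zero_or_pos i with rfl | h0
      · rw [np0, nq0]
        exact ⟨fun e => h.pq _ hn _ hn e.symm, .inl ⟨rfl, fun hm => h.p_unmarked hm.1⟩⟩
      · obtain ⟨⟨e1, e2⟩, -⟩ := h.interior_vertex hp hq h0 hi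
        rw [e2, e1]
        exact ⟨fun e => h.pq _ hi _ (by omega) e.symm,
          .inl ⟨rfl, fun hm => h.q_unmarked _ (by omega) (by omega) hm.2⟩⟩
    · rcases Nat.eq_zero_or_pos i with rfl | h0
      · rw [nq0, np0]
        exact ⟨fun e => h.pq _ hn _ hn e, .inl ⟨rfl, fun hm => h.p_unmarked hm.2⟩⟩
      · obtain ⟨-, ⟨e1, e2⟩⟩ := h.interior_vertex hp hq h0 hi
        rw [e2, e1]
        exact ⟨fun e => h.pq _ (by omega) _ hi e,
          .inl ⟨rfl, fun hm => h.q_unmarked _ h0 hi hm.1⟩⟩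
  · intro d hd hsp j j0 jL
    rcases cases d hd with h1 | ⟨i, hi, rfl⟩ | ⟨i, hi, rfl⟩
    · have := ψ3 d h1
      rw [nx d h1, nx _ (nxX d h1)] at hsp
      rw [nx _ (itX j d h1), nx _ (nxX _ (itX j d h1))]
      exact this hsp j j0 jL
    · have hi' := specp i hi hsp
      have hlt : i + j < n := by
        have := h.sep i n hi le_rfl hi' (.inl rfl)
        omega
      rw [h.iterate_p j i hlt.le]
      intro hsp2
      rcases specp _ hlt hsp2 with h0 | h0
      · omega
      · have := h.sep i (i + j) (by omega) hlt.le hi' (.inr h0)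
        omega
    · have hi' := specq i hi hsp
      have hlt : i + j < n := by
        have := h.sep 0 (n - i) (by omega) (by omega) (.inl rfl) hi'
        omega
      rw [h.iterate_q j i hlt.le]
      intro hsp2
      rcases specq _ hlt hsp2 with h0 | h0
      · omega
      · have := h.sep (n - (i + j)) (n - i) (by omega) (by omega) (.inr h0) hi'
        omega
  · intro d hd
    rcases cases d hd with h1 | ⟨i, hi, rfl⟩ | ⟨i, hi, rfl⟩
    · obtain ⟨j, hj⟩ := ψ4 d h1
      refine ⟨j, ?_⟩
      rwa [nx _ (itX j d h1), nx _ (nxX _ (itX j d h1))]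
    · refine ⟨n - i, .inr (.inr ?_)⟩
      rw [h.iterate_p _ _ (by omega), show i + (n - i) = n by omega, hpn, np0]
      exact mq0
    · refine ⟨n - i, .inr (.inl ?_)⟩
      rw [h.iterate_q _ _ (by omega), show i + (n - i) = n by omega, hqn]
      exact mq0

end Runs
end ThinFatgraph

namespace ThinFatgraph

/-! ### Systems of disjoint cycles, represented by lists -/

section Systems

variable {k L : ℕ} {D : Type}

/-- The map `s` sends each dart of the list to the following one, and the last one to `e`. -/
def Run (s : D → D) : List D → D → Prop
  | [], _ => True
  | d :: l, e => s d = l.headD e ∧ Run s l e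

theorem run_append {s : D → D} : ∀ {a b : List D} {e : D},
    Run s (a ++ b) e ↔ Run s a (b.headD e) ∧ Run s b e
  | [], b, e => by simp [Run]
  | d :: a, b, e => by
    simp only [List.cons_append, Run, run_append (a := a)]
    rcases a with _ | ⟨x, a⟩ <;> simp [and_assoc]

theorem Run.congr {s s' : D → D} : ∀ {l : List D} {e : D}, (∀ d ∈ l, s' d = s d) → Run s l e →
    Run s' l e
  | [], _, _, _ => trivial
  | d :: l, e, h, hr =>
    ⟨(h d (by simp)).trans hr.1, Run.congr (fun x hx => h x (by simp [hx])) hr.2⟩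

theorem Run.map_eq {s : D → D} : ∀ {l : List D} {e : D}, Run s l e → l.map s = (l ++ [e]).tail
  | [], _, _ => rfl
  | [d], e, h => by simpa using h.1
  | d :: x :: l, e, h => by
    have := Run.map_eq h.2
    simp only [List.map_cons, List.cons_append, List.tail_cons] at this ⊢
    rw [this]
    have h1 := h.1
    simp at h1
    rw [h1]

theorem Run.getD {s : D → D} : ∀ {l : List D} {e : D}, Run s l e → ∀ i < l.length,
    s (l.getD i e) = l.getD (i + 1) e
  | [], _, _, _, hi => absurd hi (by simp)
  | d :: l, e, h, 0, _ => by
    have := h.1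
    rcases l with _ | ⟨x, l⟩ <;> simpa using this
  | d :: l, e, h, i + 1, hi => by
    simpa using h.2.getD i (by simpa using hi)

/-- The list is a cycle of `s`. -/
def IsCyc (s : D → D) (c : List D) : Prop := ∀ e, c.head? = some e → Run s c e

theorem IsCyc.map_perm {s : D → D} {c : List D} (h : IsCyc s c) : (c.map s).Perm c := by
  rcases c with _ | ⟨x, c⟩
  · simp
  · rw [(h x rfl).map_eq]
    simpa using List.perm_append_singleton x c

theorem IsCyc.rot {s : D → D} {a b : List D} (h : IsCyc s (a ++ b)) : IsCyc s (b ++ a) := by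
  rcases a with _ | ⟨x, a⟩
  · simpa using h
  rcases b with _ | ⟨y, b⟩
  · simpa using h
  intro e he
  have h1 := h x rfl
  rw [run_append] at h1
  have : y = e := by simpa using he
  subst this
  rw [run_append]
  exact ⟨h1.2, h1.1⟩

/-- A collection of pairwise disjoint cycles of `s`. -/
structure IsSystem (s : D → D) (C : Multiset (List D)) : Prop where
  nodup : (C.bind fun c => (c : Multiset D)).Nodup
  cyc : ∀ c ∈ C, IsCyc s c

/-- The darts of a collection of cycles. -/
def darts (C : Multiset (List D)) : Set D := {d | d ∈ C.bind fun c => (c : Multiset D)}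

theorem mem_darts {C : Multiset (List D)} {d : D} : d ∈ darts C ↔ ∃ c ∈ C, d ∈ c := by
  simp [darts, Multiset.mem_bind]

/-- On each cycle `s` acts as a rotation, so it permutes the multiset of all darts. As this multiset
has no repetitions, injectivity and invariance follow without any argument about inverses. -/
theorem IsSystem.map_eq {s : D → D} {C : Multiset (List D)} (h : IsSystem s C) :
    (C.bind fun c => (c : Multiset D)).map s = C.bind fun c => (c : Multiset D) := by
  rw [Multiset.map_bind]
  refine Multiset.bind_congr fun c hc => ?_
  rw [Multiset.map_coe]
  exact Multiset.coe_eq_coe.2 (h.cyc c hc).map_perm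

theorem IsSystem.injOn {s : D → D} {C : Multiset (List D)} (h : IsSystem s C) :
    Set.InjOn s (darts C) := by
  intro x hx y hy hxy
  have : ((C.bind fun c => (c : Multiset D)).map s).Nodup := by
    rw [h.map_eq]; exact h.nodup
  exact Multiset.inj_on_of_nodup_map this x hx y hy hxy

theorem IsSystem.maps {s : D → D} {C : Multiset (List D)} (h : IsSystem s C) :
    ∀ d ∈ darts C, s d ∈ darts C := by
  intro d hd
  have := Multiset.mem_map_of_mem s (show d ∈ C.bind fun c => (c : Multiset D) from hd)
  rw [h.map_eq] at this
  exact this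

theorem marked_map {lab : D → Letter k} {mk : D → Bool} {c : List D} {i : ℕ} {e : D} :
    Marked (c.map fun d => (lab d, mk d)) i ↔ i < c.length ∧ mk (c.getD i e) = true := by
  simp only [Marked, List.getElem?_map, Option.map_eq_some_iff, Prod.mk.injEq]
  constructor
  · rintro ⟨x, d, hd, -, h2⟩
    obtain ⟨hi, rfl⟩ := List.getElem?_eq_some_iff.1 hd
    refine ⟨hi, ?_⟩
    rw [List.getD_eq_getElem _ _ hi]
    exact h2
  · rintro ⟨hi, h⟩
    rw [List.getD_eq_getElem _ _ hi] at h
    exact ⟨lab ((c)[i]'hi), (c)[i]'hi, List.getElem?_eq_getElem hi, rfl, h⟩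

/-- The default values of `getD` are the darts that follow the two runs, so the sequences take the
right value also at the index just beyond the lists. -/
theorem runs_of_lists {X : Set D} {s : D → D} {lab : D → Letter k} {mk : D → Bool}
    {cu cv : List D} {a b : D} (hmaps : ∀ d ∈ X, s d ∈ X) (hinj : Set.InjOn s X)
    (hu : ∀ d ∈ cu, d ∈ X) (hv : ∀ d ∈ cv, d ∈ X) (nd : (cu ++ cv).Nodup)
    (ru : Run s cu a) (rv : Run s cv b)
    (hsep : Sep L (cu.map fun d => (lab d, mk d)))
    (hlab : cv.map lab = wordInv (cu.map lab))
    (hq : ∀ i, 0 < i → i < cv.length → ¬ Marked (cv.map fun d => (lab d, mk d)) i) :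
    Runs L X s lab (fun d => mk d = true) cu.length (cu.getD · a) (cv.getD · b) := by
  have hlen : cv.length = cu.length := by
    have := congrArg List.length hlab
    simpa [wordInv] using this
  obtain ⟨nd1, nd2, nd3⟩ := List.nodup_append.1 nd
  have gu : ∀ i (hi : i < cu.length), cu.getD i a = cu[i] := fun i hi =>
    List.getD_eq_getElem _ _ hi
  have gv : ∀ i (hi : i < cu.length), cv.getD i b = cv[i]'(by omega) := fun i hi =>
    List.getD_eq_getElem _ _ (by omega)
  refine ⟨?_, hmaps, hinj, ?_, ?_, ?_, ?_, ?_, ru.getD, ?_, ?_, ?_, ?_, ?_⟩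
  · have := hsep.ne_nil
    exact List.length_pos_iff.2 (by simpa using this)
  · intro i hi; rw [gu i hi]; exact hu _ (List.getElem_mem _)
  · intro i hi; rw [gv i hi]; exact hv _ (List.getElem_mem _)
  · intro i hi j hj e
    rw [gu i hi, gu j hj] at e
    exact (List.Nodup.getElem_inj_iff nd1).1 e
  · intro i hi j hj e
    rw [gv i hi, gv j hj] at e
    exact (List.Nodup.getElem_inj_iff nd2).1 e
  · intro i hi j hj e
    rw [gu i hi, gv j hj] at e
    exact nd3 _ (List.getElem_mem _) _ (List.getElem_mem _) e
  · intro i hi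
    exact rv.getD i (by omega)
  · intro i hi
    rw [gv _ (by omega), gu i hi]
    have h1 : (cv.map lab)[cu.length - 1 - i]? = (wordInv (cu.map lab))[cu.length - 1 - i]? := by
      rw [hlab]
    rw [wordInv, List.getElem?_reverse (by simp; omega)] at h1
    simp only [List.length_map, List.getElem?_map] at h1
    rw [show cu.length - 1 - (cu.length - 1 - i) = i by omega,
      List.getElem?_eq_getElem (by omega), List.getElem?_eq_getElem hi] at h1
    simpa using h1
  · intro i h0 hi hm
    exact hq i h0 (by omega) ((marked_map (e := b)).2 ⟨by omega, hm⟩)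
  · intro hm
    have : 0 < cu.length := List.length_pos_iff.2 (by simpa using hsep.ne_nil)
    exact hsep.head ((marked_map (e := a)).2 ⟨this, hm⟩)
  · intro i j hij hj hi hj'
    refine hsep.sep i j hij (by simpa using hj) ?_ ?_
    · rcases hi with hi | hi
      · exact .inl hi
      · exact .inr (.inr ((marked_map (e := a)).2 ⟨by omega, hi⟩))
    · rcases hj' with hi | hi
      · exact .inr (.inl (by simpa using hi))
      · rcases hj.lt_or_eq with h | h
        · exact .inr (.inr ((marked_map (e := a)).2 ⟨h, hi⟩))
        · exact .inr (.inl (by simpa using h))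

theorem labels_map {lab : D → Letter k} {mk : D → Bool} {c : List D} :
    labels (c.map fun d => (lab d, mk d)) = c.map lab := by
  simp [labels, Function.comp_def]

theorem not_marked_plain {w : List (Letter k)} {i : ℕ} : ¬ Marked (plain w) i := by
  simp [Marked, plain]

theorem labels_plain {w : List (Letter k)} : labels (plain w) = w := by
  simp [labels, plain, Function.comp_def]

theorem labels_tick {l : List (Letter k × Bool)} : labels (tick l) = labels l := by
  cases l <;> simp [labels, tick]

theorem tick_map {lab : D → Letter k} {mk : D → Bool} {x : D} {c : List D} {mk' : D → Bool}
    (h : mk' x = true) (h' : ∀ d ∈ c, mk' d = mk d) :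
    (x :: c).map (fun d => (lab d, mk' d)) = tick ((x :: c).map fun d => (lab d, mk d)) := by
  simp only [List.map_cons, tick, h, List.cons.injEq, true_and]
  exact List.map_congr_left fun d hd => by rw [h' d hd]

/-- The common setup of the two surgeries: the runs `cu`, `cv` are removed and what follows each
of them is attached to what preceded the other one. -/
theorem thin_of_surgery [DecidableEq D] {s : D → D} {lab : D → Letter k} {mk : D → Bool}
    {cu cv cA cB : List D} {a b : D} {C0 C C' : Multiset (List D)} (hL : 0 < L)
    (hC : IsSystem s C)
    (hbind : (C.bind fun c => (c : Multiset D)) =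
      cu + (cv + ((a :: cA : List D) + ((b :: cB : List D) + C0.bind fun c => (c : Multiset D)))))
    (hbind' : (C'.bind fun c => (c : Multiset D)) =
      ((a :: cA : List D) + ((b :: cB : List D) + C0.bind fun c => (c : Multiset D))))
    (ru : Run s cu a) (rv : Run s cv b)
    (hsep : Sep L (cu.map fun d => (lab d, mk d)))
    (hbar : cv.map (fun d => (lab d, mk d)) = bar (cu.map fun d => (lab d, mk d)))
    (ma : mk a = false) (mb : mk b = false)
    (h : ∀ (s' : D → D) (mk' : D → Bool), mk' a = true → mk' b = true →
      (∀ d, d ≠ a → d ≠ b → mk' d = mk d) →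
      (∀ d ∈ darts C', ∀ x, cu.head? = some x → s d = x → s' d = b) →
      (∀ d ∈ darts C', ∀ x, cv.head? = some x → s d = x → s' d = a) →
      (∀ d ∈ darts C', cu.head? ≠ some (s d) → cv.head? ≠ some (s d) → s' d = s d) →
      Thin L (darts C') s' lab fun d => mk' d = true) :
    Thin L (darts C) s lab fun d => mk d = true := by
  have nd := hC.nodup
  rw [hbind] at nd
  have mem : ∀ d, d ∈ darts C ↔ d ∈ cu ∨ d ∈ cv ∨ d ∈ darts C' := by
    intro d
    change d ∈ (C.bind fun c => (c : Multiset D)) ↔ _ ∨ _ ∨ d ∈ (C'.bind fun c => (c : Multiset D))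
    rw [hbind, hbind']
    simp
  rw [Multiset.nodup_add] at nd
  obtain ⟨nd1, nd2, nd3⟩ := nd
  rw [Multiset.nodup_add] at nd2
  obtain ⟨nd4, nd5, nd6⟩ := nd2
  rw [← hbind'] at nd3 nd6 nd5
  have ucv : ∀ d ∈ cu, d ∉ cv := fun d hd hd' =>
    Multiset.disjoint_left.1 nd3 (Multiset.mem_coe.2 hd)
      (Multiset.mem_add.2 (.inl (Multiset.mem_coe.2 hd')))
  have uC : ∀ d ∈ cu, d ∉ darts C' := fun d hd hd' =>
    Multiset.disjoint_left.1 nd3 (Multiset.mem_coe.2 hd) (Multiset.mem_add.2 (.inr hd'))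
  have vC : ∀ d ∈ cv, d ∉ darts C' := fun d hd hd' =>
    Multiset.disjoint_left.1 nd6 (Multiset.mem_coe.2 hd) hd'
  have haC : a ∈ darts C' := by
    change a ∈ (C'.bind fun c => (c : Multiset D))
    rw [hbind']; simp
  have hbC : b ∈ darts C' := by
    change b ∈ (C'.bind fun c => (c : Multiset D))
    rw [hbind']; simp
  have hlab : cv.map lab = wordInv (cu.map lab) := by
    have := congrArg labels hbar
    rwa [labels_map, bar, labels_plain, labels_map] at this
  have hlen : cv.length = cu.length := by
    have := congrArg List.length hlab
    simpa [wordInv] using this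
  have hum : ∀ i, ¬ Marked (cv.map fun d => (lab d, mk d)) i := by
    intro i; rw [hbar]; exact not_marked_plain
  have hR := runs_of_lists (X := darts C) (a := a) (b := b) hC.maps hC.injOn
    (fun d hd => (mem d).2 (.inl hd)) (fun d hd => (mem d).2 (.inr (.inl hd)))
    (by
      rw [List.nodup_append]
      refine ⟨by simpa using nd1, by simpa using nd4, fun d hd e he hde => ?_⟩
      exact ucv d hd (hde ▸ he)) ru rv hsep hlab (fun i _ _ => hum i)
  have hu0 : cu ≠ [] := by simpa using hsep.ne_nil
  have hv0 : cv ≠ [] := by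
    intro e
    exact hu0 (List.length_eq_zero_iff.1 (by rw [← hlen, e]; rfl))
  have eu : cu.head? = some (cu.getD 0 a) := by
    rcases cu with _ | ⟨x, cu⟩
    · exact absurd rfl hu0
    · simp
  have ev : cv.head? = some (cv.getD 0 b) := by
    rcases cv with _ | ⟨x, cv⟩
    · exact absurd rfl hv0
    · simp
  have pn : cu.getD cu.length a = a := by simp
  have qn : cv.getD cu.length b = b := by simp [← hlen]
  set s' : D → D := fun d => if s d = cu.getD 0 a then b else if s d = cv.getD 0 b then a else s d
    with hs'
  set mk' : D → Bool := fun d => mk d || decide (d = a ∨ d = b) with hmk'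
  have uv0 : cu.getD 0 a ≠ cv.getD 0 b := hR.pq 0 hR.pos 0 hR.pos
  refine hR.thin_surgery (X' := darts C') (s' := s') (mk' := fun d => mk' d = true) hL
    ?_ (by rw [pn]; exact haC) (by show cv.getD cu.length b ∈ _; rw [qn]; exact hbC)
    (by rw [pn]; simp [ma]) (by show ¬ mk (cv.getD cu.length b) = true; rw [qn]; simp [mb]) ?_ ?_ ?_ ?_ ?_ ?_
  · intro d
    constructor
    · intro hd
      refine ⟨(mem d).2 (.inr (.inr hd)), fun i hi e => ?_, fun i hi e => ?_⟩
      · rw [List.getD_eq_getElem _ _ hi] at e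
        exact uC d (e ▸ List.getElem_mem _) hd
      · rw [List.getD_eq_getElem _ _ (by omega)] at e
        exact vC d (e ▸ List.getElem_mem _) hd
    · rintro ⟨h1, h2, h3⟩
      rcases (mem d).1 h1 with h1 | h1 | h1
      · obtain ⟨i, hi, e⟩ := List.getElem_of_mem h1
        exact absurd (by rw [List.getD_eq_getElem _ _ hi, e]) (h2 i hi)
      · obtain ⟨i, hi, e⟩ := List.getElem_of_mem h1
        exact absurd (by rw [List.getD_eq_getElem _ _ hi, e]) (h3 i (by omega))
      · exact h1
  · intro hm
    exact hum 0 ((marked_map (e := b)).2 ⟨by rw [hlen]; exact hR.pos, hm⟩)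
  · intro d _ hd
    show s' d = cv.getD cu.length b
    rw [qn]
    exact if_pos hd
  · intro d _ hd
    show s' d = cu.getD cu.length a
    rw [pn]
    have h1 : s d ≠ cu.getD 0 a := by rw [hd]; exact uv0.symm
    exact (if_neg h1).trans (if_pos hd)
  · intro d _ hd1 hd2
    exact (if_neg hd1).trans (if_neg hd2)
  · intro d
    show mk' d = true ↔ mk d = true ∨ d = cu.getD cu.length a ∨ d = cv.getD cu.length b
    rw [pn, qn]
    simp [hmk']
  · refine h s' mk' (by simp [hmk']) (by simp [hmk']) ?_ ?_ ?_ ?_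
    · intro d h1 h2
      simp [hmk', h1, h2]
    · intro d _ x hx e
      rw [eu, Option.some_inj] at hx
      exact if_pos (e.trans hx.symm)
    · intro d _ x hx e
      rw [ev, Option.some_inj] at hx
      have h1 : s d ≠ cu.getD 0 a := by rw [e, ← hx]; exact uv0.symm
      exact (if_neg h1).trans (if_pos (e.trans hx.symm))
    · intro d _ h1 h2
      rw [eu, Ne, Option.some_inj] at h1
      rw [ev, Ne, Option.some_inj] at h2
      exact (if_neg (Ne.symm h1)).trans (if_neg (Ne.symm h2))

end Systems
end ThinFatgraph

namespace ThinFatgraph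

/-! ### Good collections give thin gluings -/

section Systems

variable {k L : ℕ} {D : Type}

theorem IsCyc.of_run {s : D → D} {x : D} {l : List D} (h : Run s (x :: l) x) : IsCyc s (x :: l) := by
  intro e he
  have : x = e := by simpa using he
  exact this ▸ h

theorem isSystem_congr {s s' : D → D} {C C' : Multiset (List D)}
    (h : IsSystem s C) (hC : C' ≤ C) (hs : ∀ d ∈ darts C', s' d = s d) : IsSystem s' C' := by
  refine ⟨Multiset.nodup_of_le ?_ h.nodup, fun c hc e he => ?_⟩
  · obtain ⟨K, rfl⟩ := Multiset.le_iff_exists_add.1 hC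
    rw [Multiset.add_bind]
    exact Multiset.le_add_right _ _
  · exact Run.congr (fun d hd => hs d (mem_darts.2 ⟨c, hc, hd⟩))
      (h.cyc c (Multiset.mem_of_le hC hc) e he)

theorem marked_zero_cons {x : Letter k × Bool} {l : List (Letter k × Bool)} :
    Marked (x :: l) 0 ↔ x.2 = true := by
  constructor
  · rintro ⟨y, hy⟩
    have : x = (y, true) := by simpa using hy
    rw [this]
  · intro h
    exact ⟨x.1, by simp [← h]⟩

/-- Change of the successor of the last dart of a run. -/
theorem Run.congr_last {s s' : D → D} {e e' : D} : ∀ {l : List D}, l ≠ [] → Run s l e →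
    (∀ d ∈ l, s d ≠ e → s' d = s d) → (∀ d ∈ l, s d = e → s' d = e') → e ∉ l → Run s' l e'
  | [], h, _, _, _, _ => absurd rfl h
  | [d], _, hr, _, h2, _ => ⟨h2 d (by simp) hr.1, trivial⟩
  | d :: x :: l, _, hr, h1, h2, h3 => by
    have hx : s d = x := hr.1
    refine ⟨?_, Run.congr_last (by simp) hr.2 (fun y hy => h1 y (List.mem_cons_of_mem _ hy))
      (fun y hy => h2 y (List.mem_cons_of_mem _ hy)) fun h => h3 (List.mem_cons_of_mem _ h)⟩
    rw [h1 d (by simp), hx]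
    · rfl
    · rw [hx]
      rintro rfl
      exact h3 (by simp)

theorem Run.mem {s : D → D} {l : List D} {e : D} (h : Run s l e) {d : D} (hd : d ∈ l) :
    s d = e ∨ s d ∈ l := by
  have h1 : s d ∈ (l ++ [e]).tail := h.map_eq ▸ List.mem_map_of_mem hd
  have := List.mem_of_mem_tail h1
  simpa [or_comm] using this

/-- The surgery in terms of lists: `h` asks for the result for the new successor, under which runs
that led to the head of `x :: cu` lead to `b`, and runs that led to the head of `y :: cv` lead to
`a`. -/
theorem thin_of_list_surgery [DecidableEq D] {s : D → D} {lab : D → Letter k} {mk : D → Bool}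
    {cu cv cA cB : List D} {x y a b : D} {K C C' : Multiset (List D)} (hL : 0 < L)
    (hC : IsSystem s C) (hK : K ≤ C)
    (hbind : (C.bind fun c => (c : Multiset D)) = (x :: cu : List D) + ((y :: cv : List D) +
      ((a :: cA : List D) + ((b :: cB : List D) + K.bind fun c => (c : Multiset D)))))
    (hbind' : (C'.bind fun c => (c : Multiset D)) =
      ((a :: cA : List D) + ((b :: cB : List D) + K.bind fun c => (c : Multiset D))))
    (ru : Run s (x :: cu) a) (rv : Run s (y :: cv) b)
    (hsep : Sep L ((x :: cu).map fun d => (lab d, mk d)))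
    (hbar : (y :: cv).map (fun d => (lab d, mk d)) =
      bar ((x :: cu).map fun d => (lab d, mk d)))
    (ma : ¬ Marked ((a :: cA).map fun d => (lab d, mk d)) 0)
    (mb : ¬ Marked ((b :: cB).map fun d => (lab d, mk d)) 0)
    (h : ∀ (s' : D → D) (mk' : D → Bool),
      (a :: cA).map (fun d => (lab d, mk' d)) = tick ((a :: cA).map fun d => (lab d, mk d)) →
      (b :: cB).map (fun d => (lab d, mk' d)) = tick ((b :: cB).map fun d => (lab d, mk d)) →
      K.map (List.map fun d => (lab d, mk' d)) = K.map (List.map fun d => (lab d, mk d)) →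
      (∀ l, l ≠ [] → (∀ d ∈ l, d ∈ darts C') → Run s l x → Run s' l b) →
      (∀ l, l ≠ [] → (∀ d ∈ l, d ∈ darts C') → Run s l y → Run s' l a) →
      (∀ c ∈ K, IsCyc s' c) → (C'.bind fun c => (c : Multiset D)).Nodup →
      Thin L (darts C') s' lab fun d => mk' d = true) :
    Thin L (darts C) s lab fun d => mk d = true := by
  have nd := hC.nodup
  rw [hbind] at nd
  obtain ⟨-, nd2, nd3⟩ := Multiset.nodup_add.1 nd
  obtain ⟨-, nd5, nd6⟩ := Multiset.nodup_add.1 nd2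
  have mem : ∀ d, d ∈ darts C' ↔ d ∈ a :: cA ∨ d ∈ b :: cB ∨ d ∈ darts K := by
    intro d
    change d ∈ (C'.bind fun c => (c : Multiset D)) ↔ _ ∨ _ ∨ d ∈ (K.bind fun c => (c : Multiset D))
    rw [hbind']
    simp only [Multiset.mem_add, Multiset.mem_coe]
  have hx : x ∉ darts C' := by
    intro h
    change x ∈ (C'.bind fun c => (c : Multiset D)) at h
    rw [hbind'] at h
    exact Multiset.disjoint_left.1 nd3 (by simp) (Multiset.mem_add.2 (.inr h))
  have hy : y ∉ darts C' := by
    intro h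
    change y ∈ (C'.bind fun c => (c : Multiset D)) at h
    rw [hbind'] at h
    exact Multiset.disjoint_left.1 nd6 (by simp) h
  have hxy : x ≠ y := by
    rintro rfl
    exact Multiset.disjoint_left.1 nd3 (by simp : x ∈ ((x :: cu : List D) : Multiset D))
      (Multiset.mem_add.2 (.inl (by simp)))
  obtain ⟨nA, nBK, nABK⟩ := Multiset.nodup_add.1 nd5
  obtain ⟨nB, nK, nBK'⟩ := Multiset.nodup_add.1 nBK
  have haA : a ∉ cA := by
    have : (a :: cA).Nodup := by simpa using nA
    exact (List.nodup_cons.1 this).1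
  have hbB : b ∉ cB := by
    have : (b :: cB).Nodup := by simpa using nB
    exact (List.nodup_cons.1 this).1
  have hAB : ∀ d ∈ a :: cA, d ∉ b :: cB := fun d hd hd' =>
    Multiset.disjoint_left.1 nABK (Multiset.mem_coe.2 hd)
      (Multiset.mem_add.2 (.inl (Multiset.mem_coe.2 hd')))
  have hAK : ∀ d ∈ a :: cA, d ∉ darts K := fun d hd hd' =>
    Multiset.disjoint_left.1 nABK (Multiset.mem_coe.2 hd) (Multiset.mem_add.2 (.inr hd'))
  have hBK : ∀ d ∈ b :: cB, d ∉ darts K := fun d hd hd' =>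
    Multiset.disjoint_left.1 nBK' (Multiset.mem_coe.2 hd) hd'
  have hKS := isSystem_congr hC hK fun _ _ => rfl
  have ma' : mk a = false := by
    simpa only [List.map_cons, marked_zero_cons, Bool.not_eq_true] using ma
  have mb' : mk b = false := by
    simpa only [List.map_cons, marked_zero_cons, Bool.not_eq_true] using mb
  refine thin_of_surgery (C0 := K) hL hC hbind hbind' ru rv hsep hbar ma' mb' ?_
  intro s' mk' ma mb hmk h1 h2 h3
  have h1' : ∀ d ∈ darts C', s d = x → s' d = b := fun d hd e => h1 d hd x rfl e
  have h2' : ∀ d ∈ darts C', s d = y → s' d = a := fun d hd e => h2 d hd y rfl e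
  have h3' : ∀ d ∈ darts C', s d ≠ x → s d ≠ y → s' d = s d := fun d hd e e' =>
    h3 d hd (by simpa using e.symm) (by simpa using e'.symm)
  refine h s' mk' ?_ ?_ ?_ ?_ ?_ ?_ (hbind' ▸ nd5)
  · refine tick_map ma fun d hd => hmk d ?_ ?_
    · rintro rfl; exact haA hd
    · rintro rfl; exact hAB d (by simp [hd]) (by simp)
  · refine tick_map mb fun d hd => hmk d ?_ ?_
    · rintro rfl; exact hAB d (by simp) (by simp [hd])
    · rintro rfl; exact hbB hd
  · refine Multiset.map_congr rfl fun c hc => List.map_congr_left fun d hd => ?_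
    have hdK : d ∈ darts K := mem_darts.2 ⟨c, hc, hd⟩
    rw [hmk d]
    · rintro rfl; exact hAK d (by simp) hdK
    · rintro rfl; exact hBK d (by simp) hdK
  · intro l hl hlC hr
    refine Run.congr_last hl hr (fun d hd hne => ?_) (fun d hd e => h1' d (hlC d hd) e)
      fun h => hx (hlC x h)
    refine h3' d (hlC d hd) hne fun e => hy ?_
    rw [← e]
    exact hlC _ ((hr.mem hd).resolve_left hne)
  · intro l hl hlC hr
    refine Run.congr_last hl hr (fun d hd hne => ?_) (fun d hd e => h2' d (hlC d hd) e)
      fun h => hy (hlC y h)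
    refine h3' d (hlC d hd) (fun e => hx ?_) hne
    rw [← e]
    exact hlC _ ((hr.mem hd).resolve_left hne)
  · intro c hc e he
    refine Run.congr (fun d hd => ?_) (hKS.cyc c hc e he)
    have hdK : d ∈ darts K := mem_darts.2 ⟨c, hc, hd⟩
    have := (mem _).2 (.inr (.inr (hKS.maps d hdK)))
    exact h3' d ((mem d).2 (.inr (.inr hdK))) (fun e => hx (e ▸ this)) (fun e => hy (e ▸ this))

/-- Induction on the derivation, for all sets of darts, successors and markings at once, because
every cut changes the successor and adds marks. `split` and `merge` are instances of the surgery;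
they differ only in whether the two runs lie on the same cycle. -/
theorem thin_of_good (hL : 0 < L) {M : Multiset (List (Letter k × Bool))} (hM : Good L M) :
    ∀ {D : Type} (C : Multiset (List D)) (s : D → D) (lab : D → Letter k) (mk : D → Bool),
      C.map (List.map fun d => (lab d, mk d)) = M → IsSystem s C →
      Thin L (darts C) s lab fun d => mk d = true := by
  classical
  induction hM with
  | zero =>
    intro D C s lab mk hC _
    have : C = 0 := by simpa using hC
    subst this
    refine ⟨id, ?_, ?_, ?_, ?_⟩ <;> intro d hd <;> simp [darts] at hd
  | rot a b M _ ih =>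
    intro D C s lab mk hC hS
    obtain ⟨c, hc, hab, hM⟩ := Multiset.map_eq_cons _ _ _ _ |>.2 hC
    obtain ⟨K, rfl⟩ := Multiset.exists_cons_of_mem hc
    rw [Multiset.erase_cons_head] at hM
    obtain ⟨cb, ca, rfl, rfl, rfl⟩ := List.map_eq_append_iff.1 hab
    have hd : darts ((cb ++ ca) ::ₘ K) = darts ((ca ++ cb) ::ₘ K) := by
      ext d
      simp [mem_darts, or_comm]
    rw [hd]
    refine ih _ s lab mk (by simp [hM]) ⟨?_, ?_⟩
    · have := hS.nodup
      rw [Multiset.cons_bind] at this ⊢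
      rwa [Multiset.coe_eq_coe.2 (List.perm_append_comm (l₁ := ca))]
    · intro c hc
      rcases Multiset.mem_cons.1 hc with rfl | hc
      · exact (hS.cyc _ (Multiset.mem_cons_self _ _)).rot
      · exact hS.cyc c (Multiset.mem_cons_of_mem hc)
  | ann u M hsep _ ih =>
    intro D C s lab mk hC hS
    obtain ⟨cu, hc, rfl, hM1⟩ := Multiset.map_eq_cons _ _ _ _ |>.2 hC
    obtain ⟨K, rfl⟩ := Multiset.exists_cons_of_mem hc
    rw [Multiset.erase_cons_head] at hM1
    obtain ⟨cv, hc', hv, hM⟩ := Multiset.map_eq_cons _ _ _ _ |>.2 hM1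
    obtain ⟨K, rfl⟩ := Multiset.exists_cons_of_mem hc'
    rw [Multiset.erase_cons_head] at hM
    have nd := hS.nodup
    simp only [Multiset.cons_bind] at nd
    rw [Multiset.nodup_add] at nd
    obtain ⟨nd1, nd2, nd3⟩ := nd
    rw [Multiset.nodup_add] at nd2
    obtain ⟨nd4, nd5, nd6⟩ := nd2
    obtain _ | ⟨a, cu⟩ := cu
    · exact absurd rfl hsep.ne_nil
    have hvlen : cv.length = (a :: cu).length := by
      have h1 := congrArg List.length hv
      have h2 := congrArg List.length (labels_tick (l := bar ((a :: cu).map fun d => (lab d, mk d))))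
      simp [labels, bar, plain, wordInv] at h1 h2
      simp only [List.length_cons]
      omega
    obtain _ | ⟨b, cv⟩ := cv
    · simp at hvlen
    have hlab : (b :: cv).map lab = wordInv ((a :: cu).map lab) := by
      have h1 := congrArg labels hv
      rwa [labels_tick, bar, labels_plain, labels_map, labels_map] at h1
    have ru := hS.cyc (a :: cu) (by simp) a rfl
    have rv := hS.cyc (b :: cv) (by simp) b rfl
    have hsub : ∀ c ∈ ((a :: cu) ::ₘ (b :: cv) ::ₘ K), ∀ d ∈ c,
      d ∈ darts ((a :: cu) ::ₘ (b :: cv) ::ₘ K) := fun c hc d hd => mem_darts.2 ⟨c, hc, hd⟩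
    have hvm : ∀ i, 0 < i → ¬ Marked ((b :: cv).map fun d => (lab d, mk d)) i := by
      intro i hi
      rw [hv]
      obtain ⟨j, rfl⟩ := Nat.exists_eq_succ_of_ne_zero hi.ne'
      have h0 := not_marked_plain
        (w := wordInv (labels ((a :: cu).map fun d => (lab d, mk d)))) (i := j + 1)
      revert h0
      rw [bar]
      generalize plain (wordInv (labels ((a :: cu).map fun d => (lab d, mk d)))) = l
      rcases l with _ | ⟨x, l⟩
      · simp [tick, Marked]
      · simp [tick, Marked]
    have hR := runs_of_lists (X := darts ((a :: cu) ::ₘ (b :: cv) ::ₘ K)) (a := a) (b := b)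
      hS.maps hS.injOn (hsub (a :: cu) (by simp)) (hsub (b :: cv) (by simp))
      (by
        rw [List.nodup_append]
        refine ⟨by simpa using nd1, by simpa using nd4, fun d hd e he hde => ?_⟩
        subst hde
        exact Multiset.disjoint_left.1 nd3 (Multiset.mem_coe.2 hd)
          (Multiset.mem_add.2 (.inl (Multiset.mem_coe.2 he)))) ru rv hsep hlab
      (fun i h0 _ => hvm i h0)
    refine hR.thin_annulus (X' := darts K) ?_ (by simp) (by simp [← hvlen]) ?_
      (ih K s lab mk hM (isSystem_congr hS
        ((Multiset.le_cons_self _ _).trans (Multiset.le_cons_self _ _)) fun _ _ => rfl))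
    · intro d
      have h1 : d ∈ darts ((a :: cu) ::ₘ (b :: cv) ::ₘ K) ↔ d ∈ (a :: cu) ∨ d ∈ (b :: cv) ∨ d ∈ darts K := by
        simp [mem_darts]
      have hK : d ∈ darts K → d ∈ K.bind fun c => (c : Multiset D) := id
      constructor
      · intro hd
        refine ⟨h1.2 (.inr (.inr hd)), fun i hi e => ?_, fun i hi e => ?_⟩
        · rw [List.getD_eq_getElem _ _ hi] at e
          exact Multiset.disjoint_left.1 nd3 (Multiset.mem_coe.2 (e ▸ List.getElem_mem _))
            (Multiset.mem_add.2 (.inr (hK hd)))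
        · rw [List.getD_eq_getElem _ _ (by omega)] at e
          exact Multiset.disjoint_left.1 nd6 (Multiset.mem_coe.2 (e ▸ List.getElem_mem _)) (hK hd)
      · rintro ⟨h2, h3, h4⟩
        rcases h1.1 h2 with h2 | h2 | h2
        · obtain ⟨i, hi, e⟩ := List.getElem_of_mem h2
          exact absurd (by rw [List.getD_eq_getElem _ _ hi, e]) (h3 i hi)
        · obtain ⟨i, hi, e⟩ := List.getElem_of_mem h2
          exact absurd (by rw [List.getD_eq_getElem _ _ hi, e]) (h4 i (by omega))
        · exact h2
    · show mk b = true
      have h1 : Marked ((b :: cv).map fun d => (lab d, mk d)) 0 := by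
        rw [hv]
        have h2 := congrArg List.length hv
        revert h2
        generalize bar ((a :: cu).map fun d => (lab d, mk d)) = l
        rcases l with _ | ⟨x, l⟩
        · simp [tick]
        · intro _; exact marked_zero_cons.2 rfl
      exact marked_zero_cons.1 h1
  | split u A B M hsep hA hB mA mB _ ih =>
    intro D C s lab mk hC hS
    obtain ⟨c, hc, huv, hM⟩ := Multiset.map_eq_cons _ _ _ _ |>.2 hC
    obtain ⟨K, rfl⟩ := Multiset.exists_cons_of_mem hc
    rw [Multiset.erase_cons_head] at hM
    obtain ⟨c1, cB, rfl, huv1, rfl⟩ := List.map_eq_append_iff.1 huv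
    obtain ⟨c2, cv, rfl, huv2, hv⟩ := List.map_eq_append_iff.1 huv1
    obtain ⟨cu, cA, rfl, rfl, rfl⟩ := List.map_eq_append_iff.1 huv2
    obtain _ | ⟨a, cA⟩ := cA
    · exact absurd rfl hA
    obtain _ | ⟨b, cB⟩ := cB
    · exact absurd rfl hB
    obtain _ | ⟨x, cu⟩ := cu
    · exact absurd rfl hsep.ne_nil
    have hcv : cv ≠ [] := by
      rintro rfl
      simpa [bar, plain, wordInv, labels] using congrArg List.length hv
    obtain _ | ⟨y, cv⟩ := cv
    · exact absurd rfl hcv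
    have hcyc := hS.cyc _ (Multiset.mem_cons_self _ _) x rfl
    rw [run_append, run_append, run_append] at hcyc
    obtain ⟨⟨⟨ru, rA⟩, rv⟩, rB⟩ := hcyc
    simp only [List.headD_cons] at ru rA rv
    refine thin_of_list_surgery (K := K) (C' := (a :: cA) ::ₘ (b :: cB) ::ₘ K) hL hS
      (Multiset.le_cons_self _ _) ?_ ?_ ru rv hsep hv mA mB ?_
    · rw [Multiset.cons_bind]
      simp only [← Multiset.coe_add]
      abel
    · simp only [Multiset.cons_bind]
    intro s' mk' eA eB eK h1 h2 h3 nd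
    refine ih _ s' lab mk' ?_ ⟨nd, ?_⟩
    · rw [Multiset.map_cons, Multiset.map_cons, eA, eB, eK, hM]
    · intro c hc
      rcases Multiset.mem_cons.1 hc with rfl | hc
      · exact IsCyc.of_run (h2 _ (by simp) (fun d hd => mem_darts.2 ⟨_, by simp, hd⟩) rA)
      rcases Multiset.mem_cons.1 hc with rfl | hc
      · exact IsCyc.of_run (h1 _ (by simp) (fun d hd => mem_darts.2
          ⟨_, Multiset.mem_cons_of_mem (Multiset.mem_cons_self _ _), hd⟩) rB)
      · exact h3 c hc
  | merge u A B M hsep hA hB mA mB _ ih =>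
    intro D C s lab mk hC hS
    obtain ⟨c, hc, huA, hM1⟩ := Multiset.map_eq_cons _ _ _ _ |>.2 hC
    obtain ⟨K, rfl⟩ := Multiset.exists_cons_of_mem hc
    rw [Multiset.erase_cons_head] at hM1
    obtain ⟨c', hc', hvB, hM⟩ := Multiset.map_eq_cons _ _ _ _ |>.2 hM1
    obtain ⟨K, rfl⟩ := Multiset.exists_cons_of_mem hc'
    rw [Multiset.erase_cons_head] at hM
    obtain ⟨cu, cA, rfl, rfl, rfl⟩ := List.map_eq_append_iff.1 huA
    obtain ⟨cv, cB, rfl, hv, rfl⟩ := List.map_eq_append_iff.1 hvB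
    obtain _ | ⟨a, cA⟩ := cA
    · exact absurd rfl hA
    obtain _ | ⟨b, cB⟩ := cB
    · exact absurd rfl hB
    obtain _ | ⟨x, cu⟩ := cu
    · exact absurd rfl hsep.ne_nil
    have hcv : cv ≠ [] := by
      rintro rfl
      simpa [bar, plain, wordInv, labels] using congrArg List.length hv
    obtain _ | ⟨y, cv⟩ := cv
    · exact absurd rfl hcv
    have hcyc := hS.cyc _ (Multiset.mem_cons_self _ _) x rfl
    have hcyc' := hS.cyc _ (Multiset.mem_cons_of_mem (Multiset.mem_cons_self _ _)) y rfl
    rw [run_append] at hcyc hcyc'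
    obtain ⟨ru, rA⟩ := hcyc
    obtain ⟨rv, rB⟩ := hcyc'
    simp only [List.headD_cons] at ru rv
    refine thin_of_list_surgery (K := K) (C' := ((a :: cA) ++ (b :: cB)) ::ₘ K) hL hS
      ((Multiset.le_cons_self _ _).trans (Multiset.le_cons_self _ _)) ?_ ?_ ru rv hsep hv mA mB ?_
    · simp only [Multiset.cons_bind, ← Multiset.coe_add]
      abel
    · simp only [Multiset.cons_bind, ← Multiset.coe_add]
      abel
    intro s' mk' eA eB eK h1 h2 h3 nd
    refine ih _ s' lab mk' ?_ ⟨nd, ?_⟩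
    · rw [Multiset.map_cons, List.map_append, eA, eB, eK, hM]
    · intro c hc
      rcases Multiset.mem_cons.1 hc with rfl | hc
      · refine IsCyc.of_run (l := cA ++ b :: cB) ?_
        rw [← List.cons_append, run_append]
        exact ⟨h1 _ (by simp) (fun d hd => mem_darts.2 ⟨_, Multiset.mem_cons_self _ _,
            List.mem_append_left _ hd⟩) rA,
          h2 _ (by simp) (fun d hd => mem_darts.2 ⟨_, Multiset.mem_cons_self _ _,
            List.mem_append_right _ hd⟩) rB⟩
      · exact h3 c hc

end Systems
end ThinFatgraph

namespace ThinFatgraph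

/-! ### From good collections to fatgraphs -/

section Bounds

variable {k L : ℕ}

theorem sameCycle_iff_of_pow {α : Type*} {σ : Equiv.Perm α} {d : α} {n : ℕ} (hn : 0 < n)
    (h : (σ ^ n) d = d) (e : α) : σ.SameCycle d e ↔ ∃ r < n, (σ ^ r) d = e := by
  constructor
  · rintro ⟨i, rfl⟩
    have h0 : (n : ℤ) ≠ 0 := by omega
    refine ⟨(i % n).toNat, ?_, ?_⟩
    · have := Int.emod_lt_of_pos i (by omega : (0 : ℤ) < n)
      have := Int.emod_nonneg i h0
      omega
    · rw [← zpow_natCast, Int.toNat_of_nonneg (Int.emod_nonneg i h0)]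
      conv_rhs => rw [← Int.emod_add_mul_ediv i n, zpow_add, zpow_mul, zpow_natCast,
        Equiv.Perm.mul_apply, Equiv.Perm.zpow_apply_eq_self_of_apply_eq_self h]
  · rintro ⟨r, -, rfl⟩
    exact ⟨r, by simp⟩

/-- The marked list of the letters of a tagged loop. -/
def TaggedLoop.toList (γ : TaggedLoop k) : List (Letter k × Bool) :=
  (List.range γ.length).map fun j : ℕ =>
    (γ.letter (j : ZMod γ.length), (γ.tag (j : ZMod γ.length)).isSome)

theorem run_range' {D : Type} {s : D → D} {f : ℕ → D} (hf : ∀ j, s (f j) = f (j + 1)) :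
    ∀ n a, Run s ((List.range' a n).map f) (f (a + n))
  | 0, _ => trivial
  | n + 1, a => by
    rw [List.range'_succ, List.map_cons]
    refine ⟨?_, ?_⟩
    · rw [hf]
      rcases n with _ | n
      · rfl
      · rw [List.range'_succ]; rfl
    · have := run_range' hf n (a + 1)
      rwa [show a + 1 + n = a + (n + 1) by omega] at this

theorem ncard_pair_tag {D : Type} {d e : D} (hde : d ≠ e) (P : D → Prop)
    (hP : ¬ (P d ∧ P e)) :
    ({x | (x = d ∨ x = e) ∧ P x} : Set D).ncard = 0 ∧ ¬ (P d ∨ P e) ∨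
    ({x | (x = d ∨ x = e) ∧ P x} : Set D).ncard = 1 ∧ (P d ∨ P e) := by
  by_cases h1 : P d
  · right
    refine ⟨?_, .inl h1⟩
    rw [Set.ncard_eq_one]
    refine ⟨d, Set.ext fun x => ⟨?_, ?_⟩⟩
    · rintro ⟨rfl | rfl, h⟩
      · rfl
      · exact absurd ⟨h1, h⟩ hP
    · rintro rfl
      exact ⟨.inl rfl, h1⟩
  · by_cases h2 : P e
    · right
      refine ⟨?_, .inr h2⟩
      rw [Set.ncard_eq_one]
      refine ⟨e, Set.ext fun x => ⟨?_, ?_⟩⟩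
      · rintro ⟨rfl | rfl, h⟩
        · exact absurd h h1
        · rfl
      · rintro rfl
        exact ⟨.inr rfl, h2⟩
    · left
      refine ⟨?_, by tauto⟩
      have : {x | (x = d ∨ x = e) ∧ P x} = (∅ : Set D) := by
        ext x
        simp only [Set.mem_ofPred_eq, Set.mem_empty_iff_false, iff_false]
        rintro ⟨rfl | rfl, h⟩ <;> tauto
      rw [this, Set.ncard_empty]

/-- The orbit of `d` under `next` is listed explicitly. Two darts with one mark count as valence
three, and so do three darts without marks. -/
theorem Fatgraph.valence_cases (Y : Fatgraph k) (d : Y.Dart) (h1 : Y.next d ≠ d)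
    (h2 : (Y.next (Y.next d) = d ∧ ¬ (Y.tag d ≠ none ∧ Y.tag (Y.next d) ≠ none)) ∨
      (Y.next (Y.next d) ≠ d ∧ Y.next (Y.next (Y.next d)) = d ∧
        ¬ Y.tag d ≠ none ∧ ¬ Y.tag (Y.next d) ≠ none ∧ ¬ Y.tag (Y.next (Y.next d)) ≠ none)) :
    (Y.valence d = 2 ∨ Y.valence d = 3) ∧ (Y.valence d = 3 ↔
      (Y.next (Y.next d) ≠ d ∨ Y.tag d ≠ none ∨ Y.tag (Y.next d) ≠ none)) := by
  rcases h2 with ⟨h2, h3⟩ | ⟨h2, h3, h4, h5, h6⟩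
  · have hs : ∀ e, Y.next.SameCycle d e ↔ e = d ∨ e = Y.next d := by
      intro e
      rw [sameCycle_iff_of_pow (n := 2) (by norm_num) (by simpa [pow_two] using h2)]
      constructor
      · rintro ⟨r, hr, rfl⟩
        interval_cases r <;> simp
      · rintro (rfl | rfl)
        · exact ⟨0, by norm_num, by simp⟩
        · exact ⟨1, by norm_num, by simp⟩
    have e1 : ({e | Y.next.SameCycle d e} : Set Y.Dart) = {d, Y.next d} := by
      ext e; simp [hs]
    unfold Fatgraph.valence
    rw [e1, Set.ncard_pair h1.symm]
    simp only [hs]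
    rcases ncard_pair_tag h1.symm (fun e => Y.tag e ≠ none) h3 with ⟨a, b⟩ | ⟨a, b⟩
    · rw [a]
      exact ⟨by omega, by simpa [h2] using b⟩
    · rw [a]
      exact ⟨by omega, by simpa [h2] using b⟩
  · have hs : ∀ e, Y.next.SameCycle d e ↔ e = d ∨ e = Y.next d ∨ e = Y.next (Y.next d) := by
      intro e
      rw [sameCycle_iff_of_pow (n := 3) (by norm_num) (by simpa [pow_succ] using h3)]
      constructor
      · rintro ⟨r, hr, rfl⟩
        interval_cases r <;> simp [pow_two]
      · rintro (rfl | rfl | rfl)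
        · exact ⟨0, by norm_num, by simp⟩
        · exact ⟨1, by norm_num, by simp⟩
        · exact ⟨2, by norm_num, by simp [pow_two]⟩
    have e1 : ({e | Y.next.SameCycle d e} : Set Y.Dart) = {d, Y.next d, Y.next (Y.next d)} := by
      ext e; simp [hs]
    have e2 : ({e | Y.next.SameCycle d e ∧ Y.tag e ≠ none} : Set Y.Dart) = ∅ := by
      ext e
      simp only [hs, Set.mem_ofPred_eq, Set.mem_empty_iff_false, iff_false]
      rintro ⟨rfl | rfl | rfl, h⟩ <;> tauto
    have h7 : Y.next d ≠ Y.next (Y.next d) := fun e => h1 (Y.next.injective e).symm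
    have e3 : ({d, Y.next d, Y.next (Y.next d)} : Set Y.Dart).ncard = 3 :=
      Set.ncard_eq_three.2 ⟨_, _, _, h1.symm, h2.symm, h7, rfl⟩
    unfold Fatgraph.valence
    rw [e1, e2, e3, Set.ncard_empty]
    simp [h2]

/-- The darts are the letters of the loops and `s` moves one letter ahead. With the flip `φ` of the
gluing and the vertex permutation `s ∘ φ`, the boundary successor is `s ∘ φ ∘ φ = s`, so the
boundary is the given collection by construction. -/
theorem bounds_of_good (hL : 0 < L) {ι : Type} [Fintype ι] (Γ : ι → TaggedLoop k)
    (h : Good L (Finset.univ.val.map fun i => (Γ i).toList)) : BoundsThinFatgraph L Γ := by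
  classical
  have inst : ∀ i, NeZero (Γ i).length := fun i => ⟨(Γ i).length_pos.ne'⟩
  let D : Type := Σ i, ZMod (Γ i).length
  let s : Equiv.Perm D := Equiv.sigmaCongrRight fun i => Equiv.addRight (1 : ZMod (Γ i).length)
  let lab : D → Letter k := fun d => (Γ d.1).letter d.2
  let mk : D → Bool := fun d => ((Γ d.1).tag d.2).isSome
  let f : ∀ _ : ι, ℕ → D := fun i j => ⟨i, (j : ZMod (Γ i).length)⟩
  let C : Multiset (List D) :=
    Finset.univ.val.map fun i => (List.range (Γ i).length).map (f i)
  have hf : ∀ i j, s (f i j) = f i (j + 1) := by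
    intro i j
    show (⟨i, (j : ZMod (Γ i).length) + 1⟩ : D) = ⟨i, ((j + 1 : ℕ) : ZMod (Γ i).length)⟩
    rw [Nat.cast_add, Nat.cast_one]
  have hdarts : darts C = Set.univ := by
    refine Set.eq_univ_of_forall fun d => mem_darts.2 ⟨_, Multiset.mem_map_of_mem _
      (Finset.mem_univ d.1), ?_⟩
    refine List.mem_map.2 ⟨d.2.val, List.mem_range.2 (ZMod.val_lt _), ?_⟩
    obtain ⟨i, j⟩ := d
    simp [f]
  have hsys : IsSystem s C := by
    refine ⟨?_, ?_⟩
    · rw [Multiset.bind_map, Multiset.nodup_bind]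
      refine ⟨fun i _ => ?_, ?_⟩
      · rw [Multiset.coe_nodup]
        refine List.Nodup.map_on ?_ List.nodup_range
        intro x hx y hy e
        have e : ((x : ZMod (Γ i).length)) = y :=
          eq_of_heq (Sigma.mk.inj e).2
        rw [ZMod.natCast_eq_natCast_iff'] at e
        rwa [Nat.mod_eq_of_lt (List.mem_range.1 hx), Nat.mod_eq_of_lt (List.mem_range.1 hy)] at e
      · refine (Multiset.Nodup.pairwise (fun i _ j _ hij => ?_) Finset.univ.nodup)
        refine Multiset.disjoint_left.2 fun {d} hd hd' => ?_
        obtain ⟨x, -, rfl⟩ := List.mem_map.1 (Multiset.mem_coe.1 hd)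
        obtain ⟨y, -, e⟩ := List.mem_map.1 (Multiset.mem_coe.1 hd')
        exact hij (congrArg Sigma.fst e).symm
    · intro c hc e he
      obtain ⟨i, -, rfl⟩ := Multiset.mem_map.1 hc
      have h1 := run_range' (s := s) (hf i) (Γ i).length 0
      rw [← List.range_eq_range'] at h1
      have h2 : e = f i 0 := by
        obtain ⟨n, hn⟩ := Nat.exists_eq_succ_of_ne_zero (Γ i).length_pos.ne'
        rw [hn, List.range_succ_eq_map] at he
        simpa using he.symm
      have h3 : f i (0 + (Γ i).length) = f i 0 := by simp [f]
      rw [h2, ← h3]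
      exact h1
  obtain ⟨φ, φ1, φ2, φ3, φ4⟩ := thin_of_good hL h C s lab mk (by
    rw [Multiset.map_map]
    refine Multiset.map_congr rfl fun i _ => ?_
    simp [TaggedLoop.toList, f, lab, mk, Function.comp_def]) hsys
  rw [hdarts] at φ1 φ2 φ3 φ4
  have hmk : ∀ d, mk d = true ↔ (Γ d.1).tag d.2 ≠ none := by
    intro d
    simp [mk, Option.isSome_iff_ne_none]
  simp only [hmk] at φ2 φ3 φ4
  have hinv : Function.Involutive φ := fun d => (φ1 d trivial).2.1
  let Y : Fatgraph k :=
    { Dart := D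
      finite_dart := inferInstance
      flip := φ
      flip_flip := hinv
      flip_ne := fun d e => Letter.inv_ne (lab d) (by rw [← (φ1 d trivial).2.2, e])
      next := hinv.toPerm.trans s
      label := lab
      label_flip := fun d => (φ1 d trivial).2.2
      tag := fun d => (Γ d.1).tag d.2 }
  have hb : ∀ d, Y.boundaryNext d = s d := fun d => by
    show s (φ (φ d)) = s d
    rw [hinv d]
  have hbi : ∀ j d, Y.boundaryNext^[j] d = s^[j] d := fun j d => by
    rw [show Y.boundaryNext = s from funext hb]
  have hval := fun d : Y.Dart => Y.valence_cases d (φ2 d trivial).1 (φ2 d trivial).2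
  refine ⟨Y, ⟨fun d => (hval d).1, fun d => ?_⟩, fun d hd j hj hjL hv => ?_,
    Equiv.refl _, fun d => ?_, fun d => rfl, fun d => rfl⟩
  · obtain ⟨j, hj⟩ := φ4 d trivial
    refine ⟨j, (hval _).2.2 ?_⟩
    rw [hbi]
    exact hj
  · have h1 := (hval _).2.1 hv
    rw [hbi] at h1
    exact φ3 d trivial ((hval d).2.1 hd) j hj hjL h1
  · exact hb d

end Bounds
end ThinFatgraph

namespace ThinFatgraph

/-! ### Reduced words with prescribed directions at their ends -/

section Paths

variable {k : ℕ}

/-- The word has no letter followed by its inverse. -/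
def Red (w : List (Letter k)) : Prop := w.IsChain fun x y => y ≠ x.inv

/-- A reduced word leaving in the direction `h` and arriving in the direction `t`: its first letter
is `h` and its last letter is the inverse of `t`. -/
structure Path (h t : Letter k) (w : List (Letter k)) : Prop where
  head : w.head? = some h
  last : w.getLast? = some t.inv
  red : Red w

theorem Letter.inv_injective : Function.Injective (Letter.inv (k := k)) := fun x y h => by
  rw [← x.inv_inv, h, y.inv_inv]

@[simp] theorem length_wordInv (w : List (Letter k)) : (wordInv w).length = w.length := by
  simp [wordInv]

@[simp] theorem wordInv_append (v w : List (Letter k)) :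
    wordInv (v ++ w) = wordInv w ++ wordInv v := by
  simp [wordInv]

@[simp] theorem wordInv_wordInv (w : List (Letter k)) : wordInv (wordInv w) = w := by
  simp [wordInv, Function.comp_def]

namespace Path

variable {a b c d : Letter k} {X Y : List (Letter k)}

theorem ne_nil (h : Path a b X) : X ≠ [] := by
  rintro rfl
  simpa using h.head

theorem append (hX : Path a b X) (hY : Path c d Y) (h : b ≠ c) : Path a d (X ++ Y) := by
  refine ⟨?_, ?_, ?_⟩
  · rw [List.head?_append, hX.head]; rfl
  · rw [List.getLast?_append, hY.last]; rfl
  · refine List.isChain_append.2 ⟨hX.red, hY.red, fun x hx y hy => ?_⟩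
    rw [hX.last] at hx
    rw [hY.head] at hy
    simp only [Option.mem_def, Option.some.injEq] at hx hy
    rw [← hx, ← hy, Letter.inv_inv]
    exact h.symm

theorem inv (hX : Path a b X) : Path b a (wordInv X) := by
  refine ⟨?_, ?_, ?_⟩
  · rw [wordInv, List.head?_reverse, List.getLast?_map, hX.last]
    simp
  · rw [wordInv, List.getLast?_reverse, List.head?_map, hX.head]
    simp
  · rw [Red, wordInv, List.isChain_reverse, List.isChain_map]
    refine hX.red.imp fun x y h h' => h ?_
    simpa using h'.symm

theorem letter (x : Letter k) : Path x x.inv [x] := ⟨rfl, by simp, List.isChain_singleton x⟩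

theorem exists_of_red (h : Red X) (hX : X ≠ []) : ∃ a b, Path a b X := by
  obtain ⟨x, hx⟩ := Option.ne_none_iff_exists'.1 (mt List.head?_eq_none_iff.1 hX)
  obtain ⟨y, hy⟩ := Option.ne_none_iff_exists'.1 (mt List.getLast?_eq_none_iff.1 hX)
  exact ⟨x, y.inv, hx, by simpa using hy, h⟩

theorem head_unique (h : Path a b X) (h' : Path c d X) : a = c :=
  Option.some_injective _ (h.head.symm.trans h'.head)

theorem last_unique (h : Path a b X) (h' : Path c d X) : b = d :=
  Letter.inv_injective (Option.some_injective _ (h.last.symm.trans h'.last))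

theorem of_append (h : Path a d (X ++ Y)) (hX : X ≠ []) (hY : Y ≠ []) :
    ∃ b c, Path a b X ∧ Path c d Y ∧ b ≠ c := by
  obtain ⟨h1, h2, h3⟩ := List.isChain_append.1 h.red
  obtain ⟨a', b, hX'⟩ := exists_of_red h1 hX
  obtain ⟨c, d', hY'⟩ := exists_of_red h2 hY
  have hbc : b ≠ c := by
    have := h3 b.inv hX'.last c hY'.head
    rw [Letter.inv_inv] at this
    exact this.symm
  have h4 := hX'.append hY' hbc
  obtain rfl := h4.head_unique h
  obtain rfl := h4.last_unique h
  exact ⟨b, c, hX', hY', hbc⟩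

end Path

/-- There are `2 * k ≥ 4` letters, so three of them can be avoided. -/
theorem exists_letter_notMem (hk : 2 ≤ k) (x y z : Letter k) : ∃ w, w ≠ x ∧ w ≠ y ∧ w ≠ z := by
  by_contra! h
  have h1 : (Finset.univ : Finset (Letter k)) ⊆ {x, y, z} := by
    intro w _
    simp only [Finset.mem_insert, Finset.mem_singleton]
    by_contra! hw
    exact hw.2.2 (h w hw.1 hw.2.1)
  have h2 := Finset.card_le_card h1
  have h3 : ({x, y, z} : Finset (Letter k)).card ≤ 3 := Finset.card_le_three
  simp [Letter] at h2
  omega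

theorem exists_letters_notMem (hk : 2 ≤ k) (x y z w : Letter k) :
    ∃ a b, a ≠ b ∧ a ≠ x ∧ a ≠ y ∧ b ≠ z ∧ b ≠ w := by
  obtain ⟨a, h1, h2, -⟩ := exists_letter_notMem hk x y y
  obtain ⟨b, h3, h4, h5⟩ := exists_letter_notMem hk z w a
  exact ⟨a, b, h5.symm, h1, h2, h3, h4⟩

/-- A power of `h`, one letter `c` and `t.inv`: it suffices that `c` differs from `h.inv` and from
`t`, and length three is the shortest of this shape. -/
theorem exists_path (hk : 2 ≤ k) (h t : Letter k) {n : ℕ} (hn : 3 ≤ n) :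
    ∃ w, Path h t w ∧ w.length = n := by
  obtain ⟨c, h1, h2, -⟩ := exists_letter_notMem hk h.inv t t
  obtain ⟨m, rfl⟩ := Nat.exists_eq_add_of_le' hn
  have hr : ∀ m, Path h h.inv (List.replicate (m + 1) h) := by
    intro m
    induction m with
    | zero => exact Path.letter h
    | succ m ih =>
      rw [List.replicate_succ, ← List.singleton_append]
      exact (Path.letter h).append ih (Letter.inv_ne h)
  refine ⟨List.replicate (m + 1) h ++ ([c] ++ [t.inv]), (hr m).append
    (d := t) ((Path.letter c).append (by simpa using Path.letter t.inv) ?_) h1.symm, by simp⟩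
  intro e
  exact h2 (Letter.inv_injective e)

/-- The exponent sums of a word. -/
def hom (w : List (Letter k)) : Fin k → ℤ :=
  (w.map fun x => Pi.single x.1 (if x.2 then (1 : ℤ) else -1)).sum

@[simp] theorem hom_nil : hom ([] : List (Letter k)) = 0 := rfl

@[simp] theorem hom_append (v w : List (Letter k)) : hom (v ++ w) = hom v + hom w := by
  simp [hom]

theorem hom_letter_inv (x : Letter k) : hom [x.inv] = -hom [x] := by
  obtain ⟨i, b⟩ := x
  cases b <;> simp [hom, Letter.inv, ← Pi.single_neg]

@[simp] theorem hom_wordInv (w : List (Letter k)) : hom (wordInv w) = -hom w := by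
  induction w with
  | nil => simp [wordInv]
  | cons x w ih =>
    rw [← List.singleton_append, wordInv_append, hom_append, hom_append, ih, neg_add_rev]
    congr 1
    exact hom_letter_inv x

end Paths

/-! ### Class functions on words factor through homology -/

section Classes

variable {k : ℕ} {A : Type*} [AddCommGroup A] {ℓ : ℕ} {cls : List (Letter k) → A}

/-- A function on words that behaves like a homology class under rotation and inversion, and under
cutting a loop along a pair of inverse subwords. -/
structure IsClassFun (ℓ : ℕ) (cls : List (Letter k) → A) : Prop where
  rot : ∀ {a b c d X Y}, Path a b X → Path c d Y → b ≠ c → d ≠ a → ℓ ≤ X.length + Y.length →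
    cls (X ++ Y) = cls (Y ++ X)
  inv : ∀ {a b X}, Path a b X → a ≠ b → ℓ ≤ X.length → cls (wordInv X) = -cls X
  split : ∀ {a b c d e f u X Y}, Path a b u → Path c d X → Path e f Y → b ≠ c → d ≠ b → a ≠ e →
    f ≠ a → c ≠ d → e ≠ f → ℓ ≤ u.length → ℓ ≤ X.length → ℓ ≤ Y.length →
    cls (u ++ X ++ wordInv u ++ Y) = cls X + cls Y
  merge : ∀ {a b c d e f u X Y}, Path a b u → Path c d X → Path e f Y → b ≠ c → d ≠ a → a ≠ e →
    f ≠ b → d ≠ e → f ≠ c → ℓ ≤ u.length → ℓ ≤ X.length → ℓ ≤ Y.length →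
    cls (u ++ X) + cls (wordInv u ++ Y) = cls (X ++ Y)

namespace IsClassFun

theorem exists_long_path (hk : 2 ≤ k) (ℓ : ℕ) (h t : Letter k) :
    ∃ w, Path h t w ∧ ℓ ≤ w.length := by
  obtain ⟨w, h1, h2⟩ := exists_path hk h t (n := ℓ + 3) (by omega)
  exact ⟨w, h1, by omega⟩

variable (H : IsClassFun ℓ cls) (hk : 2 ≤ k)

include H

/-- Cutting along an auxiliary word `g`, disjoint from the directions `h`, `t`. -/
theorem aux_word {h t p q : Letter k} {g B S X : List (Letter k)} (hg : Path p q g)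
    (hB : Path h t B) (hS : Path h t S) (hX : Path h t X) (hp : p ≠ h) (hp' : p ≠ t) (hq : q ≠ h)
    (hq' : q ≠ t) (hht : h ≠ t) (lg : ℓ ≤ g.length) (lB : ℓ ≤ B.length) (lS : ℓ ≤ S.length)
    (lX : ℓ ≤ X.length) :
    cls (wordInv g ++ (B ++ S ++ X)) = cls X + cls B + cls (wordInv g ++ S) := by
  -- Cutting `g X g⁻¹ B` along `g` gives the loops `X` and `B`; merging the same loop with `g⁻¹ S`
  -- along `g` gives `X g⁻¹ B S`, a rotation of the loop in question.
  have h1 := H.split hg hX hB hq hq'.symm hp hp'.symm hht hht lg lX lB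
  have h2 := H.merge hg ((hX.append hg.inv hq'.symm).append hB hp) hS hq hp'.symm hp hq'.symm
    hht.symm hht.symm lg (by simp; omega) lS
  have h3 := H.rot hX (hg.inv.append (hB.append hS hht.symm) hp) hq'.symm hht.symm
    (by simp; omega)
  simp only [List.append_assoc] at h1 h2 h3 ⊢
  rw [← h3, ← h2, h1]

include hk

/-- The loop `B S X R` is obtained by merging `g⁻¹ B S X` with `g R`. After `aux_word`, the
auxiliary word remains only in `g R` and `g⁻¹ S`, and these two merge to `R S`. So `g` disappears,
although its own contribution is not yet known. -/
theorem four_fold {h t : Letter k} {B S X R : List (Letter k)} (hht : h ≠ t)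
    (hB : Path h t B) (hS : Path h t S) (hX : Path h t X) (hR : Path h t R)
    (lB : ℓ ≤ B.length) (lS : ℓ ≤ S.length) (lX : ℓ ≤ X.length) (lR : ℓ ≤ R.length) :
    cls (B ++ S ++ X ++ R) = cls X + cls B + cls (R ++ S) := by
  obtain ⟨p, q, hpq, hp, hp', hq, hq'⟩ := exists_letters_notMem hk h t h t
  obtain ⟨g, hg, lg⟩ := exists_long_path hk ℓ p q
  have h1 := H.aux_word hg hB hS hX hp hp' hq hq' hht lg lB lS lX
  have h2 := H.merge hg.inv ((hB.append hS hht.symm).append hX hht.symm) hR hp hq'.symm hq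
    hp'.symm hht.symm hht.symm (by simpa using lg) (by simp; omega) lR
  have h3 := H.merge hg hR hS hq hp'.symm hp hq'.symm hht.symm hht.symm lg lR lS
  rw [wordInv_wordInv] at h2
  rw [← h2, h1, ← h3]
  abel

/-- `four_fold` evaluates `Z Y Z X` and its rotation `Y Z X Z` in two ways. The comparison expresses
the defect of additivity for `X`, `Y` by the one for `Z`, `Z`. The two evaluations of `Z Z Z Z` show
that twice the defect vanishes. -/
theorem exists_defect {h t : Letter k} (hht : h ≠ t) : ∃ e : A, 2 • e = 0 ∧
    ∀ X Y, Path h t X → Path h t Y → ℓ ≤ X.length → ℓ ≤ Y.length →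
      cls (X ++ Y) = cls X + cls Y + e := by
  obtain ⟨Z, hZ, lZ⟩ := exists_long_path hk ℓ h t
  have key : ∀ X Y, Path h t X → Path h t Y → ℓ ≤ X.length → ℓ ≤ Y.length →
      cls (X ++ Y) = cls X + cls Y + (cls (Z ++ Z) - cls Z - cls Z) := by
    intro X Y hX hY lX lY
    have h1 := H.four_fold hk hht hZ hY hZ hX lZ lY lZ lX
    have h2 := H.four_fold hk hht hY hZ hX hZ lY lZ lX lZ
    have h3 := H.rot hZ ((hY.append hZ hht.symm).append hX hht.symm) hht.symm hht.symm
      (by simp; omega)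
    simp only [List.append_assoc] at h1 h2 h3
    rw [h3, h2] at h1
    have : cls (X ++ Y) = cls X + cls Y + cls (Z ++ Z) - cls Z - cls Z := by
      rw [h1]; abel
    rw [this]; abel
  refine ⟨_, ?_, key⟩
  have h1 := H.four_fold hk hht hZ hZ hZ hZ lZ lZ lZ lZ
  have hZZ := hZ.append hZ hht.symm
  have h2 := key _ _ hZZ hZZ (by simp; omega) (by simp; omega)
  rw [List.append_assoc] at h1
  rw [h1] at h2
  generalize cls (Z ++ Z) = z at h2
  generalize cls Z = y at h2
  have h3 : 2 • (z - y - y) = (z + z + (z - y - y)) - (y + y + z) := by abel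
  rw [h3, ← h2, sub_self]

/-- `φ g = cls (g ++ X) - cls X` does not depend on `X`. -/
theorem exists_phi {h t p q : Letter k} (hht : h ≠ t) {g : List (Letter k)} (hg : Path p q g)
    (hp : p ≠ h) (hp' : p ≠ t) (hq : q ≠ h) (hq' : q ≠ t) (lg : ℓ ≤ g.length) :
    ∃ φ : A, ∀ X, Path h t X → ℓ ≤ X.length → cls (g ++ X) = φ + cls X := by
  obtain ⟨e, he, key⟩ := H.exists_defect hk hht
  -- Two defects occur when `B S X` is taken apart, and they cancel because `2 • e = 0`.
  have mid : ∀ B S X, Path h t B → Path h t S → Path h t X → ℓ ≤ B.length → ℓ ≤ S.length →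
      ℓ ≤ X.length → cls (g ++ (B ++ S ++ X)) - cls (B ++ S ++ X) = cls (g ++ S) - cls S := by
    intro B S X hB hS hX lB lS lX
    have h1 := H.aux_word hg.inv hB hS hX hq hq' hp hp' hht (by simpa using lg) lB lS lX
    rw [wordInv_wordInv] at h1
    rw [h1, key _ _ (hB.append hS hht.symm) hX (by simp; omega) lX, key _ _ hB hS lB lS]
    have : cls X + cls B + cls (g ++ S) - (cls B + cls S + e + cls X + e) =
      cls (g ++ S) - cls S - 2 • e := by abel
    rw [this, he, sub_zero]
  obtain ⟨Z, hZ, lZ⟩ := exists_long_path hk ℓ h t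
  refine ⟨cls (g ++ Z) - cls Z, fun X hX lX => ?_⟩
  -- The word `Z X Z Z` is read once with `X` as its middle part and once with `Z`.
  have h1 := mid Z X (Z ++ Z) hZ hX (hZ.append hZ hht.symm) lZ lX (by simp; omega)
  have h2 := mid (Z ++ X) Z Z (hZ.append hX hht.symm) hZ hZ (by simp; omega) lZ lZ
  simp only [List.append_assoc] at h1 h2
  rw [← h2, h1]
  abel

/-- For four distinct directions the defect of additivity is a constant `r` depending only on the
pairs of directions, and the same constant governs `(c,d)` followed by `(c,d)`. Rotation makes it
symmetric in the two pairs, inversion changes its sign when `c` and `d` are exchanged, and a merge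
shows that the constant for the exchanged pair is zero. -/
theorem additive_of_disjoint {a b c d : Letter k} (hab : a ≠ b) (hac : a ≠ c) (had : a ≠ d)
    (hbc : b ≠ c) (hbd : b ≠ d) (hcd : c ≠ d) :
    (∀ X Y, Path a b X → Path a b Y → ℓ ≤ X.length → ℓ ≤ Y.length →
      cls (X ++ Y) = cls X + cls Y) ∧
    ∀ X Y, Path a b X → Path c d Y → ℓ ≤ X.length → ℓ ≤ Y.length →
      cls (X ++ Y) = cls X + cls Y := by
  have rconst : ∀ {a b c d : Letter k}, a ≠ b → a ≠ c → a ≠ d → b ≠ c → b ≠ d → c ≠ d →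
      ∃ r : A, ∀ X Y, Path a b X → Path c d Y → ℓ ≤ X.length → ℓ ≤ Y.length →
        cls (X ++ Y) = cls X + cls Y + r := by
    intro a b c d hab hac had hbc hbd hcd
    obtain ⟨P, hP, lP⟩ := exists_long_path hk ℓ a b
    obtain ⟨Q, hQ, lQ⟩ := exists_long_path hk ℓ c d
    obtain ⟨φ, hφ⟩ := H.exists_phi hk hab hQ hac.symm hbc.symm had.symm hbd.symm lQ
    refine ⟨φ - cls Q, fun X Y hX hY lX lY => ?_⟩
    obtain ⟨ψ, hψ⟩ := H.exists_phi hk hcd hX hac had hbc hbd lX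
    have h1 := H.rot hX hQ hbc had.symm (by omega)
    have h2 := hψ Q hQ lQ
    have h3 := hφ X hX lX
    rw [hψ Y hY lY]
    have : ψ = φ + cls X - cls Q := by rw [← h3, ← h1, h2]; abel
    rw [this]; abel
  have rdefect : ∀ {a b c d : Letter k}, a ≠ b → a ≠ c → a ≠ d → b ≠ c → b ≠ d → c ≠ d →
      ∃ r : A, (∀ X Y, Path a b X → Path c d Y → ℓ ≤ X.length → ℓ ≤ Y.length →
        cls (X ++ Y) = cls X + cls Y + r) ∧
        (∀ X Y, Path c d X → Path c d Y → ℓ ≤ X.length → ℓ ≤ Y.length →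
        cls (X ++ Y) = cls X + cls Y + r) := by
    intro a b c d hab hac had hbc hbd hcd
    obtain ⟨r, hr⟩ := rconst hab hac had hbc hbd hcd
    refine ⟨r, hr, fun X Y hX hY lX lY => ?_⟩
    obtain ⟨P, hP, lP⟩ := exists_long_path hk ℓ a b
    have h1 := H.merge hX (hY.append hP had.symm) hP hcd.symm hbc hac.symm hbd hab.symm hbc lX
      (by simp; omega) lP
    have h2 := hr P (X ++ Y) hP (hX.append hY hcd.symm) lP (by simp; omega)
    have h3 := H.rot hP (hX.append hY hcd.symm) hbc had.symm (by simp; omega)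
    have h4 := H.merge hX hP hP had.symm hbc hac.symm hbd hab.symm hab.symm lX lP lP
    have h5 := H.rot hP hX hbc had.symm (by omega)
    have h6 := hr P X hP hX lP lX
    have h7 := hr P Y hP hY lP lY
    have hPP := hP.append hP hab.symm
    have h10 := hr _ Y hPP hY (by simp; omega) lY
    simp only [List.append_assoc] at h1 h2 h3 h4 h10
    rw [← h3, h2] at h1
    rw [← h5, h6] at h4
    have h11 := H.rot hY hPP had.symm hbc (by simp; omega)
    simp only [List.append_assoc] at h11
    rw [h11, h10, ← h4] at h1
    have h12 : cls (X ++ Y) - (cls X + cls Y + r) =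
        cls P + cls (X ++ Y) + r + cls (wordInv X ++ P) -
          (cls P + cls X + r + cls (wordInv X ++ P) + cls Y + r) := by abel
    rw [h1, sub_self] at h12
    exact sub_eq_zero.1 h12
  obtain ⟨r, h1, h2⟩ := rdefect hab hac had hbc hbd hcd
  obtain ⟨r', h1', h2'⟩ := rdefect hcd hac.symm hbc.symm had.symm hbd.symm hab
  obtain ⟨r'', h1'', h2''⟩ := rdefect hab had hac hbd hbc hcd.symm
  obtain ⟨P, hP, lP⟩ := exists_long_path hk ℓ a b
  obtain ⟨Q, hQ, lQ⟩ := exists_long_path hk ℓ c d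
  have e1 : r' = r := by
    have e := H.rot hP hQ hbc had.symm (by omega)
    rw [h1 P Q hP hQ lP lQ, h1' Q P hQ hP lQ lP, add_comm (cls P)] at e
    exact (add_left_cancel e).symm
  have e2 : r'' = -r := by
    have e := H.inv (hQ.append hQ hcd.symm) hcd (by simp; omega)
    rw [wordInv_append, h2 Q Q hQ hQ lQ lQ, h2'' _ _ hQ.inv hQ.inv (by simpa) (by simpa),
      H.inv hQ hcd lQ] at e
    have : r'' = (-cls Q + -cls Q + r'') + cls Q + cls Q := by abel
    rw [this, e]; abel
  -- Merging `Q P` and `Q⁻¹ P` along `Q` gives `P P`: the defects `r` and `r''` appear on one side,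
  -- and `r' = r` on the other.
  have e3 : r'' = 0 := by
    have e := H.merge hQ hP hP had.symm hbc hac.symm hbd hab.symm hab.symm lQ lP lP
    have f1 := H.rot hQ hP had.symm hbc (by omega)
    have f2 := H.rot hQ.inv hP hac.symm hbd (by simp; omega)
    rw [f1, f2, h1 P Q hP hQ lP lQ, h1'' P _ hP hQ.inv lP (by simpa), H.inv hQ hcd lQ,
      h2' P P hP hP lP lP, e1] at e
    have : r'' = (cls P + cls Q + r + (cls P + -cls Q + r'')) - (cls P + cls P + r) := by abel
    rw [this, e, sub_self]
  have e4 : r = 0 := by rw [e3] at e2; exact neg_eq_zero.1 e2.symm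
  rw [e1, e4] at h2'
  rw [e4] at h1
  simp only [add_zero] at h1 h2'
  exact ⟨h2', h1⟩

theorem additive_self {a b : Letter k} (hab : a ≠ b) {X Y : List (Letter k)} (hX : Path a b X)
    (hY : Path a b Y) (lX : ℓ ≤ X.length) (lY : ℓ ≤ Y.length) : cls (X ++ Y) = cls X + cls Y := by
  obtain ⟨c, hc, hc', -⟩ := exists_letter_notMem hk a b b
  obtain ⟨d, hd, hd', hd''⟩ := exists_letter_notMem hk a b c
  exact (H.additive_of_disjoint hk hab hc.symm hd.symm hc'.symm hd'.symm hd''.symm).1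
    X Y hX hY lX lY

/-- Merging `X W` with an auxiliary loop `X⁻¹ Z` gives `W Z`, where all four directions are
distinct. So `cls (X W) - cls W` is the same for all `W` with the directions of `Y`, and for `W = X
G` it can be computed from the cases already settled. -/
theorem additive_of_common_head {a b d : Letter k} (hab : a ≠ b) (had : a ≠ d) (hbd : b ≠ d)
    {X Y : List (Letter k)} (hX : Path a b X)
    (hY : Path a d Y) (lX : ℓ ≤ X.length) (lY : ℓ ≤ Y.length) : cls (X ++ Y) = cls X + cls Y := by
  obtain ⟨c, hc, hc', hc''⟩ := exists_letter_notMem hk a b d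
  obtain ⟨Z, hZ, lZ⟩ := exists_long_path hk ℓ b c
  obtain ⟨G, hG, lG⟩ := exists_long_path hk ℓ c d
  have key : ∀ W, Path a d W → ℓ ≤ W.length →
      cls (X ++ W) = cls W + cls Z - cls (wordInv X ++ Z) := by
    intro W hW lW
    have h1 := H.merge hX hW hZ hab.symm had.symm hab hc' hbd.symm hc lX lW lZ
    rw [(H.additive_of_disjoint hk had hab hc.symm hbd.symm hc''.symm hc'.symm).2 W Z hW hZ lW lZ] at h1
    rw [← h1]; abel
  have hD := (H.additive_of_disjoint hk hab hc.symm had hc'.symm hbd hc'').2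
  have hXG := hX.append hG hc'.symm
  have h1 := key (X ++ G) hXG (by simp; omega)
  have h2 := hD (X ++ X) G (hX.append hX hab.symm) hG (by simp; omega) lG
  rw [H.additive_self hk hab hX hX lX lX] at h2
  rw [hD X G hX hG lX lG, ← List.append_assoc, h2] at h1
  rw [key Y hY lY]
  have : cls Y + cls Z - cls (wordInv X ++ Z) = cls Y - cls X - cls G +
    (cls X + cls G + cls Z - cls (wordInv X ++ Z)) := by abel
  rw [this, ← h1]; abel

/-- The hypotheses exclude all coincidences between the four directions except `a = c` and `b = d`;
a common end direction is turned into a common initial one by inversion. -/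
theorem additive {a b c d : Letter k} (hab : a ≠ b) (hcd : c ≠ d) (hbc : b ≠ c) (hda : d ≠ a)
    {X Y : List (Letter k)} (hX : Path a b X)
    (hY : Path c d Y) (lX : ℓ ≤ X.length) (lY : ℓ ≤ Y.length) : cls (X ++ Y) = cls X + cls Y := by
  by_cases hac : a = c
  · subst hac
    by_cases hbd : b = d
    · subst hbd
      exact H.additive_self hk hab hX hY lX lY
    · exact H.additive_of_common_head hk hab hcd hbd hX hY lX lY
  · by_cases hbd : b = d
    · subst hbd
      have h1 := H.inv (hX.append hY hbc) hda.symm (by simp; omega)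
      have h2 := H.additive_of_common_head hk hcd.symm hab.symm (Ne.symm hac) hY.inv hX.inv
        (by simpa) (by simpa)
      rw [wordInv_append, h2, H.inv hX hab lX, H.inv hY hcd lY] at h1
      rw [← neg_inj, ← h1]; abel
    · exact (H.additive_of_disjoint hk hab hac hda.symm hbc hbd hcd).2 X Y hX hY lX lY

/-- The contribution of a word to the classes of the loops that contain it is well-defined. -/
theorem exists_psi {p q : Letter k} {g : List (Letter k)} (hg : Path p q g) : ∃ ψ : A,
    ∀ a b Q, Path a b Q → a ≠ b → a ≠ q → b ≠ p → ℓ ≤ Q.length → cls (g ++ Q) = ψ + cls Q := by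
  obtain ⟨a', b', hab', haq', -, hbp', -⟩ := exists_letters_notMem hk q q p p
  obtain ⟨Z, hZ, lZ⟩ := exists_long_path hk ℓ a' b'
  refine ⟨cls (g ++ Z) - cls Z, fun a b Q hQ hab haq hbp lQ => ?_⟩
  obtain ⟨c, d, hcd, hc1, hc2, hd1, hd2⟩ := exists_letters_notMem hk b b' a a'
  obtain ⟨R, hR, lR⟩ := exists_long_path hk ℓ c d
  have hgQ := hg.append hQ haq.symm
  have hgZ := hg.append hZ haq'.symm
  have hZg := hZ.append hg hbp'
  -- The loop `Z g Q R` is computed both as `(Z g)(Q R)` and, after rotation, as `(g Q)(R Z)`; the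
  -- word `R` only mediates between `Q` and `Z`, whose directions may not fit to each other.
  have h1 := H.additive hk hcd hab' hd2 hc2.symm hR hZ lR lZ
  have h2 := H.additive hk hab hcd hc1.symm hd1 hQ hR lQ lR
  have h3 := H.additive hk hbp.symm hc2 hc1.symm hbp' hgQ (hR.append hZ hd2) (by simp; omega)
    (by simp; omega)
  have h4 := H.additive hk haq' hd1.symm haq.symm hd2 hZg (hQ.append hR hc1.symm) (by simp; omega)
    (by simp; omega)
  have h5 := H.rot hZ ((hgQ).append hR hc1.symm) hbp' hd2 (by simp; omega)
  have h6 := H.rot hZ hg hbp' haq'.symm (by omega)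
  rw [h1] at h3
  rw [h2, h6] at h4
  simp only [List.append_assoc] at h3 h4 h5
  rw [h4, h3] at h5
  have : cls (g ++ Q) = (cls (g ++ Q) + (cls R + cls Z)) - (cls R + cls Z) := by abel
  rw [this, ← h5]; abel

/-- The value `ψ` is the contribution of the word `g` to the classes of the loops that contain it. -/
def IsContribution (ℓ : ℕ) (cls : List (Letter k) → A) (p q : Letter k) (g : List (Letter k))
    (ψ : A) : Prop :=
  ∀ a b Q, Path a b Q → a ≠ b → a ≠ q → b ≠ p → ℓ ≤ Q.length → cls (g ++ Q) = ψ + cls Q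

/-- The loop `g g' Q Q` is rotated to `(g' Q)(Q g)`, where additivity separates the two
contributions. -/
theorem contribution_append {p q p' q' : Letter k} {g g' : List (Letter k)} {ψ ψ' : A}
    (hg : Path p q g) (hg' : Path p' q' g') (hqp : q ≠ p') (h : IsContribution ℓ cls p q g ψ)
    (h' : IsContribution ℓ cls p' q' g' ψ') : IsContribution ℓ cls p q' (g ++ g') (ψ + ψ') := by
  obtain ⟨φ, hφ⟩ := H.exists_psi hk (hg.append hg' hqp)
  obtain ⟨a, b, hab, ha1, ha2, hb1, hb2⟩ := exists_letters_notMem hk q q' p p'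
  obtain ⟨Q, hQ, lQ⟩ := exists_long_path hk ℓ a b
  have h1 := hφ a b (Q ++ Q) (hQ.append hQ hab.symm) hab ha2 hb1 (by simp; omega)
  have h2 := h a b Q hQ hab ha1 hb1 lQ
  have h3 := h' a b Q hQ hab ha2 hb2 lQ
  have h4 := H.additive hk hab hab hab.symm hab.symm hQ hQ lQ lQ
  have hgQ := hg'.append hQ ha2.symm
  have hQg := hQ.append hg hb1
  have h5 := H.additive hk hb2.symm ha1 hab.symm hqp hgQ hQg (by simp; omega) (by simp; omega)
  have h6 := H.rot hg (hgQ.append hQ hab.symm) hqp hb1 (by simp; omega)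
  have h7 := H.rot hQ hg hb1 ha1.symm (by omega)
  rw [h7, h2, h3] at h5
  simp only [List.append_assoc] at h1 h5 h6
  rw [h6, h5, h4] at h1
  have e : φ = ψ + ψ' := by
    have : φ = (φ + (cls Q + cls Q)) - (cls Q + cls Q) := by abel
    rw [this, ← h1]; abel
  rw [← e]
  exact hφ

/-- Contributions of words add up, so they are determined by those of the letters, and inverse
letters contribute opposite values. The remaining sum involves the word only through its exponent
sums. -/
theorem exists_linear : ∃ E : Fin k → A, ∀ a b w, Path a b w → a ≠ b → ℓ ≤ w.length →
    cls w = ∑ i, hom w i • E i := by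
  choose ψ hψ using fun x : Letter k => H.exists_psi hk (Path.letter x)
  have hinv : ∀ x, ψ x.inv = -ψ x := by
    intro x
    obtain ⟨a, b, hab, ha1, ha2, hb1, hb2⟩ := exists_letters_notMem hk x x.inv x x.inv
    obtain ⟨Q, hQ, lQ⟩ := exists_long_path hk ℓ a b
    have h1 := hψ x a b Q hQ hab ha2 hb1 lQ
    have h2 := hψ x.inv b a _ hQ.inv hab.symm (by simpa using hb1) ha2 (by simpa)
    have h3 := H.inv ((Path.letter x).append hQ ha2.symm) hb1.symm (by simp; omega)
    have h4 := H.rot (hQ.inv) (Path.letter x).inv ha2 hb1.symm (by simp; omega)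
    have e : wordInv [x] = [x.inv] := rfl
    rw [wordInv_append, h4, e, h2, H.inv hQ hab lQ, h1] at h3
    have : ψ x.inv = (ψ x.inv + -cls Q) + cls Q := by abel
    rw [this, h3]; abel
  let E : Fin k → A := fun i => ψ (i, true)
  have hE : ∀ x, ψ x = ∑ i, hom [x] i • E i := by
    have h1 : ∀ i, ψ (i, true) = ∑ j, hom [(i, true)] j • E j := by
      intro i
      rw [Finset.sum_eq_single i]
      · simp [hom, E]
      · intro j _ hj
        simp [hom, Pi.single_eq_of_ne hj]
      · simp
    rintro ⟨i, b⟩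
    cases b
    · have h2 : ((i, false) : Letter k) = Letter.inv (i, true) := rfl
      rw [h2, hinv, h1, hom_letter_inv]
      simp
    · exact h1 i
  have hall : ∀ (w : List (Letter k)) (p q : Letter k), Path p q w →
      IsContribution ℓ cls p q w (∑ i, hom w i • E i) := by
    intro w
    induction w with
    | nil => intro p q h; exact absurd rfl h.ne_nil
    | cons x w ih =>
      intro p q h
      rcases w with _ | ⟨y, w⟩
      · have e1 := (Path.letter x).head_unique h
        have e2 := (Path.letter x).last_unique h
        rw [← e1, ← e2, ← hE]
        exact hψ x
      · rw [← List.singleton_append] at h ⊢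
        obtain ⟨b, c, h1, h2, hbc⟩ := h.of_append (by simp) (by simp)
        have e1 := (Path.letter x).head_unique h1
        have e2 := (Path.letter x).last_unique h1
        subst e1 e2
        have := H.contribution_append hk h1 h2 hbc (hψ x) (ih c q h2)
        rw [hE, ← Finset.sum_add_distrib] at this
        simpa only [hom_append, Pi.add_apply, add_smul] using this
  refine ⟨E, fun a b w hw hab lw => ?_⟩
  obtain ⟨c, d, hcd, hc, -, hd, -⟩ := exists_letters_notMem hk b b a a
  obtain ⟨Q, hQ, lQ⟩ := exists_long_path hk ℓ c d
  have h1 := hall w a b hw c d Q hQ hcd hc hd lQ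
  rw [H.additive hk hab hcd hc.symm hd hw hQ lw lQ] at h1
  exact add_right_cancel h1

end IsClassFun
end Classes
end ThinFatgraph

namespace ThinFatgraph

/-! ### Spacing of marks, mirror images, and one-mark loops -/

section Calculus

variable {k L : ℕ}

theorem Marked.lt {u : List (Letter k × Bool)} {i : ℕ} (h : Marked u i) : i < u.length := by
  obtain ⟨x, hx⟩ := h
  exact (List.getElem?_eq_some_iff.1 hx).1

theorem marked_append_left {a b : List (Letter k × Bool)} {i : ℕ} (hi : i < a.length) :
    Marked (a ++ b) i ↔ Marked a i := by
  simp only [Marked, List.getElem?_append_left hi]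

theorem marked_append_right {a b : List (Letter k × Bool)} {i : ℕ} (hi : a.length ≤ i) :
    Marked (a ++ b) i ↔ Marked b (i - a.length) := by
  simp only [Marked, List.getElem?_append_right hi]

@[simp] theorem length_tick (u : List (Letter k × Bool)) : (tick u).length = u.length := by
  cases u <;> rfl

@[simp] theorem length_plain (w : List (Letter k)) : (plain w).length = w.length := by
  simp [plain]

@[simp] theorem length_labels (u : List (Letter k × Bool)) : (labels u).length = u.length := by
  simp [labels]

@[simp] theorem labels_append (u v : List (Letter k × Bool)) :
    labels (u ++ v) = labels u ++ labels v := by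
  simp [labels]

@[simp] theorem plain_append (v w : List (Letter k)) : plain (v ++ w) = plain v ++ plain w := by
  simp [plain]

attribute [simp] labels_plain labels_tick

theorem tick_append {u v : List (Letter k × Bool)} (hu : u ≠ []) :
    tick (u ++ v) = tick u ++ v := by
  cases u
  · exact absurd rfl hu
  · rfl

theorem marked_tick {u : List (Letter k × Bool)} {i : ℕ} :
    Marked (tick u) i ↔ (i = 0 ∧ u ≠ []) ∨ Marked u i := by
  cases u with
  | nil => simp [tick]
  | cons x u =>
    cases i with
    | zero => simp [tick, Marked]
    | succ i => simp [tick, Marked]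

/-- The end points and the marked vertices have pairwise distance at least `L`. -/
def Spaced (L : ℕ) (u : List (Letter k × Bool)) : Prop :=
  u ≠ [] ∧ ∀ i j, i < j → j ≤ u.length → IsSpec u i → IsSpec u j → L ≤ j - i

theorem Sep.spaced {u : List (Letter k × Bool)} (h : Sep L u) : Spaced L u := ⟨h.ne_nil, h.sep⟩

theorem Spaced.sep {u : List (Letter k × Bool)} (h : Spaced L u) (h0 : ¬ Marked u 0) : Sep L u :=
  ⟨h.1, h0, h.2⟩

theorem Spaced.tick {u : List (Letter k × Bool)} (h : Spaced L u) :
    Spaced L (ThinFatgraph.tick u) := by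
  refine ⟨fun e => h.1 ?_, fun i j hij hj hi hj' => h.2 i j hij (by simpa using hj) ?_ ?_⟩
  · have := congrArg List.length e
    simpa using this
  all_goals
    simp only [IsSpec, length_tick, marked_tick] at *
    tauto

theorem Spaced.append {a b : List (Letter k × Bool)} (ha : Spaced L a) (hb : Spaced L b) :
    Spaced L (a ++ b) := by
  have left : ∀ i < a.length, IsSpec (a ++ b) i → IsSpec a i := by
    rintro i hi (h | h | h)
    · exact .inl h
    · simp only [List.length_append] at h; omega
    · exact .inr (.inr ((marked_append_left hi).1 h))
  have right : ∀ i, a.length ≤ i → IsSpec (a ++ b) i → IsSpec b (i - a.length) := by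
    rintro i hi (h | h | h)
    · exact .inl (by omega)
    · exact .inr (.inl (by simp only [List.length_append] at h; omega))
    · exact .inr (.inr ((marked_append_right hi).1 h))
  refine ⟨by simp [ha.1], fun i j hij hj hi hj' => ?_⟩
  rw [List.length_append] at hj
  by_cases h1 : a.length ≤ i
  · have := hb.2 _ _ (by omega) (by omega) (right i h1 hi) (right j (by omega) hj')
    omega
  · push Not at h1
    by_cases h2 : a.length ≤ j
    · have := ha.2 i a.length h1 le_rfl (left i h1 hi) (.inr (.inl rfl))
      omega
    · push Not at h2
      exact ha.2 i j hij h2.le (left i h1 hi) (left j h2 hj')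

theorem spaced_plain {w : List (Letter k)} (hL : 0 < L) (h : L ≤ w.length) : Spaced L (plain w) := by
  refine ⟨fun e => ?_, fun i j hij hj hi hj' => ?_⟩
  · have := congrArg List.length e
    simp at this
    simp [this] at h
    omega
  · simp only [IsSpec, length_plain, not_marked_plain, or_false] at *
    omega

/-- A word as a marked loop with a single mark, at the initial vertex. -/
def onem (w : List (Letter k)) : List (Letter k × Bool) := tick (plain w)

theorem spaced_onem {w : List (Letter k)} (hL : 0 < L) (h : L ≤ w.length) : Spaced L (onem w) :=
  (spaced_plain hL h).tick

@[simp] theorem labels_onem (w : List (Letter k)) : labels (onem w) = w := by simp [onem]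

@[simp] theorem length_onem (w : List (Letter k)) : (onem w).length = w.length := by simp [onem]

theorem onem_append {v w : List (Letter k)} (hv : v ≠ []) : onem (v ++ w) = onem v ++ plain w := by
  rw [onem, plain_append, tick_append]
  · rfl
  · simpa [plain] using hv

theorem not_marked_append_zero {a b : List (Letter k × Bool)} (ha : a ≠ []) (h : ¬ Marked a 0) :
    ¬ Marked (a ++ b) 0 := by
  rwa [marked_append_left (List.length_pos_iff.2 ha)]

theorem sep_append {a b : List (Letter k × Bool)} (ha : Sep L a) (hb : Spaced L b) :
    Sep L (a ++ b) :=
  (ha.spaced.append hb).sep (not_marked_append_zero ha.ne_nil ha.head)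

theorem sep_plain {w : List (Letter k)} (hL : 0 < L) (h : L ≤ w.length) : Sep L (plain w) :=
  (spaced_plain hL h).sep not_marked_plain

theorem Good.add {M N : Multiset (List (Letter k × Bool))} (hM : Good L M) (hN : Good L N) :
    Good L (M + N) := by
  induction hM with
  | zero => simpa using hN
  | rot a b M _ ih =>
    rw [Multiset.cons_add] at ih ⊢
    exact .rot a b _ ih
  | ann u M hu _ ih =>
    rw [Multiset.cons_add, Multiset.cons_add]
    exact .ann u _ hu ih
  | split u A B M hu hA hB mA mB _ ih =>
    rw [Multiset.cons_add] at ih ⊢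
    rw [Multiset.cons_add] at ih
    exact .split u A B _ hu hA hB mA mB ih
  | merge u A B M hu hA hB mA mB _ ih =>
    rw [Multiset.cons_add] at ih ⊢
    rw [Multiset.cons_add]
    exact .merge u A B _ hu hA hB mA mB ih

theorem Good.nsmul {M : Multiset (List (Letter k × Bool))} (hM : Good L M) (n : ℕ) :
    Good L (n • M) := by
  induction n with
  | zero => simpa using Good.zero
  | succ n ih => rw [succ_nsmul]; exact ih.add hM

@[simp] theorem hom_labels_bar (u : List (Letter k × Bool)) :
    hom (labels (bar u)) = -hom (labels u) := by
  simp [bar]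

/-- Every rule removes a word together with its inverse. This is what makes exchange loops
null-homologous later on. -/
theorem Good.hom_eq_zero {M : Multiset (List (Letter k × Bool))} (hM : Good L M) :
    (M.map fun l => hom (labels l)).sum = 0 := by
  induction hM with
  | zero => rfl
  | rot a b M _ ih =>
    rw [← ih]
    simp [add_comm (hom (labels a))]
  | ann u M hu _ ih => simp [ih]
  | split u A B M hu hA hB mA mB _ ih =>
    rw [← ih]
    simp
    abel
  | merge u A B M hu hA hB mA mB _ ih =>
    rw [← ih]
    simp
    abel

/-- The mark at the head of a marked list, and a default value if there is none. -/
def headMark (nx : Bool) : List (Letter k × Bool) → Bool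
  | [] => nx
  | x :: _ => x.2

/-- The inverse of a marked list, where `nx` tells whether the terminal vertex is marked. -/
def revMark (nx : Bool) : List (Letter k × Bool) → List (Letter k × Bool)
  | [] => []
  | x :: l => revMark nx l ++ [(x.1.inv, headMark nx l)]

/-- The inverse of a marked loop. -/
def mirror (c : List (Letter k × Bool)) : List (Letter k × Bool) := revMark (headMark false c) c

theorem revMark_append (nx : Bool) (a b : List (Letter k × Bool)) :
    revMark nx (a ++ b) = revMark nx b ++ revMark (headMark nx b) a := by
  induction a with
  | nil => simp [revMark]
  | cons x a ih =>
    simp only [List.cons_append, revMark, ih, List.append_assoc]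
    congr 2
    cases a <;> rfl

theorem headMark_append {nx : Bool} {a b : List (Letter k × Bool)} (ha : a ≠ []) :
    headMark nx (a ++ b) = headMark false a := by
  cases a
  · exact absurd rfl ha
  · rfl

theorem headMark_of_ne_nil {nx : Bool} {a : List (Letter k × Bool)} (ha : a ≠ []) :
    headMark nx a = headMark false a := by
  simpa using headMark_append (nx := nx) (b := []) ha

theorem headMark_eq_false {a : List (Letter k × Bool)} (ha : ¬ Marked a 0) :
    headMark false a = false := by
  rcases a with _ | ⟨x, a⟩
  · rfl
  · rw [marked_zero_cons] at ha
    exact eq_false_of_ne_true ha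

theorem headMark_tick {nx : Bool} {a : List (Letter k × Bool)} (ha : a ≠ []) :
    headMark nx (tick a) = true := by
  cases a
  · exact absurd rfl ha
  · rfl

@[simp] theorem length_revMark (nx : Bool) (a : List (Letter k × Bool)) :
    (revMark nx a).length = a.length := by
  induction a with
  | nil => rfl
  | cons x a ih => simp [revMark, ih]

theorem labels_revMark (nx : Bool) (a : List (Letter k × Bool)) :
    labels (revMark nx a) = wordInv (labels a) := by
  induction a with
  | nil => rfl
  | cons x a ih => 
    rw [revMark, labels_append, ih]
    simp [labels, wordInv]

theorem revMark_ne_nil {nx : Bool} {a : List (Letter k × Bool)} (ha : a ≠ []) :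
    revMark nx a ≠ [] := by
  intro e
  have := congrArg List.length e
  exact ha (by simpa using this)

theorem revMark_true {a : List (Letter k × Bool)} :
    revMark true a = tick (revMark false a) := by
  induction a with
  | nil => rfl
  | cons x a ih =>
    rcases a with _ | ⟨y, a⟩
    · rfl
    · have h1 : ∀ nx, revMark nx (x :: y :: a) = revMark nx (y :: a) ++ [(x.1.inv, y.2)] :=
        fun _ => rfl
      rw [h1, ih, h1, tick_append (revMark_ne_nil (by simp))]

theorem revMark_tick {nx : Bool} {a : List (Letter k × Bool)} :
    revMark nx (tick a) = revMark nx a := by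
  cases a <;> rfl

theorem revMark_plain {w : List (Letter k)} : revMark false (plain w) = plain (wordInv w) := by
  induction w with
  | nil => rfl
  | cons x w ih =>
    have : plain (x :: w) = (x, false) :: plain w := rfl
    rw [this, revMark, ih]
    have h2 : headMark false (plain w) = false := by cases w <;> rfl
    rw [h2]
    simp [plain, wordInv]

theorem not_marked_revMark_zero {a : List (Letter k × Bool)} : ¬ Marked (revMark false a) 0 := by
  induction a with
  | nil => simp [revMark, Marked]
  | cons x a ih =>
    rcases a with _ | ⟨y, a⟩
    · simp [revMark, marked_zero_cons, headMark]
    · rw [revMark]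
      exact not_marked_append_zero (revMark_ne_nil (by simp)) ih

theorem marked_revMark {a : List (Letter k × Bool)} {i : ℕ} (hi : 0 < i) (hi' : i < a.length) :
    Marked (revMark false a) i ↔ Marked a (a.length - i) := by
  induction a generalizing i with
  | nil => simp at hi'
  | cons x a ih =>
    rw [revMark]
    simp only [List.length_cons] at hi' ⊢
    by_cases h : i < a.length
    · rw [marked_append_left (by simpa), ih hi h,
        show a.length + 1 - i = (a.length - i) + 1 by omega]
      simp [Marked]
    · have : i = a.length := by omega
      subst this
      rw [marked_append_right (by simp)]
      rcases a with _ | ⟨y, a⟩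
      · simp at hi
      · rw [show (y :: a).length - (revMark false (y :: a)).length = 0 by simp,
          show (y :: a).length + 1 - (y :: a).length = 0 + 1 by omega, marked_zero_cons]
        simp only [Marked, List.getElem?_cons_succ]
        exact marked_zero_cons.symm

theorem Sep.revMark {a : List (Letter k × Bool)} (h : Sep L a) : Sep L (revMark false a) := by
  have hs : ∀ i ≤ a.length, IsSpec (ThinFatgraph.revMark false a) i → IsSpec a (a.length - i) := by
    rintro i hi (h1 | h1 | h1)
    · exact .inr (.inl (by omega))
    · exact .inl (by simp at h1; omega)
    · have := h1.lt
      rw [length_revMark] at this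
      rcases Nat.eq_zero_or_pos i with rfl | h0
      · exact absurd h1 not_marked_revMark_zero
      · exact .inr (.inr ((marked_revMark h0 this).1 h1))
  refine ⟨revMark_ne_nil h.ne_nil, not_marked_revMark_zero, fun i j hij hj hi hj' => ?_⟩
  rw [length_revMark] at hj
  have := h.sep (a.length - j) (a.length - i) (by omega) (by omega) (hs j hj hj')
    (hs i (by omega) hi)
  omega

theorem bar_revMark {a : List (Letter k × Bool)} :
    bar (revMark false a) = revMark false (bar a) := by
  rw [bar, labels_revMark, bar, revMark_plain]

/-- Reversing the orientation of all loops turns a sequence of cuts into a sequence of cuts of the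
same kind: the glued word `u` is replaced by its reversal, and the parts `A` and `B` are reversed,
in the opposite cyclic order. Spacing of marks is symmetric under reversal. -/
theorem Good.mirror {M : Multiset (List (Letter k × Bool))} (hM : Good L M) :
    Good L (M.map ThinFatgraph.mirror) := by
  induction hM with
  | zero => exact .zero
  | rot a b M _ ih =>
    by_cases ha : a = []
    · subst ha; simpa using ih
    by_cases hb : b = []
    · subst hb; simpa using ih
    rw [Multiset.map_cons] at ih ⊢
    rw [ThinFatgraph.mirror, headMark_append ha, revMark_append, headMark_of_ne_nil hb] at ih
    rw [ThinFatgraph.mirror, headMark_append hb, revMark_append, headMark_of_ne_nil ha]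
    exact .rot _ _ _ ih
  | ann u M hu _ ih =>
    rw [Multiset.map_cons, Multiset.map_cons]
    have hb : bar u ≠ [] := by
      intro e
      have := congrArg List.length e
      exact hu.ne_nil (by simpa [bar] using this)
    rw [ThinFatgraph.mirror, headMark_eq_false hu.head, ThinFatgraph.mirror, headMark_tick hb,
      revMark_tick, revMark_true, ← bar_revMark]
    exact .ann _ _ hu.revMark ih
  | split u A B M hu hA hB mA mB _ ih =>
    rw [Multiset.map_cons] at ih ⊢
    rw [Multiset.map_cons] at ih
    rw [ThinFatgraph.mirror, headMark_tick hA, revMark_tick, revMark_true, ThinFatgraph.mirror,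
      headMark_tick hB, revMark_tick, revMark_true, Multiset.cons_swap] at ih
    have hb : bar u ≠ [] := by
      intro e
      have := congrArg List.length e
      exact hu.ne_nil (by simpa [bar] using this)
    have e1 : ThinFatgraph.mirror (u ++ A ++ bar u ++ B) =
        (revMark false B ++ bar (revMark false u) ++ revMark false A) ++ revMark false u := by
      rw [ThinFatgraph.mirror, List.append_assoc, List.append_assoc, headMark_append hu.ne_nil,
        headMark_eq_false hu.head, revMark_append, headMark_append hA, headMark_eq_false mA,
        revMark_append, headMark_append hb, revMark_append, headMark_eq_false (a := bar u) not_marked_plain,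
        headMark_eq_false mB, bar_revMark]
    rw [e1]
    refine .rot _ _ _ ?_
    rw [← List.append_assoc, ← List.append_assoc]
    exact .split _ _ _ _ hu.revMark (revMark_ne_nil hB) (revMark_ne_nil hA)
      not_marked_revMark_zero not_marked_revMark_zero ih
  | merge u A B M hu hA hB mA mB _ ih =>
    rw [Multiset.map_cons] at ih ⊢
    rw [Multiset.map_cons]
    have hb : bar u ≠ [] := by
      intro e
      have := congrArg List.length e
      exact hu.ne_nil (by simpa [bar] using this)
    have hA' : tick A ≠ [] := by
      intro e
      have := congrArg List.length e
      exact hA (by simpa using this)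
    rw [ThinFatgraph.mirror, headMark_append hA', headMark_tick hA, revMark_append,
      headMark_tick hB, revMark_tick, revMark_tick, revMark_true, revMark_true] at ih
    rw [ThinFatgraph.mirror, headMark_append hu.ne_nil, headMark_eq_false hu.head, revMark_append,
      headMark_eq_false mA, ThinFatgraph.mirror, headMark_append hb,
      headMark_eq_false (a := bar u) not_marked_plain, revMark_append, headMark_eq_false mB, ← bar_revMark]
    refine .rot _ _ _ ?_
    rw [Multiset.cons_swap]
    refine .rot _ _ _ ?_
    rw [Multiset.cons_swap]
    refine .merge _ _ _ _ hu.revMark (revMark_ne_nil hA) (revMark_ne_nil hB)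
      not_marked_revMark_zero not_marked_revMark_zero (.rot _ _ _ ih)

/-- A loop without close marks can be paired with a loop with a single mark. -/
theorem Good.pair {X Y : List (Letter k × Bool)} (h : Sep L (Y ++ X))
    {M : Multiset (List (Letter k × Bool))} (hM : Good L M) :
    Good L ((X ++ Y) ::ₘ onem (wordInv (labels (Y ++ X))) ::ₘ M) :=
  .rot _ _ _ (.ann _ _ h hM)

/-- The loop is rotated to begin with `b`, so that its mark lies inside the glued circle, at
distance `|b|` and `|a|` from the base point, where the mark of the other loop sits. -/
theorem good_onem_pair (hL : 0 < L) {a b : List (Letter k)} (ha : L ≤ a.length)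
    (hb : L ≤ b.length) : Good L {onem (a ++ b), onem (wordInv (b ++ a))} := by
  have h1 := Good.pair (k := k) (L := L) (X := onem a) (Y := plain b)
    (sep_append (sep_plain hL hb) (spaced_onem hL ha)) .zero
  rw [← onem_append (by rintro rfl; simp at ha; omega)] at h1
  simpa using h1

/-- After the cut along `u` the two remaining loops carry marks at the new corners, and one of them
still carries the original mark between `b'` and `c`. Each is paired with a one-mark loop whose base
point avoids these marks. Modulo inversion this is the relation that the class of `u X u⁻¹ Y` is the
sum of those of `X` and `Y`. -/
theorem good_onem_split (hL : 0 < L) {u a a' b b' c : List (Letter k)} (hu : L ≤ u.length)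
    (ha : L ≤ a.length) (ha' : L ≤ a'.length) (hb : L ≤ b.length) (hb' : L ≤ b'.length)
    (hc : L ≤ c.length) :
    Good L {onem (c ++ u ++ (a ++ a') ++ wordInv u ++ (b ++ b')), onem (wordInv (a' ++ a)),
      onem (wordInv (b' ++ c ++ b))} := by
  have nn : ∀ {w : List (Letter k)}, L ≤ w.length → w ≠ [] := by
    rintro w hw rfl
    simp at hw; omega
  have np : ∀ {w : List (Letter k)}, L ≤ w.length → plain w ≠ [] := fun hw => 
    (sep_plain hL hw).ne_nil
  have h1 := Good.pair (k := k) (L := L) (X := onem a) (Y := plain a')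
    (sep_append (sep_plain hL ha') (spaced_onem hL ha)) .zero
  have h2 := Good.pair (k := k) (L := L) (X := onem b) (Y := plain b' ++ onem c)
    (sep_append (sep_append (sep_plain hL hb') (spaced_onem hL hc)) (spaced_onem hL hb)) .zero
  have h3 := h1.add h2
  have e1 : onem a ++ plain a' = tick (plain a ++ plain a') := (tick_append (np ha)).symm
  have e2 : onem b ++ (plain b' ++ onem c) = tick (plain b ++ plain b' ++ onem c) := by
    rw [List.append_assoc, tick_append (np hb)]; rfl
  rw [e1, e2] at h3
  have h4 := Good.split (plain u) (plain a ++ plain a') (plain b ++ plain b' ++ onem c)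
    {onem (wordInv (a' ++ a)), onem (wordInv (b' ++ c ++ b))} (sep_plain hL hu)
    (by simp [np ha]) (by simp [np hb]) (not_marked_append_zero (np ha) not_marked_plain)
    (by
      rw [List.append_assoc]
      exact not_marked_append_zero (np hb) not_marked_plain)
    (by
      convert h3 using 1
      simp
      rw [← Multiset.singleton_add, ← Multiset.singleton_add, ← Multiset.singleton_add,
        ← Multiset.singleton_add, ← Multiset.singleton_add]
      abel)
  have e3 : plain u ++ (plain a ++ plain a') ++ bar (plain u) ++ (plain b ++ plain b' ++ onem c) =
      (plain u ++ (plain a ++ plain a') ++ bar (plain u) ++ (plain b ++ plain b')) ++ onem c := by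
    simp
  rw [e3] at h4
  have h5 := Good.rot _ _ _ h4
  convert h5 using 2
  simp [onem_append (nn hc), bar]

/-- The merged loop carries four marks, two old ones and two from the new corners. The lower bounds
on the lengths keep them apart, also from the base point between `a` and `a'` at which the loop is
paired. -/
theorem good_onem_merge (hL : 0 < L) {u a a' b c d : List (Letter k)} (hu : L ≤ u.length)
    (ha : L ≤ a.length) (ha' : L ≤ a'.length) (hb : L ≤ b.length) (hc : L ≤ c.length)
    (hd : L ≤ d.length) :
    Good L {onem (b ++ u ++ (a ++ a')), onem (d ++ wordInv u ++ c),
      onem (wordInv (a' ++ b ++ c ++ d ++ a))} := by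
  have nn : ∀ {w : List (Letter k)}, L ≤ w.length → w ≠ [] := by
    rintro w hw rfl
    simp at hw; omega
  have np : ∀ {w : List (Letter k)}, L ≤ w.length → plain w ≠ [] := fun hw => 
    (sep_plain hL hw).ne_nil
  have h1 := Good.pair (k := k) (L := L) (X := onem a) (Y := plain a' ++ onem b ++ onem c ++ onem d)
    (sep_append (sep_append (sep_append (sep_append (sep_plain hL ha') (spaced_onem hL hb))
      (spaced_onem hL hc)) (spaced_onem hL hd)) (spaced_onem hL ha)) .zero
  have e1 : onem a ++ (plain a' ++ onem b ++ onem c ++ onem d) =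
      tick (plain a ++ plain a' ++ onem b) ++ tick (plain c ++ onem d) := by
    rw [tick_append (np hc), List.append_assoc (plain a), tick_append (np ha)]
    simp [onem]
  rw [e1] at h1
  have h2 := Good.merge (plain u) _ _ _ (sep_plain hL hu) (by simp [np ha]) (by simp [np hc])
    (by
      rw [List.append_assoc]
      exact not_marked_append_zero (np ha) not_marked_plain)
    (not_marked_append_zero (np hc) not_marked_plain) h1
  have e2 : plain u ++ (plain a ++ plain a' ++ onem b) =
      (plain u ++ (plain a ++ plain a')) ++ onem b := by simp
  have e3 : bar (plain u) ++ (plain c ++ onem d) = (bar (plain u) ++ plain c) ++ onem d := by simp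
  rw [e2, e3] at h2
  have h3 := Good.rot _ _ _ h2
  rw [Multiset.cons_swap] at h3
  have h4 := Good.rot _ _ _ h3
  rw [Multiset.cons_swap] at h4
  have e4 : onem (b ++ u ++ (a ++ a')) = onem b ++ (plain u ++ (plain a ++ plain a')) := by
    simp [onem_append (nn hb)]
  have e5 : onem (d ++ wordInv u ++ c) = onem d ++ (bar (plain u) ++ plain c) := by
    simp [onem_append (nn hd), bar]
  have e6 : labels (plain a' ++ onem b ++ onem c ++ onem d ++ onem a) = a' ++ b ++ c ++ d ++ a := by
    simp
  rw [e4, e5]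
  rw [e6] at h4
  exact h4

end Calculus

end ThinFatgraph

namespace ThinFatgraph

/-! ### Homologically trivial collections are stably good -/

section StableGood

variable {k L : ℕ}

/-- Cyclically reduced words. -/
def CycRed (w : List (Letter k)) : Prop := ∃ a b, Path a b w ∧ a ≠ b

theorem CycRed.rot {X Y : List (Letter k)} (h : CycRed (X ++ Y)) : CycRed (Y ++ X) := by
  by_cases hX : X = []
  · subst hX; simpa using h
  by_cases hY : Y = []
  · subst hY; simpa using h
  obtain ⟨a, d, h, had⟩ := h
  obtain ⟨b, c, h1, h2, hbc⟩ := h.of_append hX hY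
  exact ⟨c, b, h2.append h1 had.symm, hbc.symm⟩

theorem CycRed.inv {w : List (Letter k)} (h : CycRed w) : CycRed (wordInv w) := by
  obtain ⟨a, b, h, hab⟩ := h
  exact ⟨b, a, h.inv, hab.symm⟩

/-- Cyclically reduced words of length at least `4 L`. -/
def Admissible (L : ℕ) (w : List (Letter k)) : Prop := CycRed w ∧ 4 * L ≤ w.length

theorem Admissible.rot {X Y : List (Letter k)} (h : Admissible L (X ++ Y)) :
    Admissible L (Y ++ X) :=
  ⟨h.1.rot, by have := h.2; simp only [List.length_append] at *; omega⟩

theorem Admissible.inv {w : List (Letter k)} (h : Admissible L w) : Admissible L (wordInv w) :=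
  ⟨h.1.inv, by simpa using h.2⟩

/-- Collections of admissible words whose one-mark loops form a good collection. -/
def GoodWords (L : ℕ) (W : Multiset (List (Letter k))) : Prop :=
  (∀ w ∈ W, Admissible L w) ∧ Good L (W.map onem)

theorem GoodWords.zero : GoodWords L (0 : Multiset (List (Letter k))) :=
  ⟨by simp, .zero⟩

theorem GoodWords.add {V W : Multiset (List (Letter k))} (hV : GoodWords L V)
    (hW : GoodWords L W) : GoodWords L (V + W) := by
  refine ⟨fun w hw => ?_, ?_⟩
  · rcases Multiset.mem_add.1 hw with h | h
    · exact hV.1 w h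
    · exact hW.1 w h
  · rw [Multiset.map_add]
    exact hV.2.add hW.2

/-- The multiplicities of a multiset of words. -/
def wordCount : Multiset (List (Letter k)) →+ (List (Letter k) → ℤ) where
  toFun M w := M.count w
  map_zero' := by ext; simp
  map_add' M N := by ext; simp

theorem wordCount_injective : Function.Injective (wordCount (k := k)) := fun M N h => by
  ext w
  have := congrFun h w
  change (M.count w : ℤ) = N.count w at this
  exact_mod_cast this

/-- The subgroup generated by the good collections of words. -/
def goodSubgroup (k L : ℕ) : AddSubgroup (List (Letter k) → ℤ) :=
  AddSubgroup.closure {f | ∃ W, GoodWords L W ∧ wordCount W = f}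

theorem exists_of_mem_goodSubgroup {f : List (Letter k) → ℤ} (hf : f ∈ goodSubgroup k L) :
    ∃ V W, GoodWords L V ∧ GoodWords L W ∧ f = wordCount V - wordCount W := by
  induction hf using AddSubgroup.closure_induction with
  | mem f hf =>
    obtain ⟨W, hW, rfl⟩ := hf
    exact ⟨W, 0, hW, .zero, by simp⟩
  | zero => exact ⟨0, 0, .zero, .zero, by simp⟩
  | add f g _ _ hf hg =>
    obtain ⟨V, W, hV, hW, rfl⟩ := hf
    obtain ⟨V', W', hV', hW', rfl⟩ := hg
    exact ⟨V + V', W + W', hV.add hV', hW.add hW', by simp; abel⟩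
  | neg f _ hf =>
    obtain ⟨V, W, hV, hW, rfl⟩ := hf
    exact ⟨W, V, hW, hV, by abel⟩

/-- The class of a word modulo good collections. -/
def wordClass (L : ℕ) (w : List (Letter k)) : (List (Letter k) → ℤ) ⧸ goodSubgroup k L :=
  QuotientAddGroup.mk (wordCount {w})

theorem sum_wordClass (W : Multiset (List (Letter k))) :
    (W.map (wordClass L)).sum = QuotientAddGroup.mk (wordCount W) := by
  induction W using Multiset.induction_on with
  | empty => simp
  | cons w W ih =>
    rw [Multiset.map_cons, Multiset.sum_cons, ih, ← Multiset.singleton_add, map_add]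
    rfl

theorem GoodWords.sum_eq_zero {W : Multiset (List (Letter k))} (hW : GoodWords L W) :
    (W.map (wordClass L)).sum = 0 := by
  rw [sum_wordClass, QuotientAddGroup.eq_zero_iff]
  exact AddSubgroup.subset_closure ⟨W, hW, rfl⟩

/-- Good collections are closed under sums, so the subgroup they generate consists of differences of
two of them; an equation between multiplicities is an equation between multisets. -/
theorem exists_of_sum_eq_zero {W : Multiset (List (Letter k))}
    (h : (W.map (wordClass L)).sum = 0) : ∃ U V, GoodWords L U ∧ GoodWords L V ∧ W + V = U := by
  rw [sum_wordClass, QuotientAddGroup.eq_zero_iff] at h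
  obtain ⟨U, V, hU, hV, e⟩ := exists_of_mem_goodSubgroup h
  refine ⟨U, V, hU, hV, wordCount_injective ?_⟩
  rw [map_add, e, sub_add_cancel]

theorem wordClass_pair (hL : 0 < L) {a b : List (Letter k)} (h : Admissible L (a ++ b))
    (ha : L ≤ a.length) (hb : L ≤ b.length) :
    wordClass L (wordInv (b ++ a)) = -wordClass L (a ++ b) := by
  have h1 : GoodWords L {a ++ b, wordInv (b ++ a)} := by
    refine ⟨?_, by simpa using good_onem_pair hL ha hb⟩
    intro w hw
    simp only [Multiset.insert_eq_cons, Multiset.mem_cons, Multiset.mem_singleton] at hw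
    rcases hw with rfl | rfl
    · exact h
    · exact h.rot.inv
  have h2 := h1.sum_eq_zero
  simp only [Multiset.insert_eq_cons, Multiset.map_cons, Multiset.map_singleton,
    Multiset.sum_cons, Multiset.sum_singleton] at h2
  exact eq_neg_of_add_eq_zero_right h2

/-- Cut `x w` as `(x w₁)(w₂)` and `w x` as `(w₁)(w₂ x)`. Both pairings use the same partner, the
inverse of `w₂ x w₁`, so both classes are the negative of its class. -/
theorem wordClass_rot_one (hL : 0 < L) {x : Letter k} {w : List (Letter k)}
    (h : Admissible L (x :: w)) : wordClass L (x :: w) = wordClass L (w ++ [x]) := by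
  have hl : 4 * L ≤ w.length + 1 := by simpa using h.2
  have e1 := wordClass_pair hL (a := x :: w.take (2 * L - 1)) (b := w.drop (2 * L - 1))
    (by simpa using h) (by simp; omega) (by simp; omega)
  have h' : Admissible L (w ++ [x]) := by
    have : Admissible L ([x] ++ w) := h
    exact this.rot
  have e2 := wordClass_pair hL (a := w.take (2 * L - 1)) (b := w.drop (2 * L - 1) ++ [x])
    (by rw [← List.append_assoc, List.take_append_drop]; exact h') (by simp; omega) (by simp; omega)
  rw [← List.append_assoc, List.take_append_drop, List.append_assoc, List.singleton_append,
    e1, neg_inj] at e2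
  simpa using e2

theorem wordClass_rot (hL : 0 < L) : ∀ {X Y : List (Letter k)}, Admissible L (X ++ Y) →
    wordClass L (X ++ Y) = wordClass L (Y ++ X)
  | [], Y, _ => by simp
  | x :: X, Y, h => by
    have h1 := wordClass_rot_one hL h
    have h' : Admissible L (X ++ (Y ++ [x])) := by
      have : Admissible L ([x] ++ (X ++ Y)) := h
      simpa using this.rot
    have h2 := wordClass_rot hL h'
    calc wordClass L (x :: X ++ Y) = wordClass L (X ++ (Y ++ [x])) := by
          rw [← List.append_assoc]; exact h1
      _ = _ := by rw [h2]; simp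

/-- The explicit good collections for a pairing, a split and a merge give the relations, up to
rotation and inversion. Length `4 * L` leaves room for cutting a word into up to three parts of
length at least `L`, as required there. -/
theorem isClassFun_wordClass (hL : 0 < L) : IsClassFun (k := k) (4 * L) (wordClass L) := by
  have inv : ∀ {w : List (Letter k)}, Admissible L w →
      wordClass L (wordInv w) = -wordClass L w := by
    intro w h
    have hl := h.2
    have e1 := wordClass_pair hL (a := w.take (2 * L)) (b := w.drop (2 * L))
      (by simpa using h) (by simp; omega) (by simp; omega)
    rw [List.take_append_drop, wordInv_append] at e1
    rw [← e1, wordClass_rot hL, ← wordInv_append, List.take_append_drop]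
    rw [← wordInv_append]
    refine (Admissible.rot ?_).inv
    simpa using h
  have len : ∀ {w : List (Letter k)} {n : ℕ}, n ≤ w.length → (w.take n).length = n := by
    intro w n h; simpa using h
  refine ⟨?_, ?_, ?_, ?_⟩
  · intro a b c d X Y hX hY hbc hda hl
    exact wordClass_rot hL ⟨⟨a, d, hX.append hY hbc, hda.symm⟩, by simpa using hl⟩
  · intro a b X hX hab hl
    exact inv ⟨⟨a, b, hX, hab⟩, hl⟩
  · intro a b c d e f u X Y hu hX hY hbc hdb hae hfa hcd hef lu lX lY
    have vX : Admissible L X := ⟨⟨c, d, hX, hcd⟩, lX⟩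
    have vY : Admissible L Y := ⟨⟨e, f, hY, hef⟩, lY⟩
    have vW : Admissible L (u ++ X ++ wordInv u ++ Y) :=
      ⟨⟨a, f, ((hu.append hX hbc).append hu.inv hdb).append hY hae, hfa.symm⟩, by simp; omega⟩
    obtain ⟨X1, X2, rfl, l1, l2⟩ : ∃ X1 X2, X = X1 ++ X2 ∧ L ≤ X1.length ∧ L ≤ X2.length :=
      ⟨X.take L, X.drop L, (List.take_append_drop _ _).symm, by simp; omega, by simp; omega⟩
    obtain ⟨Y1, Y2, Y3, rfl, m1, m2, m3⟩ : ∃ Y1 Y2 Y3, Y = Y1 ++ Y2 ++ Y3 ∧ L ≤ Y1.length ∧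
        L ≤ Y2.length ∧ L ≤ Y3.length :=
      ⟨Y.take L, (Y.drop L).take L, (Y.drop L).drop L, by simp [-List.drop_drop], by simp; omega,
        by simp; omega, by simp; omega⟩
    have g := good_onem_split (k := k) hL (by omega : L ≤ u.length) l1 l2 m1 m2 m3
    have vW' : Admissible L (Y3 ++ u ++ (X1 ++ X2) ++ wordInv u ++ (Y1 ++ Y2)) := by
      have : Admissible L ((u ++ (X1 ++ X2) ++ wordInv u ++ (Y1 ++ Y2)) ++ Y3) := by
        simpa using vW
      simpa using this.rot
    have vY' : Admissible L (Y2 ++ Y3 ++ Y1) := by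
      have : Admissible L (Y1 ++ (Y2 ++ Y3)) := by simpa using vY
      simpa using this.rot
    have gw : GoodWords L {Y3 ++ u ++ (X1 ++ X2) ++ wordInv u ++ (Y1 ++ Y2),
        wordInv (X2 ++ X1), wordInv (Y2 ++ Y3 ++ Y1)} := by
      refine ⟨?_, by simpa using g⟩
      intro w hw
      simp only [Multiset.insert_eq_cons, Multiset.mem_cons, Multiset.mem_singleton] at hw
      rcases hw with rfl | rfl | rfl
      · exact vW'
      · exact vX.rot.inv
      · exact vY'.inv
    have h2 := gw.sum_eq_zero
    simp only [Multiset.insert_eq_cons, Multiset.map_cons, Multiset.map_singleton,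
      Multiset.sum_cons, Multiset.sum_singleton] at h2
    rw [inv vX.rot, inv vY', ← wordClass_rot hL vX] at h2
    have e1 : wordClass L (Y2 ++ Y3 ++ Y1) = wordClass L (Y1 ++ Y2 ++ Y3) := by
      rw [wordClass_rot hL vY', List.append_assoc]
    have e2 : wordClass L (Y3 ++ u ++ (X1 ++ X2) ++ wordInv u ++ (Y1 ++ Y2)) =
        wordClass L (u ++ (X1 ++ X2) ++ wordInv u ++ (Y1 ++ Y2 ++ Y3)) := by
      have := wordClass_rot hL (X := Y3) (Y := u ++ (X1 ++ X2) ++ wordInv u ++ (Y1 ++ Y2))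
        (by simpa using vW')
      simpa using this
    rw [e1, e2] at h2
    have h3 : wordClass L (u ++ (X1 ++ X2) ++ wordInv u ++ (Y1 ++ Y2 ++ Y3)) -
      (wordClass L (X1 ++ X2) + wordClass L (Y1 ++ Y2 ++ Y3)) = 0 := by rw [← h2]; abel
    exact sub_eq_zero.1 h3
  · intro a b c d e f u X Y hu hX hY hbc hda hae hfb hde hfc lu lX lY
    have v1 : Admissible L (u ++ X) := ⟨⟨a, d, hu.append hX hbc, hda.symm⟩, by simp; omega⟩
    have v2 : Admissible L (wordInv u ++ Y) := ⟨⟨b, f, hu.inv.append hY hae, hfb.symm⟩, by simp; omega⟩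
    have v3 : Admissible L (X ++ Y) := ⟨⟨c, f, hX.append hY hde, hfc.symm⟩, by simp; omega⟩
    obtain ⟨X1, X2, X3, rfl, m1, m2, m3⟩ : ∃ Y1 Y2 Y3, X = Y1 ++ Y2 ++ Y3 ∧ L ≤ Y1.length ∧
        L ≤ Y2.length ∧ L ≤ Y3.length :=
      ⟨X.take L, (X.drop L).take L, (X.drop L).drop L, by simp [-List.drop_drop], by simp; omega,
        by simp; omega, by simp; omega⟩
    obtain ⟨Y1, Y2, rfl, l1, l2⟩ : ∃ X1 X2, Y = X1 ++ X2 ∧ L ≤ X1.length ∧ L ≤ X2.length :=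
      ⟨Y.take L, Y.drop L, (List.take_append_drop _ _).symm, by simp; omega, by simp; omega⟩
    have g := good_onem_merge (k := k) hL (by omega : L ≤ u.length) m1 m2 m3 l1 l2
    have w1 : Admissible L (X3 ++ u ++ (X1 ++ X2)) := by
      have : Admissible L ((u ++ (X1 ++ X2)) ++ X3) := by simpa using v1
      simpa using this.rot
    have w2 : Admissible L (Y2 ++ wordInv u ++ Y1) := by
      have : Admissible L ((wordInv u ++ Y1) ++ Y2) := by simpa using v2
      simpa using this.rot
    have w3 : Admissible L (X2 ++ X3 ++ Y1 ++ Y2 ++ X1) := by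
      have : Admissible L (X1 ++ (X2 ++ X3 ++ Y1 ++ Y2)) := by simpa using v3
      simpa using this.rot
    have gw : GoodWords L {X3 ++ u ++ (X1 ++ X2), Y2 ++ wordInv u ++ Y1,
        wordInv (X2 ++ X3 ++ Y1 ++ Y2 ++ X1)} := by
      refine ⟨?_, by simpa using g⟩
      intro w hw
      simp only [Multiset.insert_eq_cons, Multiset.mem_cons, Multiset.mem_singleton] at hw
      rcases hw with rfl | rfl | rfl
      · exact w1
      · exact w2
      · exact w3.inv
    have h2 := gw.sum_eq_zero
    simp only [Multiset.insert_eq_cons, Multiset.map_cons, Multiset.map_singleton,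
      Multiset.sum_cons, Multiset.sum_singleton] at h2
    have e1 : wordClass L (X3 ++ u ++ (X1 ++ X2)) = wordClass L (u ++ (X1 ++ X2 ++ X3)) := by
      have := wordClass_rot hL (X := X3) (Y := u ++ (X1 ++ X2)) (by simpa using w1)
      simpa using this
    have e2 : wordClass L (Y2 ++ wordInv u ++ Y1) = wordClass L (wordInv u ++ (Y1 ++ Y2)) := by
      have := wordClass_rot hL (X := Y2) (Y := wordInv u ++ Y1) (by simpa using w2)
      simpa using this
    have e3 : wordClass L (X2 ++ X3 ++ Y1 ++ Y2 ++ X1) = wordClass L (X1 ++ X2 ++ X3 ++ (Y1 ++ Y2)) := by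
      have := wordClass_rot hL w3
      simpa using this
    rw [inv w3, e1, e2, e3] at h2
    have h3 : wordClass L (u ++ (X1 ++ X2 ++ X3)) + wordClass L (wordInv u ++ (Y1 ++ Y2)) -
      wordClass L (X1 ++ X2 ++ X3 ++ (Y1 ++ Y2)) = 0 := by rw [← h2]; abel
    exact sub_eq_zero.1 h3

/-- A homologically trivial collection of words is good up to adding good collections. -/
theorem exists_goodWords_of_hom (hk : 2 ≤ k) (hL : 0 < L) {W : Multiset (List (Letter k))}
    (hW : ∀ w ∈ W, Admissible L w) (h : (W.map hom).sum = 0) :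
    ∃ U V, GoodWords L U ∧ GoodWords L V ∧ W + V = U := by
  refine exists_of_sum_eq_zero ?_
  obtain ⟨E, hE⟩ := (isClassFun_wordClass (k := k) hL).exists_linear hk
  have h1 : W.map (wordClass L) = W.map fun w => ∑ i, hom w i • E i := by
    refine Multiset.map_congr rfl fun w hw => ?_
    obtain ⟨⟨a, b, hp, hab⟩, hl⟩ := hW w hw
    exact hE a b w hp hab hl
  have h2 : ∀ W : Multiset (List (Letter k)), (W.map fun w => ∑ i, hom w i • E i).sum =
      ∑ i, (W.map hom).sum i • E i := by
    intro W
    induction W using Multiset.induction_on with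
    | empty => simp
    | cons w W ih =>
      simp only [Multiset.map_cons, Multiset.sum_cons, ih, Pi.add_apply, add_zsmul,
        Finset.sum_add_distrib]
  rw [h1, h2, h]
  simp

end StableGood

end ThinFatgraph

namespace ThinFatgraph

/-! ### A finite absorber for loops of bounded length -/

section Absorber

variable {k L : ℕ}

/-- Marked loops of bounded length that can be paired with one-mark loops. -/
def Tame (L : ℕ) (t : List (Letter k × Bool)) : Prop :=
  Sep L t ∧ CycRed (labels t) ∧ 4 * L ≤ t.length ∧ t.length ≤ 32 * L

theorem finite_tame : Finite {t : List (Letter k × Bool) // Tame L t} := by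
  have h := List.finite_length_le (Letter k × Bool) (32 * L)
  exact (h.subset fun t ht => ht.2.2.2).to_subtype

theorem Good.add_inverses {M : Multiset (List (Letter k × Bool))} (hM : ∀ t ∈ M, Sep L t) :
    Good L (M + (M.map fun t => wordInv (labels t)).map onem) := by
  induction M using Multiset.induction_on with
  | empty => exact .zero
  | cons t M ih =>
    rw [Multiset.map_cons, Multiset.map_cons, Multiset.cons_add, Multiset.add_cons]
    exact .ann _ _ (hM t (by simp)) (ih fun t ht => hM t (by simp [ht]))

theorem Good.multiset_sum {ι : Type*} {l : Multiset ι} {F : ι → Multiset (List (Letter k × Bool))}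
    (h : ∀ x ∈ l, Good L (F x)) : Good L (l.map F).sum := by
  induction l using Multiset.induction_on with
  | empty => exact .zero
  | cons x l ih =>
    rw [Multiset.map_cons, Multiset.sum_cons]
    exact (h x (by simp)).add (ih fun y hy => h y (by simp [hy]))

/-- There is a good collection of one-mark loops, a bounded number of copies of which makes any
homologically trivial collection of tame loops good. -/
theorem exists_absorber (hk : 2 ≤ k) (hL : 0 < L) :
    ∃ B : Multiset (List (Letter k)), GoodWords L B ∧
      ∀ M : Multiset (List (Letter k × Bool)), (∀ t ∈ M, Tame L t) →
        (M.map fun t => hom (labels t)).sum = 0 → ∀ N, M.card ≤ N →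
          Good L (M + N • B.map onem) := by
  classical
  have := finite_tame (k := k) (L := L)
  have := Fintype.ofFinite {t : List (Letter k × Bool) // Tame L t}
  let T := {t : List (Letter k × Bool) // Tame L t}
  let toM : (T → ℕ) →+ Multiset (List (Letter k × Bool)) :=
    { toFun := fun g => ∑ t, g t • {t.1}
      map_zero' := by simp
      map_add' := fun g g' => by simp [add_smul, Finset.sum_add_distrib] }
  have toM_single : ∀ t : T, toM (Pi.single t 1) = {t.1} := by
    intro t
    show ∑ s, (Pi.single t 1 : T → ℕ) s • ({s.1} : Multiset (List (Letter k × Bool))) = _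
    rw [Finset.sum_eq_single t]
    · simp
    · intro s _ hs
      simp [Pi.single_eq_of_ne hs]
    · simp
  have toM_surj : ∀ M : Multiset (List (Letter k × Bool)), (∀ t ∈ M, Tame L t) →
      ∃ g, toM g = M := by
    intro M
    induction M using Multiset.induction_on with
    | empty => intro _; exact ⟨0, map_zero _⟩
    | cons t M ih =>
      intro h
      obtain ⟨g, hg⟩ := ih fun s hs => h s (by simp [hs])
      refine ⟨Pi.single ⟨t, h t (by simp)⟩ 1 + g, ?_⟩
      rw [map_add, toM_single, hg, Multiset.singleton_add]
  have toM_tame : ∀ g, ∀ t ∈ toM g, Tame L t := by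
    intro g t ht
    change t ∈ ∑ s, g s • ({s.1} : Multiset (List (Letter k × Bool))) at ht
    obtain ⟨s, -, hs⟩ := Multiset.mem_sum.1 ht
    have := Multiset.mem_of_mem_nsmul hs
    rw [Multiset.mem_singleton] at this
    rw [this]
    exact s.2
  let homM : Multiset (List (Letter k × Bool)) →+ (Fin k → ℤ) :=
    { toFun := fun M => (M.map fun t => hom (labels t)).sum
      map_zero' := rfl
      map_add' := fun M N => by simp }
  -- The homologically trivial combinations with nonnegative coefficients form a finitely generated
  -- monoid.
  obtain ⟨S, hS⟩ := AddSubmonoid.fg_eqLocusM (homM.comp toM) 0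
  have hS0 : ∀ g ∈ S, homM (toM g) = 0 := by
    intro g hg
    have : g ∈ AddSubmonoid.closure (S : Set (T → ℕ)) := AddSubmonoid.subset_closure hg
    rw [hS] at this
    exact this
  have hb : ∀ g, ∃ b : Multiset (List (Letter k)), g ∈ S →
      GoodWords L b ∧ Good L (toM g + b.map onem) := by
    intro g
    by_cases hg : g ∈ S
    swap
    · exact ⟨0, fun h => absurd h hg⟩
    have ht := toM_tame g
    -- The tame loops of a generator are paired with the one-mark loops of their inverses. These
    -- inverses are again homologically trivial, so they can be completed by a good collection `V`
    -- to a good collection `U`. Thus `U` is good alone and also together with the generator.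
    obtain ⟨U, V, hU, hV, e⟩ := exists_goodWords_of_hom (L := L)
      (W := (toM g).map fun t => wordInv (labels t)) hk hL
      (by
        intro w hw
        obtain ⟨t, h1, rfl⟩ := Multiset.mem_map.1 hw
        exact ⟨(ht t h1).2.1.inv, by simpa using (ht t h1).2.2.1⟩)
      (by
        have h1 := hS0 g hg
        change ((toM g).map fun t => hom (labels t)).sum = 0 at h1
        have h2 : ∀ M : Multiset (List (Letter k × Bool)),
            (M.map fun t => -hom (labels t)).sum = -(M.map fun t => hom (labels t)).sum := by
          intro M
          induction M using Multiset.induction_on with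
          | empty => simp
          | cons t M ih => simp [ih]; abel
        simp only [Multiset.map_map, Function.comp_def, hom_wordInv]
        rw [h2, h1, neg_zero])
    refine ⟨U, fun _ => ⟨hU, ?_⟩⟩
    rw [← e, Multiset.map_add, ← add_assoc]
    exact (Good.add_inverses fun t h => (ht t h).1).add hV.2
  choose b hb using hb
  refine ⟨∑ g ∈ S, b g, ?_, ?_⟩
  · have : ∀ S' ⊆ S, GoodWords L (∑ g ∈ S', b g) := by
      intro S'
      induction S' using Finset.induction_on with
      | empty => intro _; simpa using GoodWords.zero
      | insert g S' hg ih =>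
        intro h
        rw [Finset.sum_insert hg]
        exact (hb g (h (by simp))).1.add (ih fun x hx => h (by simp [hx]))
    exact this S subset_rfl
  · intro M hM h0 N hN
    obtain ⟨g, rfl⟩ := toM_surj M hM
    have hg : g ∈ AddSubmonoid.closure (S : Set (T → ℕ)) := by
      rw [hS]; exact h0
    obtain ⟨l, hl, hsum⟩ := AddSubmonoid.exists_multiset_of_mem_closure hg
    -- Zero generators are discarded, so that the number of generators is bounded by the number of
    -- loops.
    let l' := l.filter (· ≠ 0)
    have hl' : l'.sum = g := by
      rw [← hsum]
      have h1 := congrArg Multiset.sum (Multiset.filter_add_not (fun x : T → ℕ => x ≠ 0) l)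
      rw [Multiset.sum_add] at h1
      rw [← h1]
      have h2 : (l.filter fun x => ¬ x ≠ 0).sum = 0 := by
        refine Multiset.sum_eq_zero fun x hx => ?_
        simpa using (Multiset.mem_filter.1 hx).2
      rw [h2, add_zero]
    have hcard : ∀ m : Multiset (T → ℕ), (∀ x ∈ m, x ≠ 0) → m.card ≤ (toM m.sum).card := by
      intro m
      induction m using Multiset.induction_on with
      | empty => simp
      | cons x m ih =>
        intro h
        have h1 := ih fun y hy => h y (by simp [hy])
        rw [Multiset.sum_cons, map_add, Multiset.card_add, Multiset.card_cons]
        have h2 : 0 < (toM x).card := by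
          obtain ⟨t, ht⟩ := Function.ne_iff.1 (h x (by simp))
          refine Multiset.card_pos_iff_exists_mem.2 ⟨t.1, ?_⟩
          change t.1 ∈ ∑ s, x s • ({s.1} : Multiset (List (Letter k × Bool)))
          refine Multiset.mem_sum.2 ⟨t, Finset.mem_univ _, ?_⟩
          rw [Multiset.mem_nsmul_of_ne_zero (by simpa using ht)]
          simp
        omega
    -- Each generator is used at most `N` times, so `N` copies of the absorber contain what is
    -- needed; the unused parts are good on their own.
    have hle : l' ≤ N • S.val := by
      refine Multiset.le_iff_count.2 fun x => ?_
      by_cases hx : x ∈ l'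
      · have h1 : x ∈ S := hl x (Multiset.mem_of_mem_filter hx)
        rw [Multiset.count_nsmul, Multiset.count_eq_one_of_mem S.nodup h1, mul_one]
        refine (Multiset.count_le_card _ _).trans ((hcard l' ?_).trans (hl' ▸ hN))
        intro y hy
        exact (Multiset.mem_filter.1 hy).2
      · rw [Multiset.count_eq_zero_of_notMem hx]
        exact Nat.zero_le _
    obtain ⟨l'', hl''⟩ := Multiset.le_iff_exists_add.1 hle
    have hmem : ∀ x ∈ l' + l'', x ∈ S := by
      intro x hx
      rw [← hl''] at hx
      exact Multiset.mem_of_mem_nsmul hx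
    have e1 : N • (∑ g ∈ S, b g).map onem = ((N • S.val).map fun g => (b g).map onem).sum := by
      rw [Multiset.map_nsmul, Multiset.sum_nsmul]
      congr 1
      exact map_sum (Multiset.mapAddMonoidHom (onem (k := k))) b S
    have e2 : toM g = (l'.map toM).sum := by
      rw [← hl', map_multiset_sum]
    rw [e1, hl'', Multiset.map_add, Multiset.sum_add, e2, ← add_assoc, ← Multiset.sum_map_add]
    refine (Good.multiset_sum fun x hx => ?_).add (Good.multiset_sum fun x hx => ?_)
    · exact (hb x (hmem x (by simp [hx]))).2
    · exact (hb x (hmem x (by simp [hx]))).1.2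

end Absorber

end ThinFatgraph

namespace ThinFatgraph

/-! ### Cutting long loops into tame ones -/

section Pieces

variable {k L : ℕ}

/-- A segment of moderate length, along whose end points a loop can be cut. -/
def Piece (L : ℕ) (p : List (Letter k × Bool)) : Prop :=
  Sep L p ∧ 4 * L ≤ p.length ∧ p.length ≤ 12 * L

/-- The marks have pairwise distance at least `d`. -/
def Apart (d : ℕ) (l : List (Letter k × Bool)) : Prop :=
  ∀ i j, i < j → Marked l i → Marked l j → d ≤ j - i

theorem Apart.of_append_left {d : ℕ} {a b : List (Letter k × Bool)} (h : Apart d (a ++ b)) :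
    Apart d a := fun i j hij hi hj =>
  h i j hij ((marked_append_left hi.lt).2 hi) ((marked_append_left hj.lt).2 hj)

theorem Apart.of_append_right {d : ℕ} {a b : List (Letter k × Bool)} (h : Apart d (a ++ b)) :
    Apart d b := fun i j hij hi hj => by
  have := h (a.length + i) (a.length + j) (by omega)
    ((marked_append_right (by omega)).2 (by simpa using hi))
    ((marked_append_right (by omega)).2 (by simpa using hj))
  omega

theorem Sep.of_append {a b : List (Letter k × Bool)} (h : Sep L (a ++ b))
    (ha : a ≠ []) (hb : b ≠ [])
    (hmid : ∀ i, Marked (a ++ b) i → L ≤ a.length - i ∨ L ≤ i - a.length) (hL : 0 < L)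
    (la : L ≤ a.length) (lb : L ≤ b.length) : Sep L a ∧ Sep L b := by
  have hla := List.length_pos_iff.2 ha
  refine ⟨⟨ha, fun h0 => h.head ((marked_append_left hla).2 h0), ?_⟩,
    ⟨hb, fun h0 => ?_, ?_⟩⟩
  · intro i j hij hj hi hj'
    have hi2 : IsSpec (a ++ b) i := by
      rcases hi with hi | hi | hi
      · exact .inl hi
      · omega
      · exact .inr (.inr ((marked_append_left hi.lt).2 hi))
    rcases hj' with hj' | hj' | hj'
    · omega
    · rcases hi with hi | hi | hi
      · omega
      · omega
      · have := hmid i ((marked_append_left hi.lt).2 hi)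
        omega
    · exact h.sep i j hij (by simp; omega) hi2 (.inr (.inr ((marked_append_left hj'.lt).2 hj')))
  · have := hmid a.length ((marked_append_right le_rfl).2 (by simpa using h0))
    omega
  · intro i j hij hj hi hj'
    have key : ∀ j, 0 < j → IsSpec b j → IsSpec (a ++ b) (a.length + j) := by
      rintro j h0 (hj | hj | hj)
      · omega
      · exact .inr (.inl (by simp; omega))
      · exact .inr (.inr ((marked_append_right (by omega)).2 (by simpa using hj)))
    rcases Nat.eq_zero_or_pos i with rfl | h0
    · rcases hj' with hj' | hj' | hj'
      · omega
      · omega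
      · have := hmid (a.length + j) ((marked_append_right (by omega)).2 (by simpa using hj'))
        omega
    · have := h.sep (a.length + i) (a.length + j) (by omega) (by simp; omega) (key i h0 hi)
        (key j (by omega) hj')
      omega

/-- Cut near `5 * L` as long as the segment is longer than `12 * L`. A mark can forbid the place `5
* L`, but marks are `2 * L` apart, so a place at distance `L` behind that mark is free. The cut is
at most at `7 * L`, which leaves a remainder that is long enough. -/
theorem exists_pieces (hL : 0 < L) : ∀ (n : ℕ) (m : List (Letter k × Bool)), m.length = n →
    Sep L m → Apart (2 * L) m → 4 * L ≤ m.length →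
    ∃ ps : List (List (Letter k × Bool)), (∀ p ∈ ps, Piece L p) ∧ ps.flatten = m ∧ ps ≠ [] ∧
      4 * L * ps.length ≤ m.length := by
  intro n
  induction n using Nat.strong_induction_on with
  | _ n ih =>
    rintro m rfl hs ha hl
    by_cases h12 : m.length ≤ 12 * L
    · exact ⟨[m], by simpa using ⟨hs, hl, h12⟩, by simp, by simp, by simpa using hl⟩
    obtain ⟨c, hc1, hc2, hc⟩ : ∃ c, 5 * L ≤ c ∧ c ≤ 7 * L ∧
        ∀ i, Marked m i → L ≤ c - i ∨ L ≤ i - c := by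
      by_cases h5 : ∀ i, Marked m i → L ≤ 5 * L - i ∨ L ≤ i - 5 * L
      · exact ⟨5 * L, le_rfl, by omega, h5⟩
      push Not at h5
      obtain ⟨i, hi, h1, h2⟩ := h5
      refine ⟨i + L, by omega, by omega, fun j hj => ?_⟩
      rcases lt_trichotomy i j with hij | rfl | hij
      · have := ha i j hij hi hj
        omega
      · omega
      · have := ha j i hij hj hi
        omega
    have htd := List.take_append_drop c m
    have l1 : (m.take c).length = c := by simp; omega
    have l2 : (m.drop c).length = m.length - c := by simp
    have hsd := Sep.of_append (a := m.take c) (b := m.drop c) (L := L) (by rwa [htd])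
      (by intro e; rw [e] at l1; simp at l1; omega) (by intro e; rw [e] at l2; simp at l2; omega)
      (by rw [htd, l1]; exact hc) hL (by omega) (by omega)
    obtain ⟨ps, h1, h2, h3, h4⟩ := ih _ (by omega) (m.drop c) rfl hsd.2
      (Apart.of_append_right (a := m.take c) (by rwa [htd])) (by omega)
    refine ⟨m.take c :: ps, ?_, ?_, by simp, ?_⟩
    · intro p hp
      rcases List.mem_cons.1 hp with rfl | hp
      · exact ⟨hsd.1, by omega, by omega⟩
      · exact h1 p hp
    · rw [List.flatten_cons, h2, htd]
    · rw [List.length_cons, mul_add, mul_one]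
      omega

/-- Merging along `u` with an auxiliary loop `Z' u⁻¹ Z` replaces the segment `u` by `Z Z'`. The
directions at the ends of `Z Z'` can be chosen to fit both loops. The mark of the auxiliary loop
sits between `Z` and `Z'` and stays there after the merge. -/
theorem exists_flower (hk : 2 ≤ k) (hL : 0 < L) {u A : List (Letter k × Bool)} (hu : Sep L u)
    (hA : A ≠ []) (mA : ¬ Marked A 0) (h : CycRed (labels (u ++ A))) :
    ∃ Z Z' : List (Letter k), Z.length = 2 * L ∧ Z'.length = 2 * L ∧
      CycRed (labels A ++ (Z ++ Z')) ∧ CycRed (Z' ++ wordInv (labels u) ++ Z) ∧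
      ∀ N, Good L ((tick A ++ (onem Z ++ onem Z')) ::ₘ N) →
        Good L ((u ++ A) ::ₘ onem (Z' ++ wordInv (labels u) ++ Z) ::ₘ N) := by
  have lne : ∀ {v : List (Letter k × Bool)}, v ≠ [] → labels v ≠ [] := by
    intro v hv e
    exact hv (by simpa [labels] using e)
  obtain ⟨a, d, hp, had⟩ := h
  rw [labels_append] at hp
  obtain ⟨b, c, hpu, hpA, hbc⟩ := hp.of_append (lne hu.ne_nil) (lne hA)
  obtain ⟨p, hp1, hp2, -⟩ := exists_letter_notMem hk a d d
  obtain ⟨q, hq1, hq2, -⟩ := exists_letter_notMem hk b c c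
  obtain ⟨W, hW, lW⟩ := exists_path hk p q (n := 4 * L) (by omega)
  obtain ⟨Z, Z', rfl, l1, l2⟩ : ∃ Z Z', W = Z ++ Z' ∧ Z.length = 2 * L ∧ Z'.length = 2 * L :=
    ⟨W.take (2 * L), W.drop (2 * L), (List.take_append_drop _ _).symm, by simp; omega,
      by simp; omega⟩
  have hf : CycRed (wordInv (labels u) ++ Z ++ Z') := by
    rw [List.append_assoc]
    exact ⟨b, q, hpu.inv.append hW hp1.symm, hq1.symm⟩
  have nZ : Z ≠ [] := by rintro rfl; simp at l1; omega
  have nZ' : Z' ≠ [] := by rintro rfl; simp at l2; omega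
  have npZ : plain Z ≠ [] := by simpa [plain] using nZ
  refine ⟨Z, Z', l1, l2, ⟨c, q, hpA.append hW hp2.symm, hq2.symm⟩, ?_, fun N hN => ?_⟩
  · simpa using hf.rot
  · have e : onem Z ++ onem Z' = tick (plain Z ++ onem Z') := by
      rw [tick_append npZ]; rfl
    rw [e] at hN
    have h1 := Good.merge u A (plain Z ++ onem Z') N hu hA (by simp [npZ]) mA
      (not_marked_append_zero npZ not_marked_plain) hN
    rw [Multiset.cons_swap, ← List.append_assoc] at h1
    have h2 := Good.rot _ _ _ h1
    rw [Multiset.cons_swap] at h2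
    convert h2 using 3
    simp [onem_append nZ', bar]

/-- The part of a loop made of pieces that remains after some of the pieces have been cut off. -/
theorem exists_tame_of_state (hk : 2 ≤ k) (hL : 0 < L) : ∀ (n : ℕ) (Z Z' : List (Letter k))
    (ps : List (List (Letter k × Bool))), ps.length = n → ps ≠ [] → Z.length = 2 * L →
    Z'.length = 2 * L → (∀ p ∈ ps, Piece L p) →
    CycRed (Z ++ Z' ++ labels ps.flatten) →
    ∃ (F : Multiset (List (Letter k))) (t : List (Letter k × Bool)), Tame L t ∧
      (∀ w ∈ F, Admissible L w ∧ w.length ≤ 32 * L) ∧ F.card ≤ ps.length ∧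
      hom (labels t) = hom (Z ++ Z' ++ labels ps.flatten) + (F.map hom).sum ∧
      ∀ N, Good L (t ::ₘ N) →
        Good L ((onem Z ++ onem Z' ++ tick ps.flatten) ::ₘ (F.map onem + N)) := by
  intro n
  induction n using Nat.strong_induction_on with
  | _ n ih =>
  rintro Z Z' ps rfl hne lZ lZ' hps hcr
  -- Two pieces and `Z Z'` have total length at most `28 * L`, so the loop is tame once it is
  -- rotated to begin at an unmarked vertex in the middle of `Z'`.
  by_cases hlen : ps.length ≤ 2
  · have hlt : 4 * L ≤ ps.flatten.length ∧ ps.flatten.length ≤ 24 * L ∧ Spaced L ps.flatten := by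
      rcases ps with _ | ⟨p, _ | ⟨q, _ | ⟨r, ps⟩⟩⟩
      · exact absurd rfl hne
      · have h1 := hps p (by simp)
        simp only [List.flatten_cons, List.flatten_nil, List.append_nil]
        exact ⟨h1.2.1, by have := h1.2.2; omega, h1.1.spaced⟩
      · have h1 := hps p (by simp)
        have h2 := hps q (by simp)
        simp only [List.flatten_cons, List.flatten_nil, List.append_nil, List.length_append]
        exact ⟨by have := h1.2.1; omega, by have := h1.2.2; have := h2.2.2; omega,
          h1.1.spaced.append h2.1.spaced⟩
      · simp at hlen
    obtain ⟨f1, f2, f3⟩ := hlt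
    obtain ⟨Y, Y', rfl, l1, l2⟩ : ∃ Y Y', Z' = Y ++ Y' ∧ Y.length = L ∧ Y'.length = L :=
      ⟨Z'.take L, Z'.drop L, (List.take_append_drop _ _).symm, by simp; omega, by simp; omega⟩
    have nY : Y ≠ [] := by rintro rfl; simp at l1; omega
    refine ⟨0, plain Y' ++ (tick ps.flatten ++ onem Z ++ onem Y), ⟨?_, ?_, ?_, ?_⟩, by simp,
      by simp, ?_, fun N hN => ?_⟩
    · exact sep_append (sep_plain hL (by omega)) ((f3.tick.append (spaced_onem hL (by omega))).append
        (spaced_onem hL (by omega)))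
    · have : CycRed ((Z ++ Y) ++ (Y' ++ labels ps.flatten)) := by simpa using hcr
      simpa using this.rot
    · simp [-List.length_flatten]; omega
    · simp [-List.length_flatten]; omega
    · simp; abel
    · rw [onem_append nY]
      have : onem Z ++ (onem Y ++ plain Y') ++ tick ps.flatten =
          (onem Z ++ onem Y) ++ (plain Y' ++ tick ps.flatten) := by simp
      rw [this, Multiset.map_zero, zero_add]
      refine .rot _ _ _ ?_
      simpa using hN
  · push Not at hlen
    obtain ⟨p, l, rfl⟩ := List.exists_cons_of_ne_nil hne
    obtain ⟨mid, q, rfl⟩ : ∃ mid q, l = mid ++ [q] := by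
      rcases List.eq_nil_or_concat l with rfl | ⟨mid, q, rfl⟩
      · simp at hlen
      · exact ⟨mid, q, by simp⟩
    simp only [List.length_cons, List.length_append, List.length_nil] at hlen
    obtain ⟨m, mid, rfl⟩ := List.exists_cons_of_ne_nil (l := mid) (by rintro rfl; simp at hlen)
    have hp := hps p (by simp)
    have hq := hps q (by simp)
    have hm := hps m (by simp)
    -- The last piece, `Z Z'` and the first piece are traded for a new word of length `4 * L`. Here
    -- `u` has length at most `28 * L`, so the auxiliary word has length at most `32 * L`; this is
    -- the origin of the bound for tame loops.
    set u := q ++ (onem Z ++ onem Z' ++ tick p) with hu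
    have su : Sep L u := sep_append hq.1 (((spaced_onem hL (by omega)).append
      (spaced_onem hL (by omega))).append hp.1.spaced.tick)
    set A := (m :: mid).flatten with hA
    have nA : A ≠ [] := by simp [hA, hm.1.ne_nil]
    have mA : ¬ Marked A 0 := by
      rw [hA, List.flatten_cons]
      exact not_marked_append_zero hm.1.ne_nil hm.1.head
    have lu : labels u ++ labels A = labels q ++ (Z ++ Z' ++ labels p ++ labels A) := by
      simp [hu]
    have lps : Z ++ Z' ++ labels (p :: (m :: mid ++ [q])).flatten =
        (Z ++ Z' ++ labels p ++ labels A) ++ labels q := by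
      simp [hA]
    rw [lps] at hcr
    obtain ⟨Y, Y', l1, l2, h1, h2, h3⟩ := exists_flower hk hL su nA mA
      (by rw [labels_append, lu]; exact hcr.rot)
    obtain ⟨F, t, ht, hF, hc, hh, hg⟩ := ih _ (by simp) Y Y' (m :: mid) rfl (by simp) l1 l2
      (fun x hx => hps x (by simp at hx ⊢; tauto)) h1.rot
    refine ⟨(Y' ++ wordInv (labels u) ++ Y) ::ₘ F, t, ht, ?_, ?_, ?_, fun N hN => ?_⟩
    · intro w hw
      rcases Multiset.mem_cons.1 hw with rfl | hw
      · have e1 := hp.2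
        have e2 := hq.2
        refine ⟨⟨h2, ?_⟩, ?_⟩ <;> simp [hu] <;> omega
      · exact hF w hw
    · simp at hc ⊢; omega
    · rw [hh, lps]
      simp [hu, hA]
      abel
    · have h4 := hg N hN
      have h5 : Good L ((tick A ++ (onem Y ++ onem Y')) ::ₘ (F.map onem + N)) := .rot _ _ _ h4
      have h6 := h3 _ h5
      have e : onem Z ++ onem Z' ++ tick (p :: (m :: mid ++ [q])).flatten =
          (onem Z ++ onem Z' ++ tick p ++ A) ++ q := by
        rw [List.flatten_cons, tick_append hp.1.ne_nil]
        simp [hA]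
      rw [e]
      refine .rot _ _ _ ?_
      rw [Multiset.map_cons, Multiset.cons_add]
      convert h6 using 2
      simp [hu]

theorem exists_tame (hk : 2 ≤ k) (hL : 0 < L) {ps : List (List (Letter k × Bool))}
    (hne : ps ≠ []) (hps : ∀ p ∈ ps, Piece L p) (hcr : CycRed (labels ps.flatten)) :
    ∃ (F : Multiset (List (Letter k))) (t : List (Letter k × Bool)), Tame L t ∧
      (∀ w ∈ F, Admissible L w ∧ w.length ≤ 32 * L) ∧ F.card ≤ ps.length ∧
      hom (labels t) = hom (labels ps.flatten) + (F.map hom).sum ∧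
      ∀ N, Good L (t ::ₘ N) → Good L (ps.flatten ::ₘ (F.map onem + N)) := by
  rcases ps with _ | ⟨p, _ | ⟨q, ps⟩⟩
  · exact absurd rfl hne
  · have hp := hps p (by simp)
    refine ⟨0, p, ⟨hp.1, by simpa using hcr, hp.2.1, by have := hp.2.2; omega⟩, by simp, by simp,
      by simp, fun N hN => by simpa using hN⟩
  · have hp := hps p (by simp)
    have hq := hps q (by simp)
    have nA : (q :: ps).flatten ≠ [] := by simp [hq.1.ne_nil]
    have mA : ¬ Marked (q :: ps).flatten 0 := by
      rw [List.flatten_cons]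
      exact not_marked_append_zero hq.1.ne_nil hq.1.head
    obtain ⟨Y, Y', l1, l2, h1, h2, h3⟩ := exists_flower hk hL hp.1 nA mA
      (by simpa using hcr)
    obtain ⟨F, t, ht, hF, hc, hh, hg⟩ := exists_tame_of_state hk hL _ Y Y' (q :: ps) rfl (by simp)
      l1 l2 (fun x hx => hps x (by simp at hx ⊢; tauto)) h1.rot
    refine ⟨(Y' ++ wordInv (labels p) ++ Y) ::ₘ F, t, ht, ?_, ?_, ?_, fun N hN => ?_⟩
    · intro w hw
      rcases Multiset.mem_cons.1 hw with rfl | hw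
      · have e1 := hp.2
        refine ⟨⟨h2, ?_⟩, ?_⟩ <;> simp <;> omega
      · exact hF w hw
    · simp at hc ⊢; omega
    · rw [hh]
      simp
      abel
    · have h4 := h3 _ (.rot _ _ _ (hg N hN))
      rw [Multiset.map_cons, Multiset.cons_add]
      exact h4

end Pieces

end ThinFatgraph

namespace ThinFatgraph

/-! ### An absorber for loops of arbitrary length -/

section LoopAbsorber

variable {k L : ℕ}

theorem exists_tame_multiset (hk : 2 ≤ k) (hL : 0 < L)
    (M : Multiset (List (List (Letter k × Bool))))
    (hM : ∀ ps ∈ M, ps ≠ [] ∧ (∀ p ∈ ps, Piece L p) ∧ CycRed (labels ps.flatten)) :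
    ∃ (F : Multiset (List (Letter k))) (T : Multiset (List (Letter k × Bool))),
      (∀ t ∈ T, Tame L t) ∧ (∀ w ∈ F, Admissible L w ∧ w.length ≤ 32 * L) ∧
      F.card ≤ (M.map List.length).sum ∧ T.card ≤ (M.map List.length).sum ∧
      (T.map fun t => hom (labels t)).sum =
        (M.map fun ps => hom (labels ps.flatten)).sum + (F.map hom).sum ∧
      ∀ N, Good L (T + N) → Good L (M.map List.flatten + (F.map onem + N)) := by
  induction M using Multiset.induction_on with
  | empty =>
    exact ⟨0, 0, by simp, by simp, by simp, by simp, by simp, fun N hN => by simpa using hN⟩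
  | cons ps M ih =>
    obtain ⟨F, T, hT, hF, cF, cT, hh, hg⟩ := ih fun x hx => hM x (by simp [hx])
    obtain ⟨h1, h2, h3⟩ := hM ps (by simp)
    obtain ⟨F', t, ht, hF', cF', hh', hg'⟩ := exists_tame hk hL h1 h2 h3
    refine ⟨F' + F, t ::ₘ T, ?_, ?_, ?_, ?_, ?_, fun N hN => ?_⟩
    · intro x hx
      rcases Multiset.mem_cons.1 hx with rfl | hx
      · exact ht
      · exact hT x hx
    · intro x hx
      rcases Multiset.mem_add.1 hx with hx | hx
      · exact hF' x hx
      · exact hF x hx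
    · simp; omega
    · have := List.length_pos_iff.2 h1
      simp; omega
    · simp only [Multiset.map_cons, Multiset.sum_cons, Multiset.map_add, Multiset.sum_add, hh, hh']
      abel
    · rw [Multiset.cons_add] at hN
      have h4 := hg' _ hN
      have h5 : Good L (T + (ps.flatten ::ₘ (F'.map onem + N))) := by
        convert h4 using 1
        simp only [← Multiset.singleton_add]
        abel
      have h6 := hg _ h5
      convert h6 using 1
      simp only [Multiset.map_cons, Multiset.map_add]
      simp only [← Multiset.singleton_add]
      abel

/-- A word whose one-mark loop can be paired with the one-mark loop of `w`. -/
def partnerWord (L : ℕ) (w : List (Letter k)) : List (Letter k) :=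
  wordInv (w.drop L ++ w.take L)

theorem goodWords_partner (hL : 0 < L) {w : List (Letter k)} (h : Admissible L w) :
    GoodWords L {w, partnerWord L w} := by
  have hl := h.2
  have h1 := good_onem_pair hL (a := w.take L) (b := w.drop L) (by simp; omega) (by simp; omega)
  rw [List.take_append_drop] at h1
  refine ⟨fun v hv => ?_, by simpa [partnerWord] using h1⟩
  simp only [Multiset.insert_eq_cons, Multiset.mem_cons, Multiset.mem_singleton] at hv
  rcases hv with rfl | rfl
  · exact h
  · refine (Admissible.rot ?_).inv
    rwa [List.take_append_drop]

/-- Rotated to begin with the inverse of `w.drop L`, the partner has an unmarked base point and its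
mark at distance at least `L` from it. -/
theorem exists_tame_partner (hL : 0 < L) {w : List (Letter k)} (h : Admissible L w)
    (h' : w.length ≤ 32 * L) : ∃ t, Tame L t ∧ hom (labels t) = -hom w ∧
      ∀ N, Good L (t ::ₘ N) → Good L (onem (partnerWord L w) ::ₘ N) := by
  have hl := h.2
  have l1 : (w.take L).length = L := by simp; omega
  have l2 : 3 * L ≤ (w.drop L).length := by simp; omega
  have hw := List.take_append_drop L w
  refine ⟨plain (wordInv (w.drop L)) ++ onem (wordInv (w.take L)), ⟨?_, ?_, ?_, ?_⟩, ?_,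
    fun N hN => ?_⟩
  · exact sep_append (sep_plain hL (by simp; omega)) (spaced_onem hL (by simp; omega))
  · rw [labels_append, labels_plain, labels_onem, ← wordInv_append, hw]
    exact h.1.inv
  · simp; omega
  · simp; omega
  · rw [labels_append, labels_plain, labels_onem, ← wordInv_append, hw, hom_wordInv]
  · rw [partnerWord, wordInv_append, onem_append]
    · exact .rot _ _ _ hN
    · intro e
      have := congrArg List.length e
      rw [length_wordInv, l1, List.length_nil] at this
      omega

/-- There is a good collection of one-mark loops, a bounded number of copies of which makes any
homologically trivial collection of loops made of pieces good. -/
theorem exists_loop_absorber (hk : 2 ≤ k) (hL : 0 < L) :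
    ∃ B : Multiset (List (Letter k)), GoodWords L B ∧
      ∀ M : Multiset (List (List (Letter k × Bool))),
        (∀ ps ∈ M, ps ≠ [] ∧ (∀ p ∈ ps, Piece L p) ∧ CycRed (labels ps.flatten)) →
        (M.map fun ps => hom (labels ps.flatten)).sum = 0 →
        ∀ N, 2 * (M.map List.length).sum ≤ N →
          Good L (M.map List.flatten + N • B.map onem) := by
  classical
  obtain ⟨B, hB, hBN⟩ := exists_absorber (k := k) hk hL
  have hfin : {w : List (Letter k) | Admissible L w ∧ w.length ≤ 32 * L}.Finite :=
    (List.finite_length_le (Letter k) (32 * L)).subset fun w hw => hw.2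
  set S := hfin.toFinset with hS
  have hSm : ∀ w, w ∈ S ↔ Admissible L w ∧ w.length ≤ 32 * L := fun w => by simp [hS]
  have hP : ∀ W : Multiset (List (Letter k)), (∀ w ∈ W, w ∈ S) →
      GoodWords L (W + W.map (partnerWord L)) := by
    intro W
    induction W using Multiset.induction_on with
    | empty => intro _; exact .zero
    | cons w W ih =>
      intro h
      have := (goodWords_partner hL ((hSm w).1 (h w (by simp))).1).add
        (ih fun x hx => h x (by simp [hx]))
      convert this using 1
      simp only [Multiset.map_cons, Multiset.insert_eq_cons]
      simp only [← Multiset.singleton_add]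
      abel
  refine ⟨B + (S.val + S.val.map (partnerWord L)), hB.add (hP _ fun w hw => hw), ?_⟩
  intro M hM h0 N hN
  obtain ⟨F, T, hT, hF, cF, cT, hh, hg⟩ := exists_tame_multiset hk hL M hM
  obtain ⟨F', hF'⟩ : ∃ F', N • S.val = F + F' := by
    refine Multiset.le_iff_exists_add.1 (Multiset.le_iff_count.2 fun w => ?_)
    by_cases hw : w ∈ F
    · have : w ∈ S := (hSm w).2 (hF w hw)
      rw [Multiset.count_nsmul, Multiset.count_eq_one_of_mem S.nodup this, mul_one]
      exact (Multiset.count_le_card _ _).trans (by omega)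
    · rw [Multiset.count_eq_zero_of_notMem hw]
      exact Nat.zero_le _
  have hF'S : ∀ w ∈ F', w ∈ S := by
    intro w hw
    have : w ∈ N • S.val := by rw [hF']; simp [hw]
    exact Multiset.mem_of_mem_nsmul this
  -- The partners of the auxiliary words that have been used are left over. They are tame after
  -- rotation, and their homology compensates that of the auxiliary words.
  obtain ⟨P, hPt, hPc, hPh, hPg⟩ : ∃ P : Multiset (List (Letter k × Bool)),
      (∀ t ∈ P, Tame L t) ∧ P.card = F.card ∧
      (P.map fun t => hom (labels t)).sum = -(F.map hom).sum ∧
      ∀ N, Good L (P + N) → Good L ((F.map (partnerWord L)).map onem + N) := by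
    clear hF' cF hg hh
    induction F using Multiset.induction_on with
    | empty => exact ⟨0, by simp, rfl, by simp, fun N hN => by simpa using hN⟩
    | cons w F ih =>
      obtain ⟨P, h1, h2, h3, h4⟩ := ih fun x hx => hF x (by simp [hx])
      obtain ⟨t, g1, g2, g3⟩ := exists_tame_partner hL (hF w (by simp)).1 (hF w (by simp)).2
      refine ⟨t ::ₘ P, ?_, by simp [h2], ?_, fun N hN => ?_⟩
      · intro x hx
        rcases Multiset.mem_cons.1 hx with rfl | hx
        · exact g1
        · exact h1 x hx
      · simp only [Multiset.map_cons, Multiset.sum_cons, g2, h3]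
        abel
      · rw [Multiset.cons_add] at hN
        have h5 := g3 _ hN
        have h6 : Good L (P + (onem (partnerWord L w) ::ₘ N)) := by
          rwa [Multiset.add_cons]
        have h7 := h4 _ h6
        rw [Multiset.map_cons, Multiset.map_cons, Multiset.cons_add]
        rwa [Multiset.add_cons] at h7
  -- Both `T` and `P` have at most as many loops as there are pieces, whence the factor two in the
  -- hypothesis on `N`.
  have h1 := hBN (T + P)
    (by
      intro t ht
      rcases Multiset.mem_add.1 ht with ht | ht
      · exact hT t ht
      · exact hPt t ht)
    (by rw [Multiset.map_add, Multiset.sum_add, hh, hPh, h0]; abel) N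
    (by rw [Multiset.card_add]; omega)
  have h2 := h1.add (hP F' hF'S).2
  have h3 := hPg (T + N • B.map onem + (F' + F'.map (partnerWord L)).map onem) (by
    convert h2 using 1; abel)
  have h4 := hg ((F.map (partnerWord L)).map onem + (N • B.map onem +
    (F' + F'.map (partnerWord L)).map onem)) (by convert h3 using 1; abel)
  convert h4 using 2
  simp only [Multiset.map_add, smul_add, ← Multiset.map_nsmul]
  rw [hF']
  simp only [Multiset.map_add]
  abel

end LoopAbsorber

end ThinFatgraph

namespace ThinFatgraph

/-! ### Words `Q` and `R` whose exchange releases the absorber -/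

section Exchange

variable {k L : ℕ}

/-- The part `p b p⁻¹` is a petal `b` on a stem `p`. Cutting along the stem releases `b` as a
one-mark loop and leaves a mark where the petal was attached. -/
theorem Good.extract (hL : 0 < L) {X Y : List (Letter k × Bool)} {p b : List (Letter k)}
    {M : Multiset (List (Letter k × Bool))} (hp : L ≤ p.length) (hb : b ≠ []) (hY : Y ≠ [])
    (mY : ¬ Marked Y 0) (h : Good L ((X ++ tick Y) ::ₘ onem b ::ₘ M)) :
    Good L ((X ++ plain p ++ plain b ++ plain (wordInv p) ++ Y) ::ₘ M) := by
  have h1 : Good L (onem b ::ₘ tick (Y ++ X) ::ₘ M) := by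
    rw [tick_append hY, Multiset.cons_swap]
    exact .rot _ _ _ h
  have hb' : plain b ≠ [] := by simpa [plain] using hb
  have h2 := Good.split (plain p) (plain b) (Y ++ X) M (sep_plain hL hp) hb' (by simp [hY])
    not_marked_plain (not_marked_append_zero hY mY) h1
  have e : plain p ++ plain b ++ bar (plain p) ++ (Y ++ X) =
      (plain p ++ plain b ++ bar (plain p) ++ Y) ++ X := by simp
  rw [e] at h2
  have h3 := Good.rot _ _ _ h2
  simpa [bar] using h3

theorem path_replicate (x : Letter k) {n : ℕ} (hn : 0 < n) :
    Path x x.inv (List.replicate n x) := by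
  obtain ⟨m, rfl⟩ := Nat.exists_eq_succ_of_ne_zero hn.ne'
  induction m with
  | zero => exact Path.letter x
  | succ m ih =>
    rw [List.replicate_succ, ← List.singleton_append]
    exact (Path.letter x).append (ih (by omega)) (Letter.inv_ne x)

theorem wordInv_replicate (x : Letter k) (n : ℕ) :
    wordInv (List.replicate n x) = List.replicate n x.inv := by
  simp [wordInv]

/-- All petals are attached along a power of `x`, with segments of length `2 * L` between them.
Their stems begin with `y`, so the word is reduced, and after their removal only marked powers of
`x` remain. -/
theorem exists_bouquet (hk : 2 ≤ k) (hL : 0 < L) {x y : Letter k} (hxy : y ≠ x)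
    (hxy' : y ≠ x.inv) : ∀ bs : List (List (Letter k)), (∀ b ∈ bs, CycRed b) →
    ∃ q : List (Letter k), (∀ X, Path x x.inv X → Path x x.inv (X ++ q)) ∧
      q.length = (bs.map List.length).sum + bs.length * (4 * L + 4) ∧
      ∀ C D N, Good L ((C ++ (List.replicate bs.length
          (onem (List.replicate (2 * L) x))).flatten ++ D) ::ₘ ((bs : Multiset (List (Letter k))).map onem + N)) →
        Good L ((C ++ plain q ++ D) ::ₘ N)
  | [], _ => ⟨[], by simp, by simp, fun C D N h => by simpa [plain] using h⟩
  | b :: bs, h => by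
    obtain ⟨q, h1, h2, h3⟩ := exists_bouquet hk hL hxy hxy' bs fun w hw => h w (by simp [hw])
    obtain ⟨a, a', hb, haa⟩ := h b (by simp)
    obtain ⟨t, ht1, ht2, -⟩ := exists_letter_notMem hk a a' a'
    obtain ⟨p, hp, lp⟩ := exists_path hk y t (n := L + 2) (by omega)
    have nx : plain (List.replicate (2 * L) x) ≠ [] := by
      intro e
      have := congrArg List.length e
      simp at this
      omega
    refine ⟨p ++ b ++ wordInv p ++ List.replicate (2 * L) x ++ q, fun X hX => ?_, ?_,
      fun C D N hG => ?_⟩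
    · have := h1 _ ((((hX.append hp hxy'.symm).append hb ht1).append hp.inv ht2.symm).append
        (path_replicate x (n := 2 * L) (by omega)) hxy)
      simpa using this
    · simp [h2, lp]
      ring
    · have h4 := h3 (C ++ onem (List.replicate (2 * L) x)) D (onem b ::ₘ N) (by
        convert hG using 2
        · simp [List.replicate_succ]
        · rw [← Multiset.cons_coe, Multiset.map_cons, Multiset.cons_add, Multiset.add_cons])
      have h5 := Good.extract hL (X := C) (Y := plain (List.replicate (2 * L) x) ++ (plain q ++ D))
        (p := p) (b := b) (M := N) (by omega) hb.ne_nil (by simp [nx])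
        (not_marked_append_zero nx not_marked_plain) (by
          rw [tick_append nx]
          simpa [onem] using h4)
      simpa using h5

/-- The loop that results from gluing along the sides of a subword `q` opposite to the inverse of
a subword `r`. -/
def exchangeLoop (q r : List (Letter k)) : List (Letter k × Bool) := onem q ++ onem (wordInv r)

/-- Any good collection of words can be absorbed by the exchange loop of two words that fit into the
same places. -/
theorem exists_exchange (hk : 2 ≤ k) (hL : 0 < L) {B : Multiset (List (Letter k))}
    (hB : GoodWords L B) : ∃ (x y : Letter k) (Q R : List (Letter k)),
      y ≠ x ∧ y ≠ x.inv ∧ Path x x.inv Q ∧ Path x.inv x R ∧ Q.length = R.length ∧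
      ∀ N, Good L (B.map onem + N) → Good L (exchangeLoop Q R ::ₘ N) := by
  let x : Letter k := (⟨0, by omega⟩, true)
  obtain ⟨y, hy, hy', -⟩ := exists_letter_notMem hk x x.inv x
  obtain ⟨w, hw, lw⟩ := exists_path hk x y (n := 4 * L) (by omega)
  have aw : Admissible L w := ⟨⟨x, y, hw, hy.symm⟩, by omega⟩
  -- Two copies of `B` make the total length of the petals even, which is needed to balance the
  -- lengths of `Q` and `R`. The additional pair is good and ensures that there are petals at all,
  -- so that `μ` below is at least `2 * L`.
  set bs := (B + B + {w, partnerWord L w}).toList with hbs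
  have hG : GoodWords L (B + {w, partnerWord L w}) := hB.add (goodWords_partner hL aw)
  have hG' : GoodWords L (B + B + {w, partnerWord L w}) := by
    rw [add_assoc]; exact hB.add hG
  obtain ⟨q, h1, h2, h3⟩ := exists_bouquet hk hL hy hy' bs fun b hb =>
    (hG'.1 b (by simpa [hbs, -Multiset.insert_eq_cons] using hb)).1
  have hr : 2 ≤ bs.length := by simp [hbs]
  have hs : (bs.map List.length).sum = 2 * (B.map List.length).sum + 8 * L := by
    have : (bs.map List.length).sum = ((B + B + {w, partnerWord L w}).map List.length).sum := by
      rw [← Multiset.sum_coe, ← Multiset.map_coe, hbs, Multiset.coe_toList]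
    have hp : (partnerWord L w).length = 4 * L := by simp [partnerWord]; omega
    rw [this, Multiset.map_add, Multiset.map_add, Multiset.sum_add, Multiset.sum_add]
    simp only [Multiset.insert_eq_cons, Multiset.map_cons, Multiset.map_singleton,
      Multiset.sum_cons, Multiset.sum_singleton, lw, hp]
    omega
  obtain ⟨t, ht, ht', -⟩ := exists_letter_notMem hk x x.inv x
  obtain ⟨p, hp, lp⟩ := exists_path hk y t (n := L + 2) (by omega)
  obtain ⟨r, hr'⟩ := Nat.exists_eq_add_of_le hr
  -- The value of `μ` is the solution of the equation that `Q` and `R` have the same length.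
  set μ := (B.map List.length).sum + (2 + r) * (L + 2) + 2 * L - (L + 2) with hμ
  have hμL : 2 * L ≤ μ := by
    have : L + 2 ≤ (2 + r) * (L + 2) := Nat.le_mul_of_pos_left _ (by omega)
    omega
  -- The number `n` is the total length of the powers of `x` that remain when all petals are
  -- removed; the petal `x⁻ⁿ` of `S` cancels exactly this loop.
  set n := (bs.length + 2) * (2 * L) + μ with hn
  set V := List.replicate (2 * L) x with hV
  have lV : V.length = 2 * L := by simp [hV]
  have nV : V ≠ [] := by intro e; rw [e] at lV; simp at lV; omega
  set S := V ++ p ++ List.replicate n x.inv ++ wordInv p ++ List.replicate μ x with hS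
  have pV : Path x x.inv V := path_replicate x (by omega)
  have pS : Path x x.inv S := by
    have h4 : Path x.inv x (List.replicate n x.inv) := by
      simpa using path_replicate x.inv (n := n) (by omega)
    exact (((pV.append hp hy'.symm).append h4 ht').append hp.inv ht.symm).append
      (path_replicate x (by omega)) hy
  refine ⟨x, y, V ++ q, wordInv S, hy, hy', h1 V pV, pS.inv, ?_, fun N hN => ?_⟩
  · have e : (2 + r) * (4 * L + 4) = 2 * L * (2 + r) + 2 * ((2 + r) * (L + 2)) := by ring
    have e' : (2 + r + 2) * (2 * L) = 2 * L * (2 + r) + 4 * L := by ring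
    have : L + 2 ≤ (2 + r) * (L + 2) := Nat.le_mul_of_pos_left _ (by omega)
    simp only [hS, List.length_append, length_wordInv, List.length_replicate, lV, h2, hs, lp, hn,
      hr', e, e']
    omega
  · rw [exchangeLoop, wordInv_wordInv, onem_append nV]
    refine h3 _ _ _ ?_
    have e1 : onem S = onem V ++ plain p ++ plain (List.replicate n x.inv) ++ plain (wordInv p) ++
        plain (List.replicate μ x) := by
      rw [hS]
      simp only [List.append_assoc]
      rw [onem_append nV]
      simp
    have e2 : (bs : Multiset (List (Letter k))).map onem =
        (B + B + {w, partnerWord L w}).map onem := by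
      rw [hbs, Multiset.coe_toList]
    rw [e1, e2]
    have nμ : plain (List.replicate μ x) ≠ [] := by
      intro e
      have := congrArg List.length e
      simp at this
      omega
    have h4 := Good.extract hL (p := p) (b := List.replicate n x.inv)
      (X := onem V ++ (List.replicate bs.length (onem V)).flatten ++ onem V)
      (Y := plain (List.replicate μ x)) (M := (B + B + {w, partnerWord L w}).map onem + N)
      (by omega) (by simp; omega) nμ not_marked_plain ?_
    · simpa using h4
    · have h5 : Good L ((B + B + {w, partnerWord L w}).map onem + N) := by
        rw [add_comm B B, add_assoc, Multiset.map_add, add_right_comm, add_comm]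
        exact hG.2.add hN
      -- The last power of `x` is divided so that the base point of the pairing lies at distance `L`
      -- from its mark.
      have e3 : tick (plain (List.replicate μ x)) =
          onem (List.replicate L x) ++ plain (List.replicate (μ - L) x) := by
        rw [← onem_append (by simp; omega), List.replicate_append_replicate]
        congr 3
        omega
      rw [e3, ← List.append_assoc]
      set X := onem V ++ (List.replicate bs.length (onem V)).flatten ++ onem V ++
        onem (List.replicate L x) with hX
      have sV : Spaced L (onem V) := spaced_onem hL (by omega)
      have sr : ∀ m, Spaced L (onem V ++ (List.replicate m (onem V)).flatten) := by
        intro m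
        induction m with
        | zero => simpa using sV
        | succ m ih =>
          rw [List.replicate_succ, List.flatten_cons]
          exact sV.append ih
      have sX : Spaced L X := ((sr _).append sV).append (spaced_onem hL (by simp))
      have lX : labels X = List.replicate ((bs.length + 2) * (2 * L) + L) x := by
        have h6 : ∀ m, labels (List.replicate m (onem V)).flatten =
            List.replicate (m * (2 * L)) x := by
          intro m
          induction m with
          | zero => simp [labels]
          | succ m ih =>
            rw [List.replicate_succ, List.flatten_cons, labels_append, ih, labels_onem, hV,
              List.replicate_append_replicate]
            congr 1
            ring
        simp only [hX, labels_append, labels_onem, h6]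
        rw [hV, List.replicate_append_replicate, List.replicate_append_replicate,
          List.replicate_append_replicate]
        congr 1
        ring
      have h6 := Good.pair (k := k) (L := L) (X := X) (Y := plain (List.replicate (μ - L) x))
        (sep_append (sep_plain hL (by simp; omega)) sX) h5
      rw [labels_append, labels_plain, lX, List.replicate_append_replicate, wordInv_replicate] at h6
      have e4 : μ - L + ((bs.length + 2) * (2 * L) + L) = n := by omega
      rwa [e4] at h6

end Exchange

/-! ### Gluing words that are inverse up to exchanges -/

section Gluing

variable {k L : ℕ}

/-- The word `c'` is the inverse of `c` up to replacing certain subwords `q` of `c` by other words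
`r`; the pairs `(q, r)` form the multiset. -/
inductive Dec (L : ℕ) : List (Letter k) → List (Letter k) →
    Multiset (List (Letter k) × List (Letter k)) → Prop
  | base (e) : L ≤ e.length → Dec L e (wordInv e) 0
  | step (e q r c c' m) : L ≤ e.length → q ≠ [] → r ≠ [] → Dec L c c' m →
      Dec L (e ++ q ++ c) (c' ++ wordInv r ++ wordInv e) ((q, r) ::ₘ m)

theorem Dec.prepend {c c' : List (Letter k)} {m} (h : Dec L c c' m) (x : List (Letter k)) :
    Dec L (x ++ c) (c' ++ wordInv x) m := by
  cases h with
  | base _ he =>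
    rw [← wordInv_append]
    exact .base _ (by simp; omega)
  | step e q r c c' m he hq hr h =>
    have := Dec.step (x ++ e) q r c c' m (by simp; omega) hq hr h
    simpa using this

theorem Dec.hom_add {c c' : List (Letter k)} {m} (h : Dec L c c' m) :
    hom c + hom c' = (m.map fun p => hom (labels (exchangeLoop p.1 p.2))).sum := by
  induction h with
  | base e _ => simp
  | step e q r c c' m _ _ _ _ ih =>
    rw [Multiset.map_cons, Multiset.sum_cons, ← ih]
    simp [exchangeLoop]
    abel

/-- Gluing the first common word `e` splits off a loop in which `c` and `c'` still face each other.
Gluing them as well closes up the loop formed by `q` and the inverse of `r`, with marks at both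
joints, which is the exchange loop. -/
theorem Dec.good_split (hL : 0 < L) {c c' : List (Letter k)} {m} (h : Dec L c c' m) :
    ∀ {A B : List (Letter k × Bool)} {M}, A ≠ [] → B ≠ [] → ¬ Marked A 0 → ¬ Marked B 0 →
      Good L (tick A ::ₘ tick B ::ₘ (m.map (fun p => exchangeLoop p.1 p.2) + M)) →
      Good L ((plain c ++ A ++ plain c' ++ B) ::ₘ M) := by
  induction h with
  | base e he =>
    intro A B M hA hB mA mB h
    rw [Multiset.map_zero, zero_add] at h
    have := Good.split (plain e) A B M (sep_plain hL he) hA hB mA mB h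
    simpa [bar] using this
  | step e q r c c' m he hq hr _ ih =>
    intro A B M hA hB mA mB h
    have hq' : plain q ≠ [] := by simpa [plain] using hq
    have hr' : plain (wordInv r) ≠ [] := by
      intro e
      have := congrArg List.length e
      exact hr (by simpa using this)
    have h1 : Good L (tick A ::ₘ tick (plain (wordInv r) ++ onem q) ::ₘ
        (m.map (fun p => exchangeLoop p.1 p.2) + tick B ::ₘ M)) := by
      rw [Multiset.cons_swap, tick_append hr']
      refine .rot _ _ _ ?_
      convert h using 1
      simp only [Multiset.map_cons, exchangeLoop, onem]
      simp only [← Multiset.singleton_add]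
      abel
    have h2 := ih hA (by simp [hr']) mA (not_marked_append_zero hr' not_marked_plain) h1
    rw [← List.append_assoc] at h2
    have h3 := Good.rot _ _ _ h2
    have h4 := Good.split (plain e) (plain q ++ (plain c ++ A ++ plain c' ++ plain (wordInv r))) B M
      (sep_plain hL he) (by simp [hq']) hB (not_marked_append_zero hq' not_marked_plain) mB
      (by rw [tick_append hq']; exact h3)
    simpa [bar] using h4

/-- Only the first common word merges two loops. From then on `c` and `c'` lie on the same loop, so
the remaining gluings are those of `Dec.good_split`. -/
theorem Dec.good_merge (hL : 0 < L) {c c' : List (Letter k)} {m} (h : Dec L c c' m)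
    {A B : List (Letter k × Bool)} {M} (hA : A ≠ []) (hB : B ≠ []) (mA : ¬ Marked A 0)
    (mB : ¬ Marked B 0)
    (hG : Good L ((tick A ++ tick B) ::ₘ (m.map (fun p => exchangeLoop p.1 p.2) + M))) :
    Good L ((plain c ++ A) ::ₘ (plain c' ++ B) ::ₘ M) := by
  cases h with
  | base _ he =>
    rw [Multiset.map_zero, zero_add] at hG
    have := Good.merge (plain c) A B M (sep_plain hL he) hA hB mA mB hG
    simpa [bar] using this
  | step e q r c c' m he hq hr h =>
    have hq' : plain q ≠ [] := by simpa [plain] using hq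
    have hr' : plain (wordInv r) ≠ [] := by
      intro e
      have := congrArg List.length e
      exact hr (by simpa using this)
    have h1 := h.good_split hL (A := A ++ tick B) (B := plain (wordInv r) ++ onem q) (M := M)
      (by simp [hA]) (by simp [hr']) (not_marked_append_zero hA mA)
      (not_marked_append_zero hr' not_marked_plain) (by
        rw [Multiset.cons_swap, tick_append hr']
        refine .rot _ _ _ ?_
        rw [tick_append hA]
        convert hG using 1
        simp only [Multiset.map_cons, exchangeLoop, onem]
        simp only [← Multiset.singleton_add]
        abel)
    rw [← List.append_assoc] at h1
    have h2 := Good.rot _ _ _ h1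
    have h3 := Good.merge (plain e) (plain q ++ (plain c ++ A))
      (B ++ (plain c' ++ plain (wordInv r))) M (sep_plain hL he) (by simp [hq']) (by simp [hB])
      (not_marked_append_zero hq' not_marked_plain) (not_marked_append_zero hB mB) (by
        rw [tick_append hq', tick_append hB]
        convert h2 using 2
        simp [onem])
    rw [Multiset.cons_swap, ← List.append_assoc] at h3
    have h4 := Good.rot _ _ _ h3
    rw [Multiset.cons_swap] at h4
    simpa [bar] using h4

end Gluing

end ThinFatgraph

namespace ThinFatgraph

/-! ### Loops as cyclic lists of cores and segments -/

section Segments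

variable {k L : ℕ}

/-- A segment that starts and ends with long unmarked parts. -/
structure Far (L : ℕ) (z : List (Letter k × Bool)) : Prop where
  length : 4 * L ≤ z.length
  apart : Apart (2 * L) z
  margin : ∀ i, Marked z i → 2 * L ≤ i ∧ i + 2 * L ≤ z.length

/-- A marked segment that starts with a mark and can be followed by another one of this kind. -/
structure Loose (L : ℕ) (z : List (Letter k × Bool)) : Prop where
  length : 4 * L ≤ z.length
  apart : Apart (2 * L) z
  head : Marked z 0
  last : ∀ i, Marked z i → i + 2 * L ≤ z.length

theorem Far.ne_nil (hL : 0 < L) {z : List (Letter k × Bool)} (h : Far L z) : z ≠ [] := by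
  rintro rfl
  have := h.length
  simp at this
  omega

theorem Far.head (hL : 0 < L) {z : List (Letter k × Bool)} (h : Far L z) : ¬ Marked z 0 := by
  intro h0
  have := h.margin 0 h0
  omega

theorem Far.loose_tick (hL : 0 < L) {z : List (Letter k × Bool)} (h : Far L z) :
    Loose L (tick z) := by
  have hl := h.length
  refine ⟨by simpa, fun i j hij hi hj => ?_, ?_, fun i hi => ?_⟩
  · rcases marked_tick.1 hj with ⟨rfl, -⟩ | hj
    · omega
    · rcases marked_tick.1 hi with ⟨rfl, -⟩ | hi
      · exact (h.margin j hj).1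
      · exact h.apart i j hij hi hj
  · exact marked_tick.2 (.inl ⟨rfl, h.ne_nil hL⟩)
  · rw [length_tick]
    rcases marked_tick.1 hi with ⟨rfl, -⟩ | hi
    · omega
    · exact (h.margin i hi).2

theorem Loose.append {y z : List (Letter k × Bool)} (hy : Loose L y) (hz : Loose L z) :
    Loose L (y ++ z) := by
  refine ⟨?_, fun i j hij hi hj => ?_, ?_, fun i hi => ?_⟩
  · have := hy.length
    simp; omega
  · by_cases h : j < y.length
    · exact hy.apart i j hij ((marked_append_left (by omega)).1 hi) ((marked_append_left h).1 hj)
    · rw [marked_append_right (by omega)] at hj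
      by_cases h' : i < y.length
      · have := hy.last i ((marked_append_left h').1 hi)
        omega
      · rw [marked_append_right (by omega)] at hi
        have := hz.apart _ _ (by omega) hi hj
        omega
  · exact (marked_append_left hy.head.lt).2 hy.head
  · simp only [List.length_append]
    by_cases h : i < y.length
    · have := hy.last i ((marked_append_left h).1 hi)
      omega
    · rw [marked_append_right (by omega)] at hi
      have := hz.last _ hi
      omega

theorem Loose.flatten {zs : List (List (Letter k × Bool))} (hne : zs ≠ [])
    (h : ∀ z ∈ zs, Loose L z) : Loose L zs.flatten := by
  induction zs with
  | nil => exact absurd rfl hne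
  | cons z zs ih =>
    rcases zs with _ | ⟨y, zs⟩
    · simpa using h z (by simp)
    · rw [List.flatten_cons]
      exact (h z (by simp)).append (ih (by simp) fun x hx => h x (List.mem_cons_of_mem _ hx))

/-- The loop is rotated by `L`, which moves the base point away from the mark at the beginning and
keeps it away from the other marks; then it is cut into pieces. -/
theorem Loose.exists_pieces (hL : 0 < L) {z : List (Letter k × Bool)} (h : Loose L z) :
    ∃ (a b : List (Letter k × Bool)) (ps : List (List (Letter k × Bool))), z = a ++ b ∧
      (∀ p ∈ ps, Piece L p) ∧ ps.flatten = b ++ a ∧ ps ≠ [] ∧ 4 * L * ps.length ≤ z.length := by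
  have hl := h.length
  have l1 : (z.take L).length = L := by simp; omega
  have l2 : (z.drop L).length = z.length - L := by simp
  have htd := List.take_append_drop L z
  have mz : ∀ i, Marked z i → i = 0 ∨ 2 * L ≤ i := by
    intro i hi
    rcases Nat.eq_zero_or_pos i with h0 | h0
    · exact .inl h0
    · have := h.apart 0 i h0 h.head hi
      omega
  have mm : ∀ i, Marked (z.drop L ++ z.take L) i →
      (i = z.length - L) ∨ (L ≤ i ∧ i + 3 * L ≤ z.length ∧ Marked z (i + L)) := by
    intro i hi
    by_cases h' : i < z.length - L
    · rw [marked_append_left (by omega)] at hi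
      have h1 : Marked z (i + L) := by
        rw [← htd, marked_append_right (by omega), l1]
        simpa using hi
      have h2 := mz _ h1
      have h3 := h.last _ h1
      exact .inr ⟨by omega, by omega, h1⟩
    · rw [marked_append_right (by omega)] at hi
      have h1 := (marked_append_left (b := z.drop L) hi.lt).2 hi
      rw [htd] at h1
      have h2 := mz _ h1
      have := hi.lt
      left
      omega
  obtain ⟨ps, h1, h2, h3, h4⟩ := ThinFatgraph.exists_pieces hL _ (z.drop L ++ z.take L) rfl
    ⟨by intro e; have := congrArg List.length e; simp at this; omega,
      fun h0 => by have := mm 0 h0; omega, fun i j hij hj hi hj' => by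
        simp only [List.length_append, l1, l2] at hj
        rcases hi with rfl | hi | hi
        · rcases hj' with rfl | hj' | hj'
          · omega
          · simp only [List.length_append, l1, l2] at hj'
            omega
          · have := mm j hj'
            omega
        · simp only [List.length_append, l1, l2] at hi
          omega
        · have hi' := mm i hi
          rcases hj' with rfl | hj' | hj'
          · omega
          · simp only [List.length_append, l1, l2] at hj'
            omega
          · rcases mm j hj' with h5 | ⟨h5, h6, h7⟩
            · omega
            · rcases hi' with h8 | ⟨h8, h9, h10⟩
              · omega
              · have := h.apart _ _ (by omega) h10 h7
                omega⟩
    (fun i j hij hi hj => by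
      rcases mm i hi with h5 | ⟨h5, h6, h7⟩
      · rcases mm j hj with h8 | ⟨h8, h9, h10⟩ <;> omega
      · rcases mm j hj with h8 | ⟨h8, h9, h10⟩
        · omega
        · have := h.apart _ _ (by omega) h7 h10
          omega)
    (by simp only [List.length_append, l1, l2]; omega)
  exact ⟨z.take L, z.drop L, ps, htd.symm, h1, h2, h3, by
    simp only [List.length_append, l1, l2] at h4; omega⟩

/-- A core word together with the last letter before it and the first letter after it. -/
abbrev Core (k : ℕ) : Type := Letter k × List (Letter k) × Letter k

/-- A segment of a loop, possibly preceded by a core. -/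
abbrev Seg (k : ℕ) : Type := Option (Core k) × List (Letter k × Bool)

/-- The marked list that is represented by a segment. -/
def Seg.flat : Seg k → List (Letter k × Bool)
  | (none, z) => tick z
  | (some κ, z) => plain κ.2.1 ++ z

/-- The marked list that is represented by a list of segments. -/
def flatSegs (l : List (Seg k)) : List (Letter k × Bool) := (l.map Seg.flat).flatten

/-- The cores in a list of segments. -/
def cores (l : List (Seg k)) : List (Core k) := l.filterMap Prod.fst

/-- The segment is far from marks, reduced, and fits to its core. -/
structure SegOK (L : ℕ) (u : Seg k) : Prop where
  far : Far L u.2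
  red : Red (labels u.2)
  head : ∀ κ ∈ u.1, (labels u.2).head? = some κ.2.2

/-- Two segments may follow each other. -/
def Link (u v : Seg k) : Prop :=
  (∀ κ ∈ v.1, (labels u.2).getLast? = some κ.1) ∧
    (v.1 = none → ∀ p ∈ (labels u.2).getLast?, ∀ q ∈ (labels v.2).head?, q ≠ p.inv)

/-- A cyclic list of segments that fit to each other. -/
structure LoopOK (L : ℕ) (l : List (Seg k)) : Prop where
  ne_nil : l ≠ []
  seg : ∀ u ∈ l, SegOK L u
  chain : Cycle.Chain Link (l : Cycle (Seg k))

/-- The two cores can be glued along a word, up to some exchanges of subwords. -/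
structure Fits (L : ℕ) (κ κ' : Core k) (m : Multiset (List (Letter k) × List (Letter k))) :
    Prop where
  dec : Dec L κ.2.1 κ'.2.1 m
  left : κ.2.2 ≠ κ'.1.inv
  right : κ'.2.2 ≠ κ.1.inv

theorem flatSegs_append (l l' : List (Seg k)) : flatSegs (l ++ l') = flatSegs l ++ flatSegs l' := by
  simp [flatSegs]

theorem cores_append (l l' : List (Seg k)) : cores (l ++ l') = cores l ++ cores l' := by
  simp [cores]

theorem LoopOK.rotate {A B : List (Seg k)} (h : LoopOK L (A ++ B)) : LoopOK L (B ++ A) := by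
  refine ⟨fun e => h.ne_nil ?_, fun u hu => h.seg u ?_, ?_⟩
  · simp at e ⊢; tauto
  · simp at hu ⊢; tauto
  · have : ((B ++ A : List (Seg k)) : Cycle (Seg k)) = (A ++ B : List (Seg k)) :=
      Cycle.coe_eq_coe.2 List.isRotated_append
    rw [this]
    exact h.chain

theorem LoopOK.exists_head {l : List (Seg k)} (h : LoopOK L l) {κ : Core k} (hκ : κ ∈ cores l) :
    ∃ (z : List (Letter k × Bool)) (A : List (Seg k)), LoopOK L ((some κ, z) :: A) ∧
      ((some κ, z) :: A).Perm l ∧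
      ∀ M, Good L (flatSegs ((some κ, z) :: A) ::ₘ M) → Good L (flatSegs l ::ₘ M) := by
  obtain ⟨⟨o, z⟩, hu, rfl : o = some κ⟩ := List.mem_filterMap.1 hκ
  obtain ⟨A, B, rfl⟩ := List.append_of_mem hu
  refine ⟨z, B ++ A, ?_, ?_, fun M hM => ?_⟩
  · simpa using h.rotate
  · rw [← List.cons_append]
    exact List.perm_append_comm
  · rw [flatSegs_append]
    refine .rot _ _ _ ?_
    rw [← flatSegs_append]
    exact hM

theorem chain_replace {u u' v v' : Seg k} {B : List (Seg k)} (hu : u.2 = u'.2)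
    (h : ∀ w, Link w v → Link w v') (hc : List.IsChain Link (u :: (B ++ [v]))) :
    List.IsChain Link (u' :: (B ++ [v'])) := by
  have h1 : ∀ {x}, Link u x → Link u' x := fun {x} hx => by
    unfold Link at hx ⊢
    rwa [← hu]
  have h2 : ∀ (B : List (Seg k)) (u : Seg k), List.IsChain Link (u :: (B ++ [v])) →
      List.IsChain Link (u :: (B ++ [v'])) := by
    intro B
    induction B with
    | nil =>
      intro u hu
      simp at hu ⊢
      exact h _ hu
    | cons b B ih =>
      intro u hu
      rw [List.cons_append, List.isChain_cons_cons] at hu ⊢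
      exact ⟨hu.1, ih b hu.2⟩
  have h3 := h2 B u hc
  rcases B with _ | ⟨b, B⟩
  · simp only [List.nil_append, List.isChain_cons_cons] at h3 ⊢
    exact ⟨h1 h3.1, h3.2⟩
  · rw [List.cons_append, List.isChain_cons_cons] at h3 ⊢
    exact ⟨h1 h3.1, h3.2⟩

/-- When two cores are glued, the segment before `κ'` is followed by the segment after `κ`. The
condition on the outer letters says that no cancellation occurs at this new joint. -/
theorem link_of_fits {κ κ' : Core k} {z z' : List (Letter k × Bool)}
    (hz : (labels z).head? = some κ.2.2) (h : κ.2.2 ≠ κ'.1.inv) (w : Seg k)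
    (hw : Link w (some κ', z')) : Link w (none, z) := by
  refine ⟨by simp, fun _ p hp q hq => ?_⟩
  have h1 := hw.1 κ' rfl
  rw [h1] at hp
  change q ∈ (labels z).head? at hq
  rw [hz] at hq
  cases hp
  cases hq
  exact h

theorem SegOK.forget {o : Option (Core k)} {z : List (Letter k × Bool)} (h : SegOK L (o, z)) :
    SegOK L ((none, z) : Seg k) := ⟨h.far, h.red, by simp⟩

theorem flatSegs_cons_none (hL : 0 < L) {o : Option (Core k)} {z : List (Letter k × Bool)}
    (h : SegOK L (o, z)) (A : List (Seg k)) :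
    flatSegs ((none, z) :: A) = tick (z ++ flatSegs A) := by
  rw [tick_append (h.far.ne_nil hL)]
  simp [flatSegs, Seg.flat]

theorem flatSegs_cons_some (κ : Core k) (z : List (Letter k × Bool)) (A : List (Seg k)) :
    flatSegs ((some κ, z) :: A) = plain κ.2.1 ++ (z ++ flatSegs A) := by
  simp [flatSegs, Seg.flat]

/-- The gluing is a split if both cores lie on the same loop and a merge otherwise. Segments are
never changed, only linked differently, so their total length and homology can be computed from the
initial loops. -/
theorem exists_glue_pair (hL : 0 < L) {S : Multiset (List (Seg k))} (hS : ∀ l ∈ S, LoopOK L l)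
    {κ κ' : Core k} {m} (hf : Fits L κ κ' m) {C : Multiset (Core k)}
    (hc : (S.bind fun l => (cores l : Multiset (Core k))) = κ ::ₘ κ' ::ₘ C) :
    ∃ S' : Multiset (List (Seg k)), (∀ l ∈ S', LoopOK L l) ∧
      (S'.bind fun l => (cores l : Multiset (Core k))) = C ∧
      ((S'.bind fun l => (l : Multiset (Seg k))).map Prod.snd =
        (S.bind fun l => (l : Multiset (Seg k))).map Prod.snd) ∧
      ∀ M, Good L (S'.map flatSegs + (m.map (fun p => exchangeLoop p.1 p.2) + M)) →
        Good L (S.map flatSegs + M) := by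
  obtain ⟨l, hl, hκ⟩ := Multiset.mem_bind.1
    (show κ ∈ S.bind fun l => (cores l : Multiset (Core k)) by rw [hc]; simp)
  obtain ⟨S, rfl⟩ := Multiset.exists_cons_of_mem hl
  obtain ⟨z, A, hA, pA, gA⟩ := (hS l hl).exists_head (Multiset.mem_coe.1 hκ)
  have hpc : (cores l : Multiset (Core k)) = κ ::ₘ (cores A : Multiset (Core k)) :=
    (Multiset.coe_eq_coe.2 (pA.filterMap Prod.fst)).symm
  have hpl : (l : Multiset (Seg k)) = (some κ, z) ::ₘ (A : Multiset (Seg k)) :=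
    (Multiset.coe_eq_coe.2 pA).symm
  rw [Multiset.cons_bind, hpc, Multiset.cons_add, Multiset.cons_inj_right] at hc
  have hz := hA.seg (some κ, z) (by simp)
  have nz := hz.far.ne_nil hL
  have mz := hz.far.head hL
  have chA := hA.chain
  rw [Cycle.chain_coe_cons] at chA
  have hmem : κ' ∈ (cores A : Multiset (Core k)) +
      S.bind fun l => (cores l : Multiset (Core k)) := by rw [hc]; simp
  rcases Multiset.mem_add.1 hmem with h1 | h1
  · obtain ⟨⟨o, z'⟩, hu, rfl : o = some κ'⟩ := List.mem_filterMap.1 (Multiset.mem_coe.1 h1)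
    obtain ⟨B, B', rfl⟩ := List.append_of_mem hu
    have hz' := hA.seg (some κ', z') (by simp)
    rw [List.append_assoc, List.cons_append, List.isChain_cons_split] at chA
    refine ⟨((none, z) :: B) ::ₘ ((none, z') :: B') ::ₘ S, ?_, ?_, ?_, fun M hM => ?_⟩
    · intro x hx
      simp only [Multiset.mem_cons] at hx
      rcases hx with rfl | rfl | hx
      · refine ⟨by simp, fun u hu => ?_, ?_⟩
        · rcases List.mem_cons.1 hu with rfl | hu
          · exact hz.forget
          · exact hA.seg u (by simp [hu])
        · rw [Cycle.chain_coe_cons]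
          exact chain_replace (u := (some κ, z)) rfl (link_of_fits (hz.head κ rfl) hf.left) chA.1
      · refine ⟨by simp, fun u hu => ?_, ?_⟩
        · rcases List.mem_cons.1 hu with rfl | hu
          · exact hz'.forget
          · exact hA.seg u (by simp [hu])
        · rw [Cycle.chain_coe_cons]
          exact chain_replace (u := (some κ', z')) rfl (link_of_fits (hz'.head κ' rfl) hf.right) chA.2
      · exact hS x (by simp [hx])
    · rw [cores_append] at hc
      have e : cores ((some κ', z') :: B') = κ' :: cores B' := rfl
      have e1 : cores ((none, z) :: B) = cores B := rfl
      have e2 : cores ((none, z') :: B') = cores B' := rfl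
      rw [e, ← Multiset.coe_add, ← Multiset.cons_coe, Multiset.add_cons, Multiset.cons_add,
        Multiset.cons_inj_right] at hc
      rw [Multiset.cons_bind, Multiset.cons_bind, e1, e2, ← hc, add_assoc]
    · rw [Multiset.cons_bind, Multiset.cons_bind, Multiset.cons_bind, hpl, ← Multiset.coe_add,
        ← Multiset.cons_coe, ← Multiset.cons_coe, ← Multiset.cons_coe]
      simp only [Multiset.map_add, Multiset.map_cons, Multiset.cons_add, Multiset.add_cons,
        add_assoc]
      exact Multiset.cons_swap _ _ _
    · rw [Multiset.map_cons, Multiset.cons_add]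
      refine gA _ ?_
      rw [flatSegs_cons_some, flatSegs_append, flatSegs_cons_some]
      have := hf.dec.good_split hL (A := z ++ flatSegs B) (B := z' ++ flatSegs B')
        (M := S.map flatSegs + M) (by simp [nz]) (by simp [hz'.far.ne_nil hL])
        (not_marked_append_zero nz mz)
        (not_marked_append_zero (hz'.far.ne_nil hL) (hz'.far.head hL)) (by
          rw [Multiset.map_cons, Multiset.map_cons, flatSegs_cons_none hL hz,
            flatSegs_cons_none hL hz'] at hM
          convert hM using 1
          simp only [← Multiset.singleton_add]
          abel)
      simpa using this
  · obtain ⟨l', hl', hκ'⟩ := Multiset.mem_bind.1 h1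
    obtain ⟨S, rfl⟩ := Multiset.exists_cons_of_mem hl'
    obtain ⟨z', B, hB, pB, gB⟩ := (hS l' (by simp)).exists_head (Multiset.mem_coe.1 hκ')
    have hpc' : (cores l' : Multiset (Core k)) = κ' ::ₘ (cores B : Multiset (Core k)) :=
      (Multiset.coe_eq_coe.2 (pB.filterMap Prod.fst)).symm
    have hpl' : (l' : Multiset (Seg k)) = (some κ', z') ::ₘ (B : Multiset (Seg k)) :=
      (Multiset.coe_eq_coe.2 pB).symm
    have hz' := hB.seg (some κ', z') (by simp)
    have chB := hB.chain
    rw [Cycle.chain_coe_cons] at chB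
    refine ⟨((none, z) :: A ++ (none, z') :: B) ::ₘ S, ?_, ?_, ?_, fun M hM => ?_⟩
    · intro x hx
      rcases Multiset.mem_cons.1 hx with rfl | hx
      · refine ⟨by simp, fun u hu => ?_, ?_⟩
        · rcases List.mem_append.1 hu with hu | hu
          · rcases List.mem_cons.1 hu with rfl | hu
            · exact hz.forget
            · exact hA.seg u (by simp [hu])
          · rcases List.mem_cons.1 hu with rfl | hu
            · exact hz'.forget
            · exact hB.seg u (by simp [hu])
        · rw [List.cons_append, Cycle.chain_coe_cons, List.append_assoc, List.cons_append,
            List.isChain_cons_split]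
          exact ⟨chain_replace (u := (some κ, z)) rfl
              (link_of_fits (hz'.head κ' rfl) hf.right) chA,
            chain_replace (u := (some κ', z')) rfl (link_of_fits (hz.head κ rfl) hf.left) chB⟩
      · exact hS x (by simp [hx])
    · have e1 : cores ((none, z) :: A ++ (none, z') :: B) = cores A ++ cores B := by
        simp [cores]
      rw [Multiset.cons_bind, hpc', Multiset.cons_add, Multiset.add_cons,
        Multiset.cons_inj_right] at hc
      rw [Multiset.cons_bind, e1, ← Multiset.coe_add, ← hc, add_assoc]
    · rw [Multiset.cons_bind, Multiset.cons_bind, Multiset.cons_bind, hpl, hpl',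
        ← Multiset.coe_add, ← Multiset.cons_coe, ← Multiset.cons_coe]
      simp only [Multiset.map_add, Multiset.map_cons, Multiset.cons_add, Multiset.add_cons,
        add_assoc]
    · rw [Multiset.map_cons, Multiset.map_cons, Multiset.cons_add, Multiset.cons_add]
      refine gA _ ?_
      rw [Multiset.cons_swap]
      refine gB _ ?_
      rw [Multiset.cons_swap, flatSegs_cons_some, flatSegs_cons_some]
      have nz' := hz'.far.ne_nil hL
      refine hf.dec.good_merge hL (by simp [nz]) (by simp [nz']) (not_marked_append_zero nz mz)
        (not_marked_append_zero nz' (hz'.far.head hL)) ?_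
      rw [← flatSegs_cons_none hL hz, ← flatSegs_cons_none hL hz', ← flatSegs_append]
      rw [Multiset.map_cons] at hM
      convert hM using 1
      simp only [← Multiset.singleton_add]
      abel

theorem exists_glue (hL : 0 < L)
    (P : Multiset (Core k × Core k × Multiset (List (Letter k) × List (Letter k))))
    (hP : ∀ p ∈ P, Fits L p.1 p.2.1 p.2.2) : ∀ {S : Multiset (List (Seg k))},
    (∀ l ∈ S, LoopOK L l) →
    (S.bind fun l => (cores l : Multiset (Core k))) = P.map (·.1) + P.map (·.2.1) →
    ∃ S' : Multiset (List (Seg k)), (∀ l ∈ S', LoopOK L l) ∧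
      (S'.bind fun l => (cores l : Multiset (Core k))) = 0 ∧
      ((S'.bind fun l => (l : Multiset (Seg k))).map Prod.snd =
        (S.bind fun l => (l : Multiset (Seg k))).map Prod.snd) ∧
      ∀ M, Good L (S'.map flatSegs + ((P.bind (·.2.2)).map (fun p => exchangeLoop p.1 p.2) + M)) →
        Good L (S.map flatSegs + M) := by
  induction P using Multiset.induction_on with
  | empty =>
    intro S hS hc
    exact ⟨S, hS, by simpa using hc, rfl, fun M hM => by simpa using hM⟩
  | cons p P ih =>
    intro S hS hc
    obtain ⟨S1, h1, h2, h3, h4⟩ := exists_glue_pair hL hS (hP p (by simp))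
      (C := P.map (·.1) + P.map (·.2.1)) (by
        rw [hc, Multiset.map_cons, Multiset.map_cons, Multiset.cons_add, Multiset.add_cons])
    obtain ⟨S2, h5, h6, h7, h8⟩ := ih (fun q hq => hP q (by simp [hq])) h1 h2
    refine ⟨S2, h5, h6, h7.trans h3, fun M hM => h4 _ (h8 _ ?_)⟩
    rw [Multiset.cons_bind, Multiset.map_add] at hM
    convert hM using 1
    abel

/-- Without cores the loop is a concatenation of segments that start with a mark and have long
unmarked margins, hence it is loose. It is cyclically reduced because consecutive segments are
linked. -/
theorem LoopOK.exists_pieces (hL : 0 < L) {l : List (Seg k)} (h : LoopOK L l)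
    (hc : cores l = []) : ∃ ps : List (List (Letter k × Bool)), ps ≠ [] ∧ (∀ p ∈ ps, Piece L p) ∧
      CycRed (labels ps.flatten) ∧ 4 * L * ps.length ≤ (l.map fun u => u.2.length).sum ∧
      hom (labels ps.flatten) = (l.map fun u => hom (labels u.2)).sum ∧
      ∀ M, Good L (ps.flatten ::ₘ M) → Good L (flatSegs l ::ₘ M) := by
  have hnone : ∀ u ∈ l, u.1 = none := by
    intro u hu
    by_contra hne
    obtain ⟨κ, hκ⟩ := Option.ne_none_iff_exists'.1 hne
    have : κ ∈ cores l := List.mem_filterMap.2 ⟨u, hu, hκ⟩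
    rw [hc] at this
    simp at this
  have hflat : flatSegs l = (l.map fun u => tick u.2).flatten := by
    unfold flatSegs
    congr 1
    refine List.map_congr_left fun u hu => ?_
    obtain ⟨o, z⟩ := u
    obtain rfl : o = none := hnone _ hu
    rfl
  have hlab : labels (flatSegs l) = (l.map fun u => labels u.2).flatten := by
    rw [hflat, labels, List.map_flatten, List.map_map]
    congr 1
    exact List.map_congr_left fun u _ => labels_tick
  have hhom : ∀ l : List (Seg k), hom (l.map fun u => labels u.2).flatten =
      (l.map fun u => hom (labels u.2)).sum := by
    intro l
    induction l with
    | nil => simp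
    | cons u l ih => simp [ih]
  have hloose : Loose L (flatSegs l) := by
    rw [hflat]
    refine Loose.flatten (by simpa using h.ne_nil) fun z hz => ?_
    obtain ⟨u, hu, rfl⟩ := List.mem_map.1 hz
    exact (h.seg u hu).far.loose_tick hL
  obtain ⟨a, b, ps, hab, h1, h2, h3, h4⟩ := hloose.exists_pieces hL
  have hcr : CycRed (labels (flatSegs l)) := by
    obtain ⟨u, A, rfl⟩ := List.exists_cons_of_ne_nil h.ne_nil
    have hne : ∀ v ∈ u :: A, labels v.2 ≠ [] := fun v hv e =>
      (h.seg v hv).far.ne_nil hL (by simpa [labels] using e)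
    have hch := h.chain
    rw [Cycle.chain_coe_cons] at hch
    -- The first segment is repeated at the end, in order to see the joint at which the loop closes
    -- up.
    have hred : Red (((u :: A) ++ [u]).map fun u => labels u.2).flatten := by
      unfold Red
      rw [List.isChain_flatten]
      · refine ⟨fun w hw => ?_, ?_⟩
        · obtain ⟨v, hv, rfl⟩ := List.mem_map.1 hw
          exact (h.seg v (by simp at hv ⊢; tauto)).red
        · rw [List.isChain_map]
          rw [← List.cons_append] at hch
          refine (List.isChain_iff_getElem.2 fun i hi => ?_)
          exact ((List.isChain_iff_getElem.1 hch i hi).2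
            (hnone _ (by rcases List.mem_append.1 (List.getElem_mem hi) with h' | h'
                         · exact h'
                         · rw [List.mem_singleton.1 h']; simp)))
      · intro hmem
        obtain ⟨v, hv, hv'⟩ := List.mem_map.1 hmem
        exact hne v (by simp at hv ⊢; tauto) hv'
    rw [List.map_append, List.flatten_append, ← hlab] at hred
    have hu := hne u (by simp)
    have hl : labels (flatSegs (u :: A)) ≠ [] := by
      rw [hlab]
      simp [hu]
    obtain ⟨p, q, hpq⟩ := Path.exists_of_red hred (by simp [hl])
    obtain ⟨r, s, hr, hs, hrs⟩ := hpq.of_append hl (by simpa using hu)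
    refine ⟨p, r, hr, ?_⟩
    have e1 := hr.head
    have e2 := hs.head
    rw [hlab] at e1
    simp only [List.map_cons, List.map_nil, List.flatten_cons, List.flatten_nil, List.append_nil,
      List.head?_append] at e1 e2
    rw [e2] at e1
    simp at e1
    rw [← e1]
    exact hrs.symm
  refine ⟨ps, h3, h1, ?_, ?_, ?_, fun M hM => ?_⟩
  · rw [hab, labels_append] at hcr
    rw [h2, labels_append]
    exact hcr.rot
  · have : (flatSegs l).length = (l.map fun u => u.2.length).sum := by
      rw [hflat, List.length_flatten, List.map_map]
      congr 1
      exact List.map_congr_left fun u _ => by simp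
    omega
  · rw [← hhom, ← hlab, h2, hab]
    simp [add_comm]
  · rw [hab]
    refine .rot _ _ _ ?_
    rwa [← h2]

theorem exists_pieces_of_cores (hL : 0 < L)
    (P : Multiset (Core k × Core k × Multiset (List (Letter k) × List (Letter k))))
    (hP : ∀ p ∈ P, Fits L p.1 p.2.1 p.2.2) {S : Multiset (List (Seg k))}
    (hS : ∀ l ∈ S, LoopOK L l)
    (hc : (S.bind fun l => (cores l : Multiset (Core k))) = P.map (·.1) + P.map (·.2.1)) :
    ∃ R : Multiset (List (List (Letter k × Bool))),
      (∀ ps ∈ R, ps ≠ [] ∧ (∀ p ∈ ps, Piece L p) ∧ CycRed (labels ps.flatten)) ∧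
      4 * L * (R.map List.length).sum ≤
        ((S.bind fun l => (l : Multiset (Seg k))).map fun u => u.2.length).sum ∧
      (R.map fun ps => hom (labels ps.flatten)).sum =
        ((S.bind fun l => (l : Multiset (Seg k))).map fun u => hom (labels u.2)).sum ∧
      ∀ M, Good L (R.map List.flatten +
          ((P.bind (·.2.2)).map (fun p => exchangeLoop p.1 p.2) + M)) →
        Good L (S.map flatSegs + M) := by
  obtain ⟨S', h1, h2, h3, h4⟩ := exists_glue hL P hP hS hc
  suffices H : ∃ R : Multiset (List (List (Letter k × Bool))),
      (∀ ps ∈ R, ps ≠ [] ∧ (∀ p ∈ ps, Piece L p) ∧ CycRed (labels ps.flatten)) ∧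
      4 * L * (R.map List.length).sum ≤
        ((S'.bind fun l => (l : Multiset (Seg k))).map fun u => u.2.length).sum ∧
      (R.map fun ps => hom (labels ps.flatten)).sum =
        ((S'.bind fun l => (l : Multiset (Seg k))).map fun u => hom (labels u.2)).sum ∧
      ∀ M, Good L (R.map List.flatten + M) → Good L (S'.map flatSegs + M) by
    obtain ⟨R, r1, r2, r3, r4⟩ := H
    refine ⟨R, r1, ?_, ?_, fun M hM => h4 _ (r4 _ hM)⟩
    · have := congrArg (fun X => (X.map List.length).sum) h3
      simp only [Multiset.map_map, Function.comp_def] at this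
      exact r2.trans this.le
    · have := congrArg (fun X => (X.map fun z => hom (labels z)).sum) h3
      simp only [Multiset.map_map, Function.comp_def] at this
      rw [r3, this]
  clear h3 h4 hc hS hP
  induction S' using Multiset.induction_on with
  | empty => exact ⟨0, by simp, by simp, by simp, fun M hM => by simpa using hM⟩
  | cons l S' ih =>
    rw [Multiset.cons_bind] at h2
    obtain ⟨h2a, h2b⟩ := add_eq_zero.1 h2
    obtain ⟨R, r1, r2, r3, r4⟩ := ih (fun x hx => h1 x (by simp [hx])) h2b
    obtain ⟨ps, p1, p2, p3, p4, p5, p6⟩ := (h1 l (by simp)).exists_pieces hL (by simpa using h2a)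
    refine ⟨ps ::ₘ R, ?_, ?_, ?_, fun M hM => ?_⟩
    · intro x hx
      rcases Multiset.mem_cons.1 hx with rfl | hx
      · exact ⟨p1, p2, p3⟩
      · exact r1 x hx
    · simp only [Multiset.map_cons, Multiset.sum_cons, Multiset.cons_bind, Multiset.map_add,
        Multiset.sum_add, Multiset.map_coe, Multiset.sum_coe, mul_add]
      omega
    · simp only [Multiset.map_cons, Multiset.sum_cons, Multiset.cons_bind, Multiset.map_add,
        Multiset.sum_add, Multiset.map_coe, Multiset.sum_coe, p5, r3]
    · rw [Multiset.map_cons, Multiset.cons_add] at hM ⊢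
      refine p6 _ ?_
      rw [← Multiset.add_cons] at hM ⊢
      exact r4 _ hM

end Segments

end ThinFatgraph

namespace ThinFatgraph

/-! ### Absorbing what remains after gluing the cores -/

section Absorption

variable {k L : ℕ}

theorem mirror_exchangeLoop {q r : List (Letter k)} (hq : q ≠ []) (hr : r ≠ []) :
    mirror (exchangeLoop q r) = exchangeLoop r q := by
  have nq : plain q ≠ [] := by simpa [plain] using hq
  have nr : plain (wordInv r) ≠ [] := by
    intro e
    have := congrArg List.length e
    exact hr (by simpa using this)
  have t : ∀ {u : List (Letter k × Bool)}, u ≠ [] → tick u ≠ [] := by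
    intro u hu e
    have := congrArg List.length e
    exact hu (by simpa using this)
  rw [mirror, exchangeLoop, onem, onem, headMark_append (t nq), headMark_tick nq, revMark_append,
    headMark_tick nr, revMark_tick, revMark_tick, revMark_true, revMark_true, revMark_plain,
    revMark_plain, wordInv_wordInv]
  rfl

theorem Good.absorb_exchange {B : Multiset (List (Letter k))} {E : List (Letter k × Bool)}
    (hE : ∀ N, Good L (B.map onem + N) → Good L (E ::ₘ N)) : ∀ (n : ℕ) (N),
    Good L (n • B.map onem + N) → Good L (Multiset.replicate n E + N)
  | 0, N, h => by simpa using h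
  | n + 1, N, h => by
    rw [Multiset.replicate_succ, Multiset.cons_add]
    refine hE _ ?_
    rw [add_comm, add_assoc]
    refine Good.absorb_exchange hE n _ ?_
    rwa [add_comm N, ← add_assoc, ← succ_nsmul]

/-- Two words of equal length that fit into the same places, such that a collection of loops
becomes good as soon as sufficiently many subwords are exchanged when gluing its cores. -/
theorem exists_good_of_cores (hk : 2 ≤ k) (hL : 0 < L) :
    ∃ (x y : Letter k) (Q R : List (Letter k)), y ≠ x ∧ y ≠ x.inv ∧ Path x x.inv Q ∧
      Path x.inv x R ∧ Q.length = R.length ∧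
      ∀ (P : Multiset (Core k × Core k × Multiset (List (Letter k) × List (Letter k)))),
        (∀ p ∈ P, Fits L p.1 p.2.1 p.2.2) → ∀ S : Multiset (List (Seg k)), (∀ l ∈ S, LoopOK L l) →
        (S.bind fun l => (cores l : Multiset (Core k))) = P.map (·.1) + P.map (·.2.1) →
        (S.map fun l => hom (labels (flatSegs l))).sum = 0 → ∀ n n' : ℕ,
        P.bind (·.2.2) = Multiset.replicate n (Q, R) + Multiset.replicate n' (R, Q) →
        2 * ((S.bind fun l => (l : Multiset (Seg k))).map fun u => u.2.length).sum ≤ 4 * L * n →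
        Good L (S.map flatSegs) := by
  obtain ⟨B, hB, hloops⟩ := exists_loop_absorber hk hL
  obtain ⟨x, y, Q, R, h1, h2, h3, h4, h5, hE⟩ := exists_exchange hk hL hB
  -- Since `B` is good, the exchange loop is good by itself, and so is its mirror image, which
  -- belongs to the opposite exchange.
  have g1 : Good L {exchangeLoop Q R} := hE 0 (by simpa using hB.2)
  have g2 : Good L {exchangeLoop R Q} := by
    have := g1.mirror
    rwa [Multiset.map_singleton, mirror_exchangeLoop h3.ne_nil h4.ne_nil] at this
  have z1 := g1.hom_eq_zero
  have z2 := g2.hom_eq_zero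
  simp only [Multiset.map_singleton, Multiset.sum_singleton] at z1 z2
  refine ⟨x, y, Q, R, h1, h2, h3, h4, h5, fun P hP S hS hc hh n n' hn hle => ?_⟩
  obtain ⟨M, m1, m2, m3, m4⟩ := exists_pieces_of_cores hL P hP hS hc
  have hseg : ∀ l : List (Seg k), hom (labels (flatSegs l)) =
      ((cores l).map fun κ => hom κ.2.1).sum + (l.map fun u => hom (labels u.2)).sum := by
    intro l
    induction l with
    | nil => simp [flatSegs, labels, cores]
    | cons u l ih =>
      have : flatSegs (u :: l) = u.flat ++ flatSegs l := rfl
      rw [this, labels_append, hom_append, ih]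
      obtain ⟨_ | κ, z⟩ := u
      · simp [Seg.flat, cores]
        abel
      · simp [Seg.flat, cores]
        abel
  have hS' : (S.map fun l => hom (labels (flatSegs l))).sum =
      ((S.bind fun l => (cores l : Multiset (Core k))).map fun κ => hom κ.2.1).sum +
      ((S.bind fun l => (l : Multiset (Seg k))).map fun u => hom (labels u.2)).sum := by
    clear hc hS hh hle m1 m2 m3 m4
    induction S using Multiset.induction_on with
    | empty => simp
    | cons l S ih =>
      rw [Multiset.map_cons, Multiset.sum_cons, ih, hseg]
      simp only [Multiset.cons_bind, Multiset.map_add, Multiset.sum_add, Multiset.map_coe,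
        Multiset.sum_coe]
      abel
  have hP' : ((P.map (·.1) + P.map (·.2.1)).map fun κ => hom κ.2.1).sum =
      ((P.bind (·.2.2)).map fun p => hom (labels (exchangeLoop p.1 p.2))).sum := by
    clear hc hn m4
    induction P using Multiset.induction_on with
    | empty => simp
    | cons p P ih =>
      have := ih fun q hq => hP q (by simp [hq])
      have e := (hP p (by simp)).dec.hom_add
      simp only [Multiset.cons_bind, Multiset.map_cons, Multiset.map_add, Multiset.sum_add,
        Multiset.sum_cons] at this ⊢
      rw [← this, ← e]
      abel
  -- The glued cores contribute only the homology of the exchange loops, which vanishes.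
  have h0 : (M.map fun ps => hom (labels ps.flatten)).sum = 0 := by
    rw [hS', hc, hP', hn] at hh
    simp only [Multiset.map_add, Multiset.map_replicate, Multiset.sum_add,
      Multiset.sum_replicate, z1, z2, smul_zero, zero_add] at hh
    rw [m3, hh]
  -- Pieces have length at least `4 * L`, so the bound on the total length of the segments bounds
  -- twice the number of pieces by the number `n` of released copies of `B`.
  have h6 := hloops M m1 h0 n (by
    have : 4 * L * (2 * (M.map List.length).sum) ≤ 4 * L * n := by
      rw [← mul_assoc, mul_comm (4 * L) 2, mul_assoc]
      exact (Nat.mul_le_mul_left 2 m2).trans hle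
    exact Nat.le_of_mul_le_mul_left this (by omega))
  have h7 := m4 0 (by
    rw [hn, Multiset.map_add, Multiset.map_replicate, Multiset.map_replicate, add_zero, ← add_assoc]
    refine Good.add ?_ ?_
    · rw [add_comm]
      exact Good.absorb_exchange hE n _ (by rwa [add_comm])
    · rw [← Multiset.nsmul_singleton]
      exact g2.nsmul n')
  simpa using h7

end Absorption

end ThinFatgraph

namespace ThinFatgraph

/-! ### Exchanging `Q` and `R` in consecutive slots -/

section Swap

variable {k : ℕ} (L : ℕ) (y : Letter k) (Q R : List (Letter k))

/-- Exchange the subwords `Q` and `R` behind the first `L + 1` letters, between letters `y`. -/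
def swapOne (g : List (Letter k)) : List (Letter k) :=
  if g.drop L = y :: (Q ++ [y]) then g.take L ++ y :: (R ++ [y])
  else if g.drop L = y :: (R ++ [y]) then g.take L ++ y :: (Q ++ [y]) else g

/-- Exchange the subwords `Q` and `R` in the first `J` consecutive slots. -/
def swap : ℕ → List (Letter k) → List (Letter k)
  | 0, c => c
  | J + 1, c => swapOne L y Q R (c.take (L + (Q.length + 2))) ++
      swap J (c.drop (L + (Q.length + 2)))

/-- The exchanges that are performed by `swap`. -/
def swaps : ℕ → List (Letter k) → Multiset (List (Letter k) × List (Letter k))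
  | 0, _ => 0
  | J + 1, c => (if (c.take (L + (Q.length + 2))).drop L = y :: (Q ++ [y]) then {(Q, R)}
      else if (c.take (L + (Q.length + 2))).drop L = y :: (R ++ [y]) then {(R, Q)} else 0) +
      swaps J (c.drop (L + (Q.length + 2)))

/-- The number of slots that contain `Q`. -/
def slotCount (J : ℕ) (c : List (Letter k)) : ℕ :=
  ∑ j ∈ Finset.range J,
    if (c.drop (j * (L + (Q.length + 2)) + L)).take (Q.length + 2) = y :: (Q ++ [y]) then 1 else 0

variable {L y Q R}

theorem length_swapOne (hQR : Q.length = R.length) {g : List (Letter k)}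
    (hg : g.length = L + (Q.length + 2)) : (swapOne L y Q R g).length = g.length := by
  unfold swapOne
  split_ifs <;> simp <;> omega

theorem swapOne_swapOne (hQR : Q.length = R.length) {g : List (Letter k)}
    (hg : g.length = L + (Q.length + 2)) : swapOne L y Q R (swapOne L y Q R g) = g := by
  have hd : ∀ X, (g.take L ++ X).drop L = X := fun X =>
    List.drop_left' (by simp; omega)
  have ht : ∀ X, (g.take L ++ X).take L = g.take L := fun X =>
    List.take_left' (by simp; omega)
  have htd := List.take_append_drop L g
  unfold swapOne
  split_ifs with h1 h2 h3 h4 h5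
  · rw [hd] at h2
    rw [ht, h2, ← h1, htd]
  · rw [ht, ← h1, htd]
  · rw [hd] at h3
    exact absurd rfl h3
  · rw [ht, ← h4, htd]
  · exact absurd (hd _) h5
  · exact absurd (hd _) h5
  · rfl

theorem length_swap (hQR : Q.length = R.length) : ∀ (J : ℕ) (c : List (Letter k)),
    J * (L + (Q.length + 2)) ≤ c.length → (swap L y Q R J c).length = c.length
  | 0, c, _ => rfl
  | J + 1, c, h => by
    rw [Nat.add_mul, one_mul] at h
    rw [swap, List.length_append, length_swapOne hQR (by simp; omega),
      length_swap hQR J _ (by simp; omega)]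
    simp
    omega

/-- As `Q` and `R` have equal length, the slots stay in place, so swapping is an involution. This is
what makes the pairing of cores injective. -/
theorem swap_swap (hQR : Q.length = R.length) : ∀ (J : ℕ) (c : List (Letter k)),
    J * (L + (Q.length + 2)) ≤ c.length → swap L y Q R J (swap L y Q R J c) = c
  | 0, c, _ => rfl
  | J + 1, c, h => by
    rw [Nat.add_mul, one_mul] at h
    have hl : (c.take (L + (Q.length + 2))).length = L + (Q.length + 2) := by simp; omega
    have hl' := (length_swapOne (y := y) hQR hl).trans hl
    rw [swap, swap, List.take_left' hl', List.drop_left' hl', swapOne_swapOne hQR hl,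
      swap_swap hQR J _ (by simp; omega), List.take_append_drop]

/-- Both `y Q y` and `y R y` are reduced with the same directions at their ends, so one can replace
the other in a reduced word. The surplus `L` in the length keeps the part after the last slot
nonempty. -/
theorem path_swap (hL : 0 < L) {x : Letter k} (hyx : y ≠ x) (hyx' : y ≠ x.inv)
    (hQ : Path x x.inv Q) (hR : Path x.inv x R) (hQR : Q.length = R.length) : ∀ (J : ℕ)
    {h t : Letter k} {c : List (Letter k)}, J * (L + (Q.length + 2)) + L ≤ c.length →
    Path h t c → Path h t (swap L y Q R J c)
  | 0, _, _, _, _, hp => hp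
  | J + 1, h, t, c, hl, hp => by
    rw [Nat.add_mul, one_mul] at hl
    have hyi : y.inv ≠ x := fun e => hyx' (by rw [← e, Letter.inv_inv])
    have hyi' : y.inv ≠ x.inv := fun e => hyx (Letter.inv_injective e)
    have pQ : Path y y.inv (y :: (Q ++ [y])) :=
      (Path.letter y).append (hQ.append (Path.letter y) hyx'.symm) hyi
    have pR : Path y y.inv (y :: (R ++ [y])) :=
      (Path.letter y).append (hR.append (Path.letter y) hyx.symm) hyi'
    have hlt : (c.take (L + (Q.length + 2))).length = L + (Q.length + 2) := by simp; omega
    have hld : (c.drop (L + (Q.length + 2))).length = c.length - (L + (Q.length + 2)) := by simp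
    have ne : ∀ {w : List (Letter k)} {n}, w.length = n → 0 < n → w ≠ [] := by
      rintro w n hw hn rfl
      simp at hw
      omega
    rw [← List.take_append_drop (L + (Q.length + 2)) c] at hp
    obtain ⟨b, b', h1, h2, h3⟩ := hp.of_append (ne hlt (by omega)) (ne hld (by omega))
    refine Path.append ?_ (path_swap hL hyx hyx' hQ hR hQR J (by omega) h2) h3
    have key : ∀ X X' : List (Letter k), X ≠ [] → Path y y.inv X → Path y y.inv X' →
        (c.take (L + (Q.length + 2))).drop L = X →
        Path h b ((c.take (L + (Q.length + 2))).take L ++ X') := by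
      intro X X' nX hX hX' e
      rw [← List.take_append_drop L (c.take (L + (Q.length + 2))), e] at h1
      obtain ⟨d, d', h4, h5, h6⟩ := h1.of_append (ne (n := L) (by simp; omega) hL) nX
      obtain rfl := h5.head_unique hX
      obtain rfl := h5.last_unique hX
      exact h4.append hX' h6
    unfold swapOne
    split_ifs with h4 h5
    · exact key _ _ (by simp) pQ pR h4
    · exact key _ _ (by simp) pR pQ h5
    · exact h1

/-- The first `L` letters of each slot serve as the glued edge before an exchange, and the surplus
`L` at the end as the last one. The letters `y` around `Q` and `R` are common to both sides and are
added to these edges. -/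
theorem dec_swap (hL : 0 < L) (hQ : Q ≠ []) (hR : R ≠ []) : ∀ (J : ℕ)
    (c : List (Letter k)), J * (L + (Q.length + 2)) + L ≤ c.length →
    Dec L c (wordInv (swap L y Q R J c)) (swaps L y Q R J c)
  | 0, c, h => .base c (by omega)
  | J + 1, c, h => by
    rw [Nat.add_mul, one_mul] at h
    have ih := dec_swap hL hQ hR J (c.drop (L + (Q.length + 2))) (by simp; omega)
    have hc := List.take_append_drop (L + (Q.length + 2)) c
    rw [swap, swaps]
    set g := c.take (L + (Q.length + 2))
    set c' := c.drop (L + (Q.length + 2))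
    have hg := List.take_append_drop L g
    have hg' : g.length = L + (Q.length + 2) := by simp [g]; omega
    have hgl : (g.take L).length = L := by rw [List.length_take]; omega
    have key : ∀ q r : List (Letter k), q ≠ [] → r ≠ [] → g.drop L = y :: (q ++ [y]) →
        Dec L c (wordInv (g.take L ++ y :: (r ++ [y]) ++ swap L y Q R J c'))
          ({(q, r)} + swaps L y Q R J c') := by
      intro q r hq hr e
      have h1 := Dec.step (g.take L ++ [y]) q r _ _ _ (by rw [List.length_append]; omega) hq hr (ih.prepend [y])
      rw [Multiset.singleton_add]
      convert h1 using 1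
      · conv_lhs => rw [← hc, ← hg, e]
        simp
      · have : y :: (r ++ [y]) = [y] ++ r ++ [y] := by simp
        rw [this]
        simp only [wordInv_append, List.append_assoc]
    unfold swapOne
    split_ifs with h1 h2
    · exact key Q R hQ hR h1
    · exact key R Q hR hQ h2
    · rw [zero_add, wordInv_append]
      have h3 := ih.prepend g
      rwa [hc] at h3

theorem exists_swaps_eq : ∀ (J : ℕ) (c : List (Letter k)), ∃ n,
    swaps L y Q R J c = Multiset.replicate (slotCount L y Q J c) (Q, R) +
      Multiset.replicate n (R, Q)
  | 0, c => ⟨0, by simp [swaps, slotCount]⟩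
  | J + 1, c => by
    obtain ⟨n, hn⟩ := exists_swaps_eq J (c.drop (L + (Q.length + 2)))
    have e : slotCount L y Q (J + 1) c =
        (if (c.take (L + (Q.length + 2))).drop L = y :: (Q ++ [y]) then 1 else 0) +
          slotCount L y Q J (c.drop (L + (Q.length + 2))) := by
      rw [slotCount, Finset.sum_range_succ', add_comm, slotCount]
      congr 1
      · rw [List.drop_take]
        simp
      · refine Finset.sum_congr rfl fun j _ => ?_
        rw [List.drop_drop]
        congr 4
        ring
    rw [swaps, hn, e]
    split_ifs with h1 h2
    · exact ⟨n, by rw [Multiset.replicate_add, Multiset.replicate_one, add_assoc]⟩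
    · exact ⟨n + 1, by
        rw [zero_add, Multiset.replicate_succ, ← Multiset.singleton_add]
        abel⟩
    · exact ⟨n, by simp⟩

end Swap

/-! ### The partner of a core -/

section Partner

variable {k L : ℕ}

/-- The word that consists of a core and the two adjacent letters. -/
def Core.word (κ : Core k) : List (Letter k) := κ.1 :: (κ.2.1 ++ [κ.2.2])

/-- The `2 * k - 1 ≥ 3` letters other than `d` are permuted cyclically, and `d` is fixed. -/
theorem exists_derangement (hk : 2 ≤ k) (d : Letter k) : ∃ f : Letter k → Letter k,
    Function.Injective f ∧ ∀ b, b ≠ d → f b ≠ d ∧ f b ≠ b := by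
  classical
  have e := Fintype.equivFin {b : Letter k // b ≠ d}
  have hc : Fintype.card {b : Letter k // b ≠ d} = 2 * k - 1 := by
    rw [Fintype.card_subtype_compl, Fintype.card_subtype_eq]
    simp [mul_comm]
  obtain ⟨n, hn⟩ : ∃ n, Fintype.card {b : Letter k // b ≠ d} = n + 2 := ⟨2 * k - 3, by omega⟩
  rw [hn] at e
  let g : Equiv.Perm {b : Letter k // b ≠ d} := (e.trans (finRotate (n + 2))).trans e.symm
  have hg : ∀ b, g b ≠ b := by
    intro b hb
    have h1 : finRotate (n + 2) (e b) = e b := by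
      simpa [g] using congrArg e hb
    rw [finRotate_apply] at h1
    simp at h1
  refine ⟨fun b => g.ofSubtype b, g.ofSubtype.injective, fun b hb => ?_⟩
  simp only [Equiv.Perm.ofSubtype_apply_of_mem g hb]
  exact ⟨(g ⟨b, hb⟩).2, fun h => hg ⟨b, hb⟩ (Subtype.ext h)⟩

theorem Core.exists_path {κ : Core k} (h : Red κ.word) (hc : κ.2.1 ≠ []) :
    ∃ s t, Path s t κ.2.1 ∧ s ≠ κ.1.inv ∧ κ.2.2 ≠ t := by
  obtain ⟨p, q, hpq⟩ := Path.exists_of_red h (by simp [Core.word])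
  rw [Core.word, ← List.singleton_append] at hpq
  obtain ⟨a, b, h1, h2, h3⟩ := hpq.of_append (by simp) (by simp)
  obtain ⟨s, t, h4, h5, h6⟩ := h2.of_append hc (by simp)
  have h7 := h1.last_unique (Path.letter κ.1)
  have h8 := h5.head_unique (Path.letter κ.2.2)
  have h9 := h4.head
  have h10 := h2.head
  rw [List.head?_append, h9] at h10
  cases h10
  exact ⟨b, s, h4, by rw [← h7]; exact h3.symm, by rw [← h8]; exact h6.symm⟩

theorem Core.red_word {κ : Core k} {s t : Letter k} (hp : Path s t κ.2.1) (h1 : s ≠ κ.1.inv)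
    (h2 : κ.2.2 ≠ t) : Red κ.word :=
  ((Path.letter κ.1).append (hp.append (Path.letter κ.2.2) h2.symm) h1.symm).red

/-- For each core there is another one to which it can be glued, up to exchanges of `Q` and `R`. -/
theorem exists_partner (hk : 2 ≤ k) (hL : 0 < L) {x y : Letter k} {Q R : List (Letter k)}
    (hyx : y ≠ x) (hyx' : y ≠ x.inv) (hQ : Path x x.inv Q) (hR : Path x.inv x R)
    (hQR : Q.length = R.length) {J n : ℕ} (hn : J * (L + (Q.length + 2)) + L ≤ n) :
    ∃ f : Core k → Core k, Set.InjOn f {κ | κ.2.1.length = n ∧ Red κ.word} ∧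
      Set.MapsTo f {κ | κ.2.1.length = n ∧ Red κ.word} {κ | κ.2.1.length = n ∧ Red κ.word} ∧
      ∀ κ : Core k, κ.2.1.length = n → Red κ.word → ∃ m n', Fits L κ (f κ) m ∧
        m = Multiset.replicate (slotCount L y Q J κ.2.1) (Q, R) + Multiset.replicate n' (R, Q) := by
  choose σ hσ hσ' using exists_derangement hk
  have ne : ∀ {w : List (Letter k)}, w.length = n → w ≠ [] := by
    rintro w hw rfl
    simp at hw
    omega
  have key : ∀ κ : Core k, κ.2.1.length = n → Red κ.word → ∃ κ' : Core k, ∃ s t : Letter k,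
      Path s t κ.2.1 ∧ κ'.1 = (σ t κ.2.2).inv ∧ κ'.2.1 = wordInv (swap L y Q R J κ.2.1) ∧
      κ'.2.2 = σ s κ.1.inv ∧ s ≠ κ.1.inv ∧ κ.2.2 ≠ t := by
    intro κ hκ hr
    obtain ⟨s, t, h1, h2, h3⟩ := Core.exists_path hr (ne hκ)
    -- The inverse of the letter before the partner must differ from `t`, so that the partner is
    -- reduced, and from `κ.2.2`, so that the joint after gluing is reduced. The derangement `σ t`
    -- achieves both and is injective; the letter on the other side is treated in the same way.
    exact ⟨((σ t κ.2.2).inv, wordInv (swap L y Q R J κ.2.1), σ s κ.1.inv), s, t, h1, rfl, rfl, rfl,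
      h2, h3⟩
  have : Nonempty (Letter k) := ⟨x⟩
  choose! f s t hp h1 h2 h3 h4 h5 using key
  refine ⟨f, ?_, ?_, fun κ hκ hr => ?_⟩
  · rintro κ ⟨hκ, hr⟩ κ' ⟨hκ', hr'⟩ e
    have e2 : κ.2.1 = κ'.2.1 := by
      have := congrArg (fun κ : Core k => wordInv κ.2.1) e
      simp only [h2 κ hκ hr, h2 κ' hκ' hr', wordInv_wordInv] at this
      rw [← swap_swap (L := L) (y := y) hQR J κ.2.1 (by omega), this,
        swap_swap hQR J κ'.2.1 (by omega)]
    have es : s κ = s κ' := (hp κ hκ hr).head_unique (by rw [e2]; exact hp κ' hκ' hr')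
    have et : t κ = t κ' := (hp κ hκ hr).last_unique (by rw [e2]; exact hp κ' hκ' hr')
    have e1 := congrArg Prod.fst e
    rw [h1 κ hκ hr, h1 κ' hκ' hr', et] at e1
    have e3 := congrArg (fun κ : Core k => κ.2.2) e
    simp only [h3 κ hκ hr, h3 κ' hκ' hr', es] at e3
    exact Prod.ext (Letter.inv_injective (hσ _ e3))
      (Prod.ext e2 (hσ _ (Letter.inv_injective e1)))
  · rintro κ ⟨hκ, hr⟩
    refine ⟨by rw [h2 κ hκ hr, length_wordInv, length_swap hQR J _ (by omega), hκ], ?_⟩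
    refine Core.red_word (s := t κ) (t := s κ) ?_ ?_ ?_
    · rw [h2 κ hκ hr]
      exact (path_swap hL hyx hyx' hQ hR hQR J (by omega) (hp κ hκ hr)).inv
    · rw [h1 κ hκ hr, Letter.inv_inv]
      exact (hσ' _ _ (h5 κ hκ hr)).1.symm
    · rw [h3 κ hκ hr]
      exact (hσ' _ _ (h4 κ hκ hr).symm).1
  · obtain ⟨n', hn'⟩ := exists_swaps_eq (L := L) (y := y) (Q := Q) (R := R) J κ.2.1
    refine ⟨_, n', ⟨?_, ?_, ?_⟩, hn'⟩
    · rw [h2 κ hκ hr]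
      exact dec_swap hL hQ.ne_nil hR.ne_nil J _ (by omega)
    · rw [h1 κ hκ hr, Letter.inv_inv]
      exact (hσ' _ _ (h5 κ hκ hr)).2.symm
    · rw [h3 κ hκ hr]
      exact (hσ' _ _ (h4 κ hκ hr).symm).2

end Partner

end ThinFatgraph

namespace ThinFatgraph

/-! ### Cutting a tagged loop at selected cores -/

section Tokens

variable {k L : ℕ}

/-- A marked letter, or a core with unmarked words before and after it. -/
abbrev Tok (k : ℕ) : Type := (Letter k × Bool) ⊕ (List (Letter k) × Core k × List (Letter k))

/-- The marked list that is represented by a token. -/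
def Tok.flat : Tok k → List (Letter k × Bool)
  | .inl r => [r]
  | .inr (x, κ, y) => plain x ++ plain κ.2.1 ++ plain y

/-- The core of a token. -/
def Tok.core : Tok k → Option (Core k)
  | .inl _ => none
  | .inr (_, κ, _) => some κ

/-- The words around a core have the right length and fit to it. -/
def TokOK (L : ℕ) (t : Tok k) : Prop := ∀ x κ y, t = .inr (x, κ, y) →
  x.length = 2 * L ∧ y.length = 2 * L ∧ x.getLast? = some κ.1 ∧ y.head? = some κ.2.2

/-- The marked list that is represented by a list of tokens. -/
def flatToks (ts : List (Tok k)) : List (Letter k × Bool) := (ts.map Tok.flat).flatten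

theorem flatToks_append (ts ts' : List (Tok k)) :
    flatToks (ts ++ ts') = flatToks ts ++ flatToks ts' := by
  simp [flatToks]

theorem flatToks_cons (t : Tok k) (ts : List (Tok k)) :
    flatToks (t :: ts) = t.flat ++ flatToks ts := rfl

/-- The segments of a list of tokens, followed by the word `x₀`; the first segment starts with `z`
and is preceded by `o`. -/
def segs (x₀ : List (Letter k)) : Option (Core k) → List (Letter k × Bool) → List (Tok k) →
    List (Seg k)
  | o, z, [] => [(o, z ++ plain x₀)]
  | o, z, .inl r :: ts => segs x₀ o (z ++ [r]) ts
  | o, z, .inr (x, κ, y) :: ts => (o, z ++ plain x) :: segs x₀ (some κ) (plain y) ts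

theorem exists_segs_eq_cons (x₀ : List (Letter k)) : ∀ (ts : List (Tok k)) (o z), ∃ z' l,
    segs x₀ o z ts = (o, z ++ z') :: l
  | [], o, z => ⟨_, _, rfl⟩
  | .inl r :: ts, o, z => by
    obtain ⟨z', l, h⟩ := exists_segs_eq_cons x₀ ts o (z ++ [r])
    exact ⟨[r] ++ z', l, by rw [segs, h, List.append_assoc]⟩
  | .inr (x, κ, y) :: ts, o, z => ⟨_, _, rfl⟩

theorem cores_segs (x₀ : List (Letter k)) : ∀ (ts : List (Tok k)) (o z),
    cores (segs x₀ o z ts) = o.toList ++ ts.filterMap Tok.core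
  | [], o, z => by cases o <;> rfl
  | .inl r :: ts, o, z => by
    rw [segs, cores_segs x₀ ts]
    rfl
  | .inr (x, κ, y) :: ts, o, z => by
    have h := cores_segs x₀ ts (some κ) (plain y)
    unfold cores at h ⊢
    rw [segs]
    cases o with
    | none => rw [List.filterMap_cons_none rfl, h]; rfl
    | some κ' =>
      rw [List.filterMap_cons_some (f := Prod.fst) (b := κ') rfl, h]
      rfl

theorem flatSegs_segs (x₀ : List (Letter k)) : ∀ (ts : List (Tok k)) (κ : Core k) (z),
    flatSegs (segs x₀ (some κ) z ts) = plain κ.2.1 ++ (z ++ flatToks ts ++ plain x₀)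
  | [], κ, z => by simp [segs, flatSegs, Seg.flat, flatToks]
  | .inl r :: ts, κ, z => by
    rw [segs, flatSegs_segs x₀ ts]
    simp [flatToks, Tok.flat]
  | .inr (x, κ', y) :: ts, κ, z => by
    rw [segs, flatSegs_cons_some, flatSegs_segs x₀ ts]
    simp [flatToks, Tok.flat]

theorem sum_length_segs (x₀ : List (Letter k)) : ∀ (ts : List (Tok k)) (o z),
    ((segs x₀ o z ts).map fun u => u.2.length).sum +
      ((ts.filterMap Tok.core).map fun κ => κ.2.1.length).sum =
      z.length + (flatToks ts).length + x₀.length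
  | [], o, z => by simp [segs, flatToks]
  | .inl r :: ts, o, z => by
    have := sum_length_segs x₀ ts o (z ++ [r])
    rw [segs, List.filterMap_cons_none rfl, this]
    simp [flatToks, Tok.flat, -List.length_flatten]
    omega
  | .inr (x, κ, y) :: ts, o, z => by
    have := sum_length_segs x₀ ts (some κ) (plain y)
    rw [segs, List.filterMap_cons_some (f := Tok.core) (b := κ) rfl, flatToks_cons]
    simp only [List.map_cons, List.sum_cons, List.length_append, length_plain, Tok.flat] at this ⊢
    omega

theorem chain_segs {x₀ : List (Letter k)} {κ₀ : Core k} (hx₀ : x₀.getLast? = some κ₀.1)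
    {w : Seg k} (hw : w.1 = some κ₀) : ∀ (ts : List (Tok k)) (o z), (∀ t ∈ ts, TokOK L t) →
    List.IsChain Link (segs x₀ o z ts ++ [w])
  | [], o, z, _ => by
    simp only [segs, List.singleton_append, List.isChain_pair]
    refine ⟨fun κ hκ => ?_, fun h => by simp [hw] at h⟩
    rw [hw] at hκ
    cases hκ
    simp [hx₀]
  | .inl r :: ts, o, z, h => chain_segs hx₀ hw ts o _ fun t ht => h t (by simp [ht])
  | .inr (x, κ, y) :: ts, o, z, h => by
    have ih := chain_segs hx₀ hw ts (some κ) (plain y) fun t ht => h t (by simp [ht])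
    obtain ⟨z', l, e⟩ := exists_segs_eq_cons x₀ ts (some κ) (plain y)
    have hx := (h _ (by simp) x κ y rfl).2.2.1
    rw [segs]
    rw [e] at ih ⊢
    rw [List.cons_append, List.cons_append, List.isChain_cons_cons]
    refine ⟨⟨fun κ' hκ' => ?_, fun h => by simp at h⟩, ih⟩
    cases hκ'
    simp [hx]

theorem segOK_of_margins {o : Option (Core k)} {x y : List (Letter k)}
    {z : List (Letter k × Bool)} (hx : x.length = 2 * L) (hy : y.length = 2 * L)
    (ho : ∀ κ ∈ o, y.head? = some κ.2.2) (ha : Apart (2 * L) (plain y ++ z ++ plain x))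
    (hr : Red (labels (plain y ++ z ++ plain x))) : SegOK L (o, plain y ++ z ++ plain x) := by
  refine ⟨⟨by simp; omega, ha, fun i hi => ?_⟩, hr, fun κ hκ => ?_⟩
  · have h1 : 2 * L ≤ i := by
      by_contra hlt
      rw [List.append_assoc, marked_append_left (by simp; omega)] at hi
      exact not_marked_plain hi
    refine ⟨h1, ?_⟩
    by_contra hlt
    simp at hlt
    rw [marked_append_right (by simp; omega)] at hi
    exact not_marked_plain hi
  · simp [ho κ hκ]

theorem segOK_segs {x₀ : List (Letter k)} (hx₀ : x₀.length = 2 * L) :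
    ∀ (ts : List (Tok k)) (o : Option (Core k)) (y : List (Letter k)) (z),
    (∀ t ∈ ts, TokOK L t) → y.length = 2 * L → (∀ κ ∈ o, y.head? = some κ.2.2) →
    Apart (2 * L) (plain y ++ z ++ flatToks ts ++ plain x₀) →
    Red (labels (plain y ++ z ++ flatToks ts ++ plain x₀)) →
    ∀ u ∈ segs x₀ o (plain y ++ z) ts, SegOK L u
  | [], o, y, z, _, hy, ho, ha, hr => by
    intro u hu
    rw [segs, List.mem_singleton] at hu
    subst hu
    exact segOK_of_margins hx₀ hy ho (by simpa [flatToks] using ha) (by simpa [flatToks] using hr)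
  | .inl r :: ts, o, y, z, h, hy, ho, ha, hr => by
    have := segOK_segs hx₀ ts o y (z ++ [r]) (fun t ht => h t (by simp [ht])) hy ho
      (by simpa [flatToks, Tok.flat] using ha) (by simpa [flatToks, Tok.flat] using hr)
    rw [segs, List.append_assoc]
    exact this
  | .inr (x, κ, y') :: ts, o, y, z, h, hy, ho, ha, hr => by
    obtain ⟨h1, h2, h3, h4⟩ := h _ (by simp) x κ y' rfl
    have e : plain y ++ z ++ flatToks (.inr (x, κ, y') :: ts) ++ plain x₀ =
        (plain y ++ z ++ plain x) ++ (plain κ.2.1 ++ (plain y' ++ [] ++ flatToks ts ++ plain x₀)) := by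
      simp [flatToks, Tok.flat]
    rw [e] at ha hr
    rw [labels_append, labels_append (plain κ.2.1)] at hr
    intro u hu
    rw [segs, List.mem_cons] at hu
    rcases hu with rfl | hu
    · exact segOK_of_margins h1 hy ho ha.of_append_left (List.isChain_append.1 hr).1
    · refine segOK_segs hx₀ ts (some κ) y' [] (fun t ht => h t (by simp [ht])) h2
        (fun κ' hκ' => by cases hκ'; exact h4) ha.of_append_right.of_append_right
        (List.isChain_append.1 (List.isChain_append.1 hr).2.1).2.1 u (by simpa using hu)

theorem CycRed.red_append {p q : List (Letter k)} (h : CycRed (p ++ q)) : Red (p ++ q ++ p) := by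
  obtain ⟨a, b, h, hab⟩ := h
  refine List.isChain_append.2 ⟨h.red, (List.isChain_append.1 h.red).1, fun u hu v hv => ?_⟩
  have h1 := h.head
  have h2 := h.last
  rw [List.head?_append, Option.mem_def.1 hv] at h1
  rw [Option.mem_def.1 hu] at h2
  cases h1
  cases h2
  rw [Letter.inv_inv]
  exact hab

theorem Apart.append_plain {d : ℕ} {a : List (Letter k × Bool)} (h : Apart d a)
    (w : List (Letter k)) : Apart d (a ++ plain w) := by
  have : ∀ i, Marked (a ++ plain w) i → Marked a i := by
    intro i hi
    by_cases h' : i < a.length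
    · exact (marked_append_left h').1 hi
    · rw [marked_append_right (by omega)] at hi
      exact absurd hi not_marked_plain
  exact fun i j hij hi hj => h i j hij (this i hi) (this j hj)

/-- A cyclic list of tokens, at least one of which is a core, as a cyclic list of segments. -/
theorem exists_loop_of_tokens {ts : List (Tok k)} (hts : ∀ t ∈ ts, TokOK L t)
    (hne : ts.filterMap Tok.core ≠ []) (hcr : CycRed (labels (flatToks ts)))
    (ha : ∀ a b, flatToks ts = a ++ b → Apart (2 * L) (b ++ a)) :
    ∃ l, LoopOK L l ∧ (cores l).Perm (ts.filterMap Tok.core) ∧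
      (l.map fun u => u.2.length).sum +
        ((ts.filterMap Tok.core).map fun κ => κ.2.1.length).sum = (flatToks ts).length ∧
      hom (labels (flatSegs l)) = hom (labels (flatToks ts)) ∧
      ∀ M, Good L (flatSegs l ::ₘ M) → Good L (flatToks ts ::ₘ M) := by
  -- The loop is rotated to begin at some core. The margin `x` before this core then becomes the end
  -- of the last segment.
  obtain ⟨κ, hκ⟩ := List.exists_mem_of_ne_nil _ hne
  obtain ⟨t, ht, htκ⟩ := List.mem_filterMap.1 hκ
  obtain ⟨A, B, rfl⟩ := List.append_of_mem ht
  rcases t with r | ⟨x, κ', y⟩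
  · simp [Tok.core] at htκ
  obtain rfl : κ' = κ := by simpa [Tok.core] using htκ
  obtain ⟨h1, h2, h3, h4⟩ := hts _ (by simp) x κ' y rfl
  have hok : ∀ t ∈ B ++ A, TokOK L t := fun t ht => hts t (by simp at ht ⊢; tauto)
  have eF : flatToks (A ++ .inr (x, κ', y) :: B) =
      flatToks A ++ (plain x ++ (plain κ'.2.1 ++ plain y ++ flatToks B)) := by
    simp [flatToks, Tok.flat]
  have hap := ((ha _ _ eF).append_plain x)
  rw [eF, labels_append] at hcr
  have hcr' := hcr.rot
  rw [labels_append, labels_plain, List.append_assoc] at hcr'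
  -- Repeating `x` at the end makes the last segment, which ends with `x`, a subword of a reduced
  -- word.
  have hred := hcr'.red_append
  set l := segs x (some κ') (plain y) (B ++ A) with hl
  have eS : flatSegs l = plain κ'.2.1 ++ (plain y ++ (flatToks B ++ flatToks A) ++ plain x) := by
    rw [hl, flatSegs_segs, flatToks_append]
  have e1 : plain x ++ (plain κ'.2.1 ++ plain y ++ flatToks B) ++ flatToks A ++ plain x =
      (plain x ++ plain κ'.2.1) ++ (plain y ++ [] ++ flatToks (B ++ A) ++ plain x) := by
    simp [flatToks_append]
  have hcores : cores l = κ' :: (B ++ A).filterMap Tok.core := by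
    rw [hl, cores_segs]
    rfl
  have hperm : (κ' :: (B ++ A).filterMap Tok.core).Perm
      ((A ++ .inr (x, κ', y) :: B).filterMap Tok.core) := by
    have : (κ' :: (B ++ A).filterMap Tok.core) =
        ((.inr (x, κ', y) :: B) ++ A).filterMap Tok.core := rfl
    rw [this]
    exact List.perm_append_comm.filterMap _
  refine ⟨l, ⟨?_, ?_, ?_⟩, ?_, ?_, ?_, fun M hM => ?_⟩
  · obtain ⟨z', l', e⟩ := exists_segs_eq_cons x (B ++ A) (some κ') (plain y)
    rw [hl, e]
    simp
  · have := segOK_segs h1 (B ++ A) (some κ') y [] hok h2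
      (fun κ hκ => by cases hκ; exact h4)
    rw [List.append_nil] at this
    refine this ?_ ?_
    · rw [e1] at hap
      simpa using hap.of_append_right
    · have e2 : x ++ (labels (plain κ'.2.1 ++ plain y ++ flatToks B) ++ labels (flatToks A)) ++ x =
          (x ++ κ'.2.1) ++ labels (plain y ++ flatToks (B ++ A) ++ plain x) := by
        simp [flatToks_append]
      rw [e2] at hred
      exact (List.isChain_append.1 hred).2.1
  · obtain ⟨z', l', e⟩ := exists_segs_eq_cons x (B ++ A) (some κ') (plain y)
    have := chain_segs (L := L) h3 (w := (some κ', plain y ++ z')) rfl (B ++ A) (some κ') (plain y) hok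
    rw [hl, e, Cycle.chain_coe_cons]
    rw [e] at this
    exact this
  · rw [hcores]
    exact hperm
  · have h5 := sum_length_segs x (B ++ A) (some κ') (plain y)
    have h6 := (hperm.map fun κ => κ.2.1.length).sum_eq
    rw [eF]
    simp only [List.map_cons, List.sum_cons, List.length_append, length_plain, flatToks_append,
      ← hl] at h5 h6 ⊢
    omega
  · rw [eS, eF]
    simp
    abel
  · rw [eF]
    refine .rot _ _ _ ?_
    have e3 : plain x ++ (plain κ'.2.1 ++ plain y ++ flatToks B) ++ flatToks A =
        plain x ++ (plain κ'.2.1 ++ plain y ++ flatToks B ++ flatToks A) := by simp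
    rw [e3]
    refine .rot _ _ _ ?_
    convert hM using 2
    rw [eS]
    simp

end Tokens

end ThinFatgraph

namespace ThinFatgraph

/-! ### Blocks with two candidate cores each -/

section Blocks

variable {k L : ℕ}

/-- The core that is represented by a word: its first letter, the middle part, its last letter. -/
def coreOf (d : Letter k) (v : List (Letter k)) : Core k := (v.headD d, v.tail.dropLast, v.getLastD d)

theorem word_coreOf (d : Letter k) {v : List (Letter k)} (h : 2 ≤ v.length) :
    (coreOf d v).word = v := by
  rcases v with _ | ⟨a, v⟩
  · simp at h
  · rcases List.eq_nil_or_concat v with rfl | ⟨c, b, rfl⟩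
    · simp at h
    · have : (a :: (c ++ [b])).getLast? = some b := by
        rw [← List.cons_append, List.getLast?_append]
        rfl
      simp [coreOf, Core.word, this]

theorem length_coreOf (d : Letter k) (v : List (Letter k)) :
    (coreOf d v).2.1.length = v.length - 2 := by
  simp [coreOf]
  omega

theorem coreOf_word (d : Letter k) (κ : Core k) : coreOf d κ.word = κ := by
  obtain ⟨a, c, b⟩ := κ
  have : (a :: (c ++ [b])).getLast? = some b := by
    rw [← List.cons_append, List.getLast?_append]
    rfl
  simp [coreOf, Core.word, this]

/-- The tokens of half a block. -/
def chunkToks (d : Letter k) (L n : ℕ) (g : List (Letter k × Bool)) (b : Prop) [Decidable b] :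
    List (Tok k) :=
  if b then [.inr ((labels g).take (2 * L),
    coreOf d (((labels g).drop (2 * L - 1)).take (n + 2)), (labels g).drop (2 * L + n))]
  else g.map .inl

theorem flatToks_map_inl (g : List (Letter k × Bool)) : flatToks (g.map .inl) = g := by
  induction g with
  | nil => rfl
  | cons r g ih => rw [List.map_cons, flatToks_cons, ih]; rfl

theorem filterMap_core_map_inl (g : List (Letter k × Bool)) :
    ((g.map .inl : List (Tok k)).filterMap Tok.core) = [] := by
  induction g with
  | nil => rfl
  | cons r g ih => rw [List.map_cons, List.filterMap_cons_none rfl, ih]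

theorem plain_labels {g : List (Letter k × Bool)} (h : ∀ i, ¬ Marked g i) :
    plain (labels g) = g := by
  rw [plain, labels, List.map_map]
  conv_rhs => rw [← List.map_id g]
  refine List.map_congr_left fun r hr => ?_
  obtain ⟨i, hi, rfl⟩ := List.getElem_of_mem hr
  rcases hg : g[i] with ⟨x, _ | _⟩
  · rfl
  · exact absurd ⟨x, by rw [List.getElem?_eq_getElem hi, hg]⟩ (h i)

theorem exists_chunk_decomp (hL : 0 < L) {n : ℕ} {w : List (Letter k)}
    (hw : w.length = 4 * L + n) : ∃ (x' c y' : List (Letter k)) (a b : Letter k),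
      x'.length = 2 * L - 1 ∧ c.length = n ∧ y'.length = 2 * L - 1 ∧
      w = (x' ++ [a]) ++ (c ++ (b :: y')) := by
  have e1 := List.take_append_drop (2 * L) w
  have e2 := List.take_append_drop n (w.drop (2 * L))
  have l1 : (w.take (2 * L)).length = 2 * L := by simp; omega
  have l2 : ((w.drop (2 * L)).take n).length = n := by simp; omega
  have l3 : ((w.drop (2 * L)).drop n).length = 2 * L := by simp; omega
  obtain ⟨x', a, hx⟩ : ∃ x' a, w.take (2 * L) = x' ++ [a] := by
    rcases List.eq_nil_or_concat (w.take (2 * L)) with h | ⟨x', a, h⟩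
    · rw [h] at l1
      simp at l1
      omega
    · exact ⟨x', a, by simpa using h⟩
  obtain ⟨b, y', hy⟩ := List.exists_cons_of_ne_nil (l := (w.drop (2 * L)).drop n) (by
    intro h
    rw [h] at l3
    simp at l3
    omega)
  refine ⟨x', (w.drop (2 * L)).take n, y', a, b, ?_, l2, ?_, ?_⟩
  · rw [hx] at l1
    simp at l1
    omega
  · rw [hy] at l3
    simp at l3
    omega
  · rw [← hx, ← hy, e2, e1]

/-- Half a block consists of a margin of length `2 * L`, a core of length `n` and another such
margin. The window that defines the core starts at `2 * L - 1` and has length `n + 2`, because it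
includes the two adjacent letters. -/
theorem chunkToks_spec (hL : 0 < L) (d : Letter k) {n : ℕ} {g : List (Letter k × Bool)}
    (hg : g.length = 4 * L + n) (b : Prop) [Decidable b] (hb : b → ∀ i, ¬ Marked g i) :
    flatToks (chunkToks d L n g b) = g ∧ (∀ t ∈ chunkToks d L n g b, TokOK L t) ∧
      (chunkToks d L n g b).filterMap Tok.core =
        if b then [coreOf d (((labels g).drop (2 * L - 1)).take (n + 2))] else [] := by
  by_cases h : b
  · obtain ⟨x', c, y', a, e, h1, h2, h3, h4⟩ := exists_chunk_decomp hL (w := labels g)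
      (by rwa [length_labels])
    have hx : (x' ++ [a]).length = 2 * L := by simp; omega
    have t1 : (labels g).take (2 * L) = x' ++ [a] := by rw [h4, List.take_left' hx]
    have t2 : (labels g).drop (2 * L + n) = e :: y' := by
      rw [← List.drop_drop, h4, List.drop_left' hx, List.drop_left' h2]
    have t3 : ((labels g).drop (2 * L - 1)).take (n + 2) = a :: (c ++ [e]) := by
      rw [h4, List.append_assoc, List.drop_left' h1]
      have : [a] ++ (c ++ e :: y') = (a :: (c ++ [e])) ++ y' := by simp
      rw [this, List.take_left' (by simp; omega)]
    have t4 : coreOf d (a :: (c ++ [e])) = (a, c, e) := coreOf_word d (a, c, e)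
    simp only [chunkToks, if_pos h, t1, t2, t3, t4]
    refine ⟨?_, ?_, rfl⟩
    · simp only [flatToks, List.map_cons, List.map_nil, Tok.flat, List.flatten_cons,
        List.flatten_nil, List.append_nil, ← plain_append]
      rw [List.append_assoc, ← h4]
      exact plain_labels (hb h)
    · intro t ht x κ y e'
      rw [List.mem_singleton] at ht
      subst ht
      cases e'
      exact ⟨hx, by simp; omega, by simp, by simp⟩
  · simp only [chunkToks, if_neg h]
    refine ⟨flatToks_map_inl g, ?_, filterMap_core_map_inl g⟩
    intro t ht x κ y e'
    obtain ⟨r, -, rfl⟩ := List.mem_map.1 ht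
    cases e'

theorem window_eq (F : List (Letter k × Bool)) {a h b p : ℕ} (hbp : b + p ≤ h) :
    ((labels ((F.drop a).take h)).drop b).take p = ((labels F).drop (a + b)).take p := by
  rw [labels, List.map_take, List.map_drop, List.drop_take, List.take_take, List.drop_drop,
    min_eq_left (by omega)]
  rfl

/-- The tokens of a block of length `T`. -/
def blockToks (d : Letter k) (L n T : ℕ) (F : List (Letter k × Bool)) (A A' : Finset ℕ) (i : ℕ) :
    List (Tok k) :=
  chunkToks d L n ((F.drop (i * T)).take (4 * L + n)) (i ∈ A) ++
    (chunkToks d L n ((F.drop (i * T + (4 * L + n))).take (4 * L + n)) (i ∈ A') ++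
      ((F.drop (i * T + 2 * (4 * L + n))).take (T - 2 * (4 * L + n))).map .inl)

theorem blockToks_spec (hL : 0 < L) (d : Letter k) {n T : ℕ} (hT : 2 * (4 * L + n) ≤ T)
    {F : List (Letter k × Bool)} {A A' : Finset ℕ} {i : ℕ} (hi : (i + 1) * T ≤ F.length)
    (hc : i ∈ A ∪ A' → ∀ j < T, ¬ Marked F (i * T + j)) :
    flatToks (blockToks d L n T F A A' i) = (F.drop (i * T)).take T ∧
      (∀ t ∈ blockToks d L n T F A A' i, TokOK L t) ∧
      (blockToks d L n T F A A' i).filterMap Tok.core =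
        (if i ∈ A then [coreOf d (((labels F).drop (i * T + (2 * L - 1))).take (n + 2))] else []) ++
        (if i ∈ A' then [coreOf d (((labels F).drop
          (i * T + (4 * L + n) + (2 * L - 1))).take (n + 2))] else []) := by
  rw [Nat.add_mul, one_mul] at hi
  have hm : ∀ {a : ℕ}, i ∈ A ∪ A' → a + (4 * L + n) ≤ T →
      ∀ j, ¬ Marked ((F.drop (i * T + a)).take (4 * L + n)) j := by
    intro a hA ha j hj
    have hlt := hj.lt
    rw [List.length_take] at hlt
    refine hc hA (a + j) (by omega) ?_
    obtain ⟨x, hx⟩ := hj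
    rw [List.getElem?_take_of_lt (by omega), List.getElem?_drop] at hx
    exact ⟨x, by rwa [← add_assoc]⟩
  obtain ⟨p1, p2, p3⟩ := chunkToks_spec hL d (n := n) (g := (F.drop (i * T)).take (4 * L + n))
    (by rw [List.length_take, List.length_drop]; omega) (i ∈ A) fun h => by
      have := hm (a := 0) (Finset.mem_union_left _ h) (by omega)
      rwa [add_zero] at this
  obtain ⟨q1, q2, q3⟩ := chunkToks_spec hL d (n := n)
    (g := (F.drop (i * T + (4 * L + n))).take (4 * L + n))
    (by rw [List.length_take, List.length_drop]; omega) (i ∈ A') fun h => hm (Finset.mem_union_right _ h) (by omega)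
  rw [window_eq F (show 2 * L - 1 + (n + 2) ≤ 4 * L + n by omega)] at p3 q3
  unfold blockToks
  refine ⟨?_, fun t ht => ?_, ?_⟩
  · rw [flatToks_append, flatToks_append, p1, q1, flatToks_map_inl]
    generalize 4 * L + n = h at hT
    have e : T = h + (h + (T - 2 * h)) := by omega
    have e' : i * T + 2 * h = i * T + h + h := by omega
    rw [e', ← List.drop_drop, ← List.drop_drop, ← List.drop_drop, ← List.take_add,
      ← List.take_add, ← e]
  · rcases List.mem_append.1 ht with ht | ht
    · exact p2 t ht
    · rcases List.mem_append.1 ht with ht | ht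
      · exact q2 t ht
      · intro x κ y e'
        obtain ⟨r, -, rfl⟩ := List.mem_map.1 ht
        cases e'
  · rw [List.filterMap_append, List.filterMap_append, p3, q3, filterMap_core_map_inl,
      List.append_nil]

theorem blocks_spec (hL : 0 < L) (d : Letter k) {n T : ℕ} (hT : 2 * (4 * L + n) ≤ T)
    {F : List (Letter k × Bool)} {A A' : Finset ℕ} : ∀ (N : ℕ), N * T ≤ F.length →
    (∀ i ∈ A ∪ A', ∀ j < T, ¬ Marked F (i * T + j)) → ∃ ts : List (Tok k),
      flatToks ts = F.take (N * T) ∧ (∀ t ∈ ts, TokOK L t) ∧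
      (ts.filterMap Tok.core : Multiset (Core k)) =
        ∑ i ∈ Finset.range N, ((if i ∈ A then
          {coreOf d (((labels F).drop (i * T + (2 * L - 1))).take (n + 2))} else 0) +
          if i ∈ A' then
          {coreOf d (((labels F).drop (i * T + (4 * L + n) + (2 * L - 1))).take (n + 2))} else 0)
  | 0, _, _ => ⟨[], by simp [flatToks], by simp, by simp⟩
  | N + 1, hN, hc => by
    obtain ⟨ts, h1, h2, h3⟩ := blocks_spec hL d hT (A := A) (A' := A') N
      (by rw [Nat.add_mul] at hN; omega) hc
    obtain ⟨p1, p2, p3⟩ := blockToks_spec hL d hT (A := A) (A' := A') hN (hc N)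
    refine ⟨ts ++ blockToks d L n T F A A' N, ?_, fun t ht => ?_, ?_⟩
    · rw [flatToks_append, h1, p1, Nat.add_mul, one_mul, List.take_add]
    · rcases List.mem_append.1 ht with ht | ht
      · exact h2 t ht
      · exact p2 t ht
    · rw [List.filterMap_append, ← Multiset.coe_add, h3, Finset.sum_range_succ, p3]
      congr 1
      split_ifs <;> rfl

theorem sum_ite_mem_singleton {β : Type*} {N : ℕ} {A : Finset ℕ} (hA : A ⊆ Finset.range N)
    (f : ℕ → β) : (∑ i ∈ Finset.range N, if i ∈ A then ({f i} : Multiset β) else 0) =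
      A.val.map f := by
  rw [Finset.sum_ite_mem, Finset.inter_eq_right.2 hA, Finset.sum]
  have := Multiset.sum_map_singleton (A.val.map f)
  rwa [Multiset.map_map] at this

/-- Cut a loop at the cores of the first halves of the blocks in `A` and of the second halves of the
blocks in `A'`. -/
theorem exists_loop_of_blocks (hL : 0 < L) (d : Letter k) {n T N : ℕ} (hT : 2 * (4 * L + n) ≤ T)
    {F : List (Letter k × Bool)} {A A' : Finset ℕ} (hN : N * T ≤ F.length)
    (hA : A ⊆ Finset.range N) (hA' : A' ⊆ Finset.range N) (hne : A.Nonempty)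
    (hc : ∀ i ∈ A ∪ A', ∀ j < T, ¬ Marked F (i * T + j)) (hcr : CycRed (labels F))
    (ha : ∀ a b, F = a ++ b → Apart (2 * L) (b ++ a)) :
    ∃ l, LoopOK L l ∧ (cores l : Multiset (Core k)) =
        A.val.map (fun i => coreOf d (((labels F).drop (i * T + (2 * L - 1))).take (n + 2))) +
        A'.val.map (fun i => coreOf d (((labels F).drop
          (i * T + (4 * L + n) + (2 * L - 1))).take (n + 2))) ∧
      (l.map fun u => u.2.length).sum + n * (A.card + A'.card) = F.length ∧
      hom (labels (flatSegs l)) = hom (labels F) ∧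
      ∀ M, Good L (flatSegs l ::ₘ M) → Good L (F ::ₘ M) := by
  obtain ⟨ts, h1, h2, h3⟩ := blocks_spec hL d hT (A := A) (A' := A') N hN hc
  rw [Finset.sum_add_distrib, sum_ite_mem_singleton hA, sum_ite_mem_singleton hA'] at h3
  set ts' := ts ++ (F.drop (N * T)).map Sum.inl with hts'
  have e : flatToks ts' = F := by
    rw [hts', flatToks_append, h1, flatToks_map_inl, List.take_append_drop]
  have hf : ts'.filterMap Tok.core = ts.filterMap Tok.core := by
    rw [hts', List.filterMap_append, filterMap_core_map_inl, List.append_nil]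
  obtain ⟨l, l1, l2, l3, l4, l5⟩ := exists_loop_of_tokens (L := L) (ts := ts') (by
      intro t ht
      rcases List.mem_append.1 ht with ht | ht
      · exact h2 t ht
      · intro x κ y e'
        obtain ⟨r, -, rfl⟩ := List.mem_map.1 ht
        cases e') (by
      intro h0
      rw [hf] at h0
      rw [h0] at h3
      have := congrArg Multiset.card h3
      have hA0 := Finset.card_pos.2 hne
      simp at this
      omega) (by rwa [e]) (by rwa [e])
  rw [e] at l3 l4 l5
  rw [hf] at l2 l3
  refine ⟨l, l1, (Multiset.coe_eq_coe.2 l2).trans h3, ?_, l4, l5⟩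
  rw [← l3]
  congr 1
  have hlen : ∀ i ∈ A ∪ A', ∀ a, a + (n + 2) ≤ T →
      (coreOf d (((labels F).drop (i * T + a)).take (n + 2))).2.1.length = n := by
    intro i hi a ha
    have : (i + 1) * T ≤ N * T := Nat.mul_le_mul_right _ (by
      have := Finset.mem_range.1 ((Finset.union_subset hA hA') hi)
      omega)
    rw [Nat.add_mul, one_mul] at this
    rw [length_coreOf, List.length_take, List.length_drop, length_labels]
    omega
  have h4 := congrArg (fun X : Multiset (Core k) => (X.map fun κ => κ.2.1.length).sum) h3
  simp only [Multiset.map_add, Multiset.sum_add, Multiset.map_coe, Multiset.sum_coe,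
    Multiset.map_map, Function.comp_def] at h4
  have h5 := Multiset.map_congr (s := A.val) rfl
    (fun i hi => hlen i (Finset.mem_union_left _ hi) (2 * L - 1) (by omega))
  have h6 : A'.val.map (fun i => (coreOf d (((labels F).drop
      (i * T + (4 * L + n) + (2 * L - 1))).take (n + 2))).2.1.length) = A'.val.map fun _ => n :=
    Multiset.map_congr rfl fun i hi => by
      rw [add_assoc]
      exact hlen i (Finset.mem_union_right _ hi) _ (by omega)
  rw [h4, h5, h6]
  simp
  ring

end Blocks

end ThinFatgraph

namespace ThinFatgraph

/-! ### Tagged loops as marked lists -/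

namespace TaggedLoop

variable {k L : ℕ} (γ : TaggedLoop k)

theorem length_toList : γ.toList.length = γ.length := by
  simp [toList]

theorem labels_toList :
    labels γ.toList = (List.range γ.length).map fun j : ℕ => γ.letter (j : ZMod γ.length) := by
  rw [labels, toList, List.map_map]
  rfl

theorem marked_toList {i : ℕ} :
    Marked γ.toList i ↔ i < γ.length ∧ γ.tag (i : ZMod γ.length) ≠ none := by
  constructor
  · rintro ⟨x, hx⟩
    have hi : i < γ.length := by
      have := (List.getElem?_eq_some_iff.1 hx).1
      rwa [length_toList] at this
    refine ⟨hi, fun h => ?_⟩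
    simp [toList, List.getElem?_range hi, h] at hx
  · rintro ⟨hi, h⟩
    refine ⟨γ.letter i, ?_⟩
    simp [toList, List.getElem?_range hi, Option.isSome_iff_ne_none, h]

theorem cycRed_toList : CycRed (labels γ.toList) := by
  have hpos := γ.length_pos
  have hr : Red (labels γ.toList) := by
    rw [labels_toList, Red, List.isChain_iff_getElem]
    intro i hi
    have := γ.reduced (i : ZMod γ.length)
    simpa using this
  have e : (γ.length - 1 : ℕ) + 1 = γ.length := by omega
  refine ⟨γ.letter 0, (γ.letter ((γ.length - 1 : ℕ) : ZMod γ.length)).inv, ⟨?_, ?_, hr⟩, ?_⟩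
  · rw [labels_toList, List.head?_map, List.head?_range]
    simp [hpos.ne']
  · rw [labels_toList, List.getLast?_map, List.getLast?_range]
    simp [hpos.ne']
  · have := γ.reduced ((γ.length - 1 : ℕ) : ZMod γ.length)
    have h0 : ((γ.length - 1 : ℕ) : ZMod γ.length) + 1 = 0 := by
      have h1 : (((γ.length - 1) + 1 : ℕ) : ZMod γ.length) = 0 := by rw [e, ZMod.natCast_self]
      simpa using h1
    rwa [h0] at this

variable {γ} in
theorem TagsSeparated.apart {r : ℕ} (h : γ.TagsSeparated r) {a b : List (Letter k × Bool)}
    (hab : γ.toList = a ++ b) : Apart r (b ++ a) := by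
  have hlen : γ.length = a.length + b.length := by
    rw [← length_toList, hab, List.length_append]
  have key : ∀ i, Marked (b ++ a) i →
      i < γ.length ∧ γ.tag ((a.length + i : ℕ) : ZMod γ.length) ≠ none := by
    intro i hi
    have hlt := hi.lt
    rw [List.length_append] at hlt
    refine ⟨by omega, ?_⟩
    by_cases hb : i < b.length
    · rw [marked_append_left hb] at hi
      have : Marked (a ++ b) (a.length + i) := by
        rw [marked_append_right (by omega)]
        simpa using hi
      rw [← hab, marked_toList] at this
      exact this.2
    · rw [marked_append_right (by omega)] at hi
      have : Marked (a ++ b) (i - b.length) := (marked_append_left hi.lt).2 hi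
      rw [← hab, marked_toList] at this
      have e : a.length + i = γ.length + (i - b.length) := by omega
      rw [e, Nat.cast_add, ZMod.natCast_self, zero_add]
      exact this.2
  intro i j hij hi hj
  obtain ⟨h1, h2⟩ := key i hi
  obtain ⟨h3, h4⟩ := key j hj
  have e : ((a.length + j : ℕ) : ZMod γ.length) - ((a.length + i : ℕ) : ZMod γ.length) =
      ((j - i : ℕ) : ZMod γ.length) := by
    rw [sub_eq_iff_eq_add, ← Nat.cast_add]
    congr 1
    omega
  have hv : ((j - i : ℕ) : ZMod γ.length).val = j - i := ZMod.val_cast_of_lt (by omega)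
  have := h _ _ h2 h4 (fun he => by
    rw [he, sub_self] at e
    rw [← e, ZMod.val_zero] at hv
    omega)
  rwa [e, hv] at this

theorem sum_range_length {A : Type*} [AddCommMonoid A] [NeZero γ.length]
    (f : ZMod γ.length → A) :
    ∑ j ∈ Finset.range γ.length, f (j : ZMod γ.length) = ∑ i, f i := by
  refine Finset.sum_nbij' (fun j => (j : ZMod γ.length)) ZMod.val ?_ ?_ ?_ ?_ ?_
  · simp
  · intro i _
    simpa using ZMod.val_lt i
  · intro j hj
    exact ZMod.val_cast_of_lt (by simpa using hj)
  · intro i _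
    exact ZMod.natCast_zmod_val i
  · simp

theorem hom_toList : hom (labels γ.toList) = γ.homologyClass := by
  have : NeZero γ.length := ⟨γ.length_pos.ne'⟩
  have h1 : hom (labels γ.toList) = ∑ i : ZMod γ.length,
      Pi.single (γ.letter i).1 (if (γ.letter i).2 then (1 : ℤ) else -1) := by
    rw [← sum_range_length, labels_toList, hom, List.map_map, Finset.sum_range]
    rw [← List.sum_ofFn]
    congr 1
    refine List.ext_getElem (by simp) fun i h h' => by simp
  classical
  funext g
  rw [h1, homologyClass, Set.ncard_eq_toFinset_card', Set.ncard_eq_toFinset_card',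
    Finset.sum_apply]
  simp only [Set.toFinset_ofPred, Finset.card_filter, Nat.cast_sum]
  rw [← Finset.sum_sub_distrib]
  refine Finset.sum_congr rfl fun i _ => ?_
  rcases γ.letter i with ⟨g', b⟩
  by_cases hg : g' = g
  · subst hg
    cases b <;> simp
  · cases b <;> simp [hg, Ne.symm hg]

theorem block_eq {T i : ℕ} (hi : (i + 1) * T ≤ γ.length) :
    ((labels γ.toList).drop (i * T)).take T = List.ofFn (γ.block T 0 i) := by
  rw [Nat.add_mul, one_mul] at hi
  rw [labels_toList]
  refine List.ext_getElem (by simp; omega) fun j h h' => ?_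
  simp [block]

open Classical in
-- Choosing one mark in each block that has marks is injective, because a position determines its
-- block by division.
theorem card_marked_blocks {T N : ℕ} :
    ((Finset.range N).filter fun i => ∃ j < T, Marked γ.toList (i * T + j)).card ≤
      ({i | γ.tag i ≠ none} : Set (ZMod γ.length)).ncard := by
  have : NeZero γ.length := ⟨γ.length_pos.ne'⟩
  rw [Set.ncard_eq_toFinset_card']
  have key : ∀ i, ∃ j, i ∈ (Finset.range N).filter
      (fun i => ∃ j < T, Marked γ.toList (i * T + j)) → j < T ∧ Marked γ.toList (i * T + j) := by
    intro i
    by_cases hi : i ∈ (Finset.range N).filter fun i => ∃ j < T, Marked γ.toList (i * T + j)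
    · obtain ⟨j, hj⟩ := (Finset.mem_filter.1 hi).2
      exact ⟨j, fun _ => hj⟩
    · exact ⟨0, fun h => absurd h hi⟩
  choose j hj using key
  refine Finset.card_le_card_of_injOn (fun i => ((i * T + j i : ℕ) : ZMod γ.length))
    (fun i hi => ?_) fun i hi i' hi' e => ?_
  · simpa using (γ.marked_toList.1 (hj i hi).2).2
  · have h1 := (hj i hi).1
    have h2 := (hj i' hi').1
    have h3 := (γ.marked_toList.1 (hj i hi).2).1
    have h4 := (γ.marked_toList.1 (hj i' hi').2).1
    have h5 := congrArg ZMod.val e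
    simp only at h5
    rw [ZMod.val_cast_of_lt h3, ZMod.val_cast_of_lt h4] at h5
    have h6 : (i * T + j i) / T = i := by
      rw [mul_comm, Nat.mul_add_div (by omega), Nat.div_eq_of_lt h1, add_zero]
    have h7 : (i' * T + j i') / T = i' := by
      rw [mul_comm, Nat.mul_add_div (by omega), Nat.div_eq_of_lt h2, add_zero]
    rw [← h6, ← h7, h5]

end TaggedLoop

end ThinFatgraph

namespace ThinFatgraph

/-! ### Frequencies of words and the matching of cores -/

section Counting

variable {k : ℕ}

/-- The words of given length that may follow a given letter in a reduced word. -/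
def exts : ℕ → Letter k → Finset (List (Letter k))
  | 0, _ => {[]}
  | p + 1, a => (Finset.univ.filter (· ≠ a.inv)).biUnion fun b => (exts p b).image (List.cons b)

theorem card_biUnion_cons (S : Finset (Letter k)) (E : Letter k → Finset (List (Letter k)))
    {c : ℕ} (hc : ∀ b, (E b).card = c) :
    (S.biUnion fun b => (E b).image (List.cons b)).card = S.card * c := by
  rw [Finset.card_biUnion]
  · rw [Finset.sum_congr rfl fun b _ => by
      rw [Finset.card_image_of_injective _ (List.cons_injective), hc b]]
    simp
  · intro b _ b' _ hbb'
    rw [Function.onFun, Finset.disjoint_left]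
    intro w hw hw'
    obtain ⟨v, -, rfl⟩ := Finset.mem_image.1 hw
    obtain ⟨v', -, h⟩ := Finset.mem_image.1 hw'
    exact hbb' (by simpa using (List.cons.inj h).1.symm)

theorem card_exts : ∀ (p : ℕ) (a : Letter k), (exts p a).card = (2 * k - 1) ^ p
  | 0, a => by simp [exts]
  | p + 1, a => by
    rw [exts, card_biUnion_cons _ _ (card_exts p), Finset.filter_ne', Finset.card_erase_of_mem
      (Finset.mem_univ _), pow_succ, mul_comm]
    simp [mul_comm]

theorem mem_exts : ∀ {p : ℕ} {a : Letter k} {w : List (Letter k)}, w ∈ exts p a →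
    w.length = p ∧ Red (a :: w)
  | 0, a, w, h => by
    obtain rfl : w = [] := by simpa [exts] using h
    exact ⟨rfl, List.isChain_singleton a⟩
  | p + 1, a, w, h => by
    obtain ⟨b, hb, hw⟩ := Finset.mem_biUnion.1 h
    obtain ⟨v, hv, rfl⟩ := Finset.mem_image.1 hw
    obtain ⟨h1, h2⟩ := mem_exts hv
    exact ⟨by simp [h1], List.isChain_cons_cons.2 ⟨by simpa using hb, h2⟩⟩

/-- Reduced words of length `p + 1`. -/
def redWords (k p : ℕ) : Finset (List (Letter k)) :=
  Finset.univ.biUnion fun b => (exts p b).image (List.cons b)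

theorem card_redWords (p : ℕ) : (redWords k p).card = 2 * k * (2 * k - 1) ^ p := by
  rw [redWords, card_biUnion_cons _ _ (card_exts p)]
  simp [mul_comm]

theorem mem_redWords {p : ℕ} {w : List (Letter k)} (h : w ∈ redWords k p) :
    w.length = p + 1 ∧ Red w := by
  obtain ⟨b, -, hw⟩ := Finset.mem_biUnion.1 h
  obtain ⟨v, hv, rfl⟩ := Finset.mem_image.1 hw
  obtain ⟨h1, h2⟩ := mem_exts hv
  exact ⟨by simp [h1], h2⟩

theorem red_wordInv {w : List (Letter k)} (h : Red w) : Red (wordInv w) := by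
  by_cases hw : w = []
  · subst hw
    exact h
  · obtain ⟨a, b, hp⟩ := Path.exists_of_red h hw
    exact hp.inv.red

/-- The reduced words of length `T` that contain `v` at the place `o`. -/
theorem exists_extensions {v : List (Letter k)} (hv : Red v) (hne : v ≠ []) {o T : ℕ}
    (hT : o + v.length ≤ T) : ∃ E : Finset (List (Letter k)),
      E.card = (2 * k - 1) ^ (T - v.length) ∧
      ∀ w ∈ E, w.length = T ∧ Red w ∧ (w.drop o).take v.length = v := by
  obtain ⟨a, b, hp⟩ := Path.exists_of_red hv hne
  -- A word can be put in front of `v` exactly if its inverse can follow `a.inv`; so extensions to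
  -- the left are inverses of extensions to the right.
  refine ⟨(exts o a.inv ×ˢ exts (T - o - v.length) b.inv).image
    fun p => wordInv p.1 ++ (v ++ p.2), ?_, fun w hw => ?_⟩
  · rw [Finset.card_image_of_injOn, Finset.card_product, card_exts, card_exts, ← pow_add]
    · congr 1
      omega
    · rintro ⟨u, w⟩ h ⟨u', w'⟩ h' e
      simp only [Finset.coe_product, Set.mem_prod, Finset.mem_coe] at h h'
      have l1 := (mem_exts h.1).1
      have l2 := (mem_exts h'.1).1
      obtain ⟨e1, e2⟩ := List.append_inj e (by simp [l1, l2])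
      simp only at e1 e2
      rw [← wordInv_wordInv u, e1, wordInv_wordInv, List.append_cancel_left e2]
  · obtain ⟨⟨u, w⟩, h, rfl⟩ := Finset.mem_image.1 hw
    rw [Finset.mem_product] at h
    obtain ⟨l1, r1⟩ := mem_exts h.1
    obtain ⟨l2, r2⟩ := mem_exts h.2
    simp only at l1 r1 l2 r2 ⊢
    refine ⟨by simp [l1, l2]; omega, ?_, ?_⟩
    · have r3 : Red (v ++ w) := by
        refine List.isChain_append.2 ⟨hv, r2.tail, fun x hx y hy => ?_⟩
        rw [hp.last] at hx
        cases hx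
        rcases w with _ | ⟨z, w⟩
        · simp at hy
        · cases hy
          exact (List.isChain_cons_cons.1 r2).1
      refine List.isChain_append.2 ⟨red_wordInv r1.tail, r3, fun x hx y hy => ?_⟩
      rw [List.head?_append, hp.head] at hy
      cases hy
      rcases u with _ | ⟨z, u⟩
      · simp [wordInv] at hx
      · have h1 := (List.isChain_cons_cons.1 r1).1
        rw [Letter.inv_inv] at h1
        have : x = z.inv := by
          simpa [wordInv, eq_comm] using hx
        rw [this, Letter.inv_inv]
        exact h1.symm
    · rw [List.drop_left' (by simp [l1]), List.take_left' rfl]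

theorem Red.isReduced {w : List (Letter k)} (h : Red w) : FreeGroup.IsReduced w := by
  refine List.IsChain.imp (fun x y hxy h1 => ?_) h
  by_contra hne
  refine hxy (Prod.ext h1.symm ?_)
  simp only [Letter.inv]
  cases hx : x.2 <;> cases hy : y.2 <;> simp_all

/-- The number of reduced words of length `p + 1`. -/
def numWords (k p : ℕ) : ℕ := 2 * k * (2 * k - 1) ^ p

/-- Pseudorandomness for the conjugate starting at `0`, whose blocks are the blocks of the list,
with the denominator multiplied out. -/
theorem TaggedLoop.IsPseudorandom.le_card_eq {γ : TaggedLoop k} {T : ℕ} {ε : ℝ} (hk : 2 ≤ k)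
    (h : γ.IsPseudorandom T ε) (hT : 0 < T) {w : List (Letter k)} (hw : Red w)
    (hl : w.length = T) :
    (1 - ε) * (γ.length / T : ℕ) ≤ (((Finset.range (γ.length / T)).filter fun i =>
      ((labels γ.toList).drop (i * T)).take T = w).card : ℝ) * numWords k (T - 1) ∧
    (((Finset.range (γ.length / T)).filter fun i =>
      ((labels γ.toList).drop (i * T)).take T = w).card : ℝ) * numWords k (T - 1) ≤
      (1 + ε) * (γ.length / T : ℕ) := by
  obtain ⟨h1, h2⟩ := h
  have hN : 0 < γ.length / T := Nat.div_pos h1 hT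
  have e : List.ofFn (fun i : Fin T => w[i]'(by omega)) = w := by
    refine List.ext_getElem (by simp [hl]) fun i _ _ => by simp
  have h3 := h2 0 (fun i : Fin T => w[i]'(by omega)) (by rw [e]; exact hw.isReduced)
  simp only at h3
  set N := γ.length / T with hNdef
  have hNR : (0 : ℝ) < N := by exact_mod_cast hN
  have hset : ({i | i < N ∧ γ.block T 0 i = fun i : Fin T => w[i]'(by omega)} : Set ℕ) =
      ((Finset.range N).filter fun i => ((labels γ.toList).drop (i * T)).take T = w :
        Finset ℕ) := by
    ext i
    simp only [Set.mem_ofPred_eq, Finset.coe_filter, Finset.mem_range]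
    refine and_congr_right fun hi => ?_
    have hi' : (i + 1) * T ≤ γ.length :=
      (Nat.mul_le_mul_right T (by omega)).trans (Nat.div_mul_le_self γ.length T)
    rw [γ.block_eq hi']
    constructor
    · intro h
      rw [h, e]
    · intro h
      rw [← e] at h
      exact List.ofFn_injective h
  rw [hset, Set.ncard_coe_finset] at h3
  have e2 : ((2 * k : ℝ) * (2 * k - 1 : ℝ) ^ (T - 1)) = (numWords k (T - 1) : ℝ) := by
    rw [numWords, Nat.cast_mul, Nat.cast_pow, Nat.cast_sub (by omega)]
    push_cast
    ring
  rw [e2, div_mul_eq_mul_div, le_div_iff₀ hNR, div_le_iff₀ hNR] at h3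
  exact h3

/-- Every reduced word occurs at a given place of the blocks as often as one expects. -/
theorem TaggedLoop.IsPseudorandom.le_card_window {γ : TaggedLoop k} {T : ℕ} {ε : ℝ} (hk : 2 ≤ k)
    (h : γ.IsPseudorandom T ε) {v : List (Letter k)} (hv : Red v) (hne : v ≠ []) {o : ℕ}
    (hT : o + v.length ≤ T) :
    (1 - ε) * (γ.length / T : ℕ) ≤ (((Finset.range (γ.length / T)).filter fun i =>
      ((labels γ.toList).drop (i * T + o)).take v.length = v).card : ℝ) *
        numWords k (v.length - 1) := by
  obtain ⟨E, hE, hE'⟩ := exists_extensions hv hne hT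
  have hvpos := List.length_pos_iff.2 hne
  set N := γ.length / T
  -- Different extensions occur in different blocks, so their numbers of occurrences add up to at
  -- most that of `v`.
  have h1 : ∑ w ∈ E, ((Finset.range N).filter fun i =>
      ((labels γ.toList).drop (i * T)).take T = w).card ≤
      ((Finset.range N).filter fun i =>
      ((labels γ.toList).drop (i * T + o)).take v.length = v).card := by
    rw [← Finset.card_biUnion]
    · refine Finset.card_le_card fun i hi => ?_
      obtain ⟨w, hw, hi⟩ := Finset.mem_biUnion.1 hi
      obtain ⟨hi, hi'⟩ := Finset.mem_filter.1 hi
      refine Finset.mem_filter.2 ⟨hi, ?_⟩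
      have := (hE' _ hw).2.2
      rwa [← hi', List.drop_take, List.take_take, List.drop_drop, min_eq_left (by omega)] at this
    · intro w _ w' _ hww'
      rw [Function.onFun, Finset.disjoint_left]
      intro i hi hi'
      exact hww' ((Finset.mem_filter.1 hi).2.symm.trans (Finset.mem_filter.1 hi').2)
  have h2 : (E.card : ℝ) * ((1 - ε) * N) ≤ (∑ w ∈ E, (((Finset.range N).filter fun i =>
      ((labels γ.toList).drop (i * T)).take T = w).card : ℝ)) * numWords k (T - 1) := by
    rw [Finset.sum_mul, ← nsmul_eq_mul, ← Finset.sum_const]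
    exact Finset.sum_le_sum fun w hw =>
      (h.le_card_eq hk (by omega) (hE' w hw).2.1 (hE' w hw).1).1
  have h3 : numWords k (T - 1) = numWords k (v.length - 1) * (2 * k - 1) ^ (T - v.length) := by
    rw [numWords, numWords, mul_assoc (2 * k) _ (_ ^ (T - v.length)), ← pow_add]
    congr 2
    omega
  have hpos : (0 : ℝ) < ((2 * k - 1) ^ (T - v.length) : ℕ) := by
    have : 0 < (2 * k - 1) ^ (T - v.length) := Nat.pow_pos (by omega)
    exact_mod_cast this
  have h1' : (∑ w ∈ E, (((Finset.range N).filter fun i =>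
      ((labels γ.toList).drop (i * T)).take T = w).card : ℝ)) ≤
      (((Finset.range N).filter fun i =>
      ((labels γ.toList).drop (i * T + o)).take v.length = v).card : ℝ) := by
    exact_mod_cast h1
  rw [hE, h3, Nat.cast_mul] at h2
  refine le_of_mul_le_mul_left (h2.trans ?_) hpos
  calc _ ≤ (((Finset.range N).filter fun i =>
      ((labels γ.toList).drop (i * T + o)).take v.length = v).card : ℝ) *
      (numWords k (v.length - 1) * ((2 * k - 1) ^ (T - v.length) : ℕ)) := by gcongr
    _ = _ := by ring

/-- As `ε < 1`, every reduced word of length `T` occurs at least once as a block, and the upper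
bound on its frequency then gives at least half as many blocks as there are such words. This is more
than enough to make the incomplete block at the end negligible. -/
theorem TaggedLoop.IsPseudorandom.le_length {γ : TaggedLoop k} {T : ℕ} {ε : ℝ} (hk : 2 ≤ k)
    (h : γ.IsPseudorandom T ε) (hT : 0 < T) (h1 : ε < 1) : T ≤ γ.length / T := by
  have hne : (redWords k (T - 1)).Nonempty := by
    rw [← Finset.card_pos, card_redWords]
    have : 0 < (2 * k - 1) ^ (T - 1) := Nat.pow_pos (by omega)
    have : 0 < 2 * k := by omega
    positivity
  obtain ⟨w, hw⟩ := hne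
  obtain ⟨l, r⟩ := mem_redWords hw
  obtain ⟨h2, h3⟩ := h.le_card_eq hk hT r (by omega)
  have hN : 0 < γ.length / T := Nat.div_pos h.1 hT
  set N := γ.length / T
  set c := ((Finset.range N).filter fun i =>
      ((labels γ.toList).drop (i * T)).take T = w).card
  have hNR : (0 : ℝ) < N := by exact_mod_cast hN
  have hc : 1 ≤ c := by
    by_contra hc
    have : c = 0 := by omega
    rw [this] at h2
    have : 0 < (1 - ε) * N := mul_pos (by linarith) hNR
    simp at h2
    linarith
  have h4 : (numWords k (T - 1) : ℝ) ≤ 2 * N := by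
    have hc' : (1 : ℝ) ≤ c := by exact_mod_cast hc
    have h5 : (0 : ℝ) ≤ numWords k (T - 1) := by positivity
    nlinarith
  have h5 : numWords k (T - 1) ≤ 2 * N := by exact_mod_cast h4
  have h6 : T - 1 < 2 ^ (T - 1) := Nat.lt_two_pow_self
  have h7 : 2 ^ (T - 1) ≤ (2 * k - 1) ^ (T - 1) := Nat.pow_le_pow_left (by omega) _
  have h8 : 2 * T ≤ numWords k (T - 1) := by
    rw [numWords]
    exact Nat.mul_le_mul (by omega) (by omega)
  omega

theorem exists_subset_of_fibers {β : Type*} [DecidableEq β] (C : Finset ℕ) (g : ℕ → β)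
    (n : β → ℕ) (h : ∀ b, n b ≤ (C.filter fun i => g i = b).card) :
    ∃ A ⊆ C, ∀ b, (A.filter fun i => g i = b).card = n b := by
  choose t ht hn using fun b => Finset.exists_subset_card_eq (h b)
  refine ⟨C.filter fun i => i ∈ t (g i), Finset.filter_subset _ _, fun b => ?_⟩
  rw [← hn b]
  congr 1
  ext i
  simp only [Finset.mem_filter]
  constructor
  · rintro ⟨⟨_, h2⟩, rfl⟩
    exact h2
  · intro hi
    have := Finset.mem_filter.1 (ht b hi)
    exact ⟨⟨this.1, by rw [this.2]; exact hi⟩, this.2⟩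

/-- Match the values of two functions, apart from few exceptions, if all values occur with nearly
the same frequency. -/
theorem exists_matching {β : Type*} [DecidableEq β] {S : Finset β} {f : β → β}
    (hf : Set.InjOn f S) (hf' : Set.MapsTo f S S) {I C : Finset ℕ} (hC : C ⊆ I) {g g' : ℕ → β}
    (hg : ∀ i ∈ I, g i ∈ S) (hg' : ∀ i ∈ I, g' i ∈ S) {s : ℝ}
    (hs : ∀ b ∈ S, s ≤ (I.filter fun i => g i = b).card)
    (hs' : ∀ b ∈ S, s ≤ (I.filter fun i => g' i = b).card) :
    ∃ A ⊆ C, ∃ A' ⊆ C, A'.val.map g' = (A.val.map g).map f ∧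
      S.card * s ≤ A.card + 2 * (I \ C).card := by
  have hsurj : Set.SurjOn f S S := Finset.surjOn_of_injOn_of_card_le f hf' hf le_rfl
  -- An injective self-map of a finite set is onto, so `g'` can be replaced by its preimage under
  -- `f`, and equal values can be matched instead.
  have hinv : ∃ g'' : ℕ → β, ∀ i ∈ I, g'' i ∈ S ∧ f (g'' i) = g' i := by
    have : ∀ i, ∃ b, i ∈ I → b ∈ S ∧ f b = g' i := fun i => by
      by_cases hi : i ∈ I
      · obtain ⟨b, hb, e⟩ := hsurj (hg' i hi)
        exact ⟨b, fun _ => ⟨hb, e⟩⟩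
      · exact ⟨g' i, fun h => absurd h hi⟩
    exact Classical.axiomOfChoice this
  obtain ⟨g'', hg''⟩ := hinv
  -- For each value as many indices are matched as both functions allow within `C`.
  set n : β → ℕ := fun b => min (C.filter fun i => g i = b).card (C.filter fun i => g'' i = b).card
    with hn
  obtain ⟨A, hA, hAn⟩ := exists_subset_of_fibers C g n fun b => min_le_left _ _
  obtain ⟨A', hA', hAn'⟩ := exists_subset_of_fibers C g'' n fun b => min_le_right _ _
  have hcount : A'.val.map g'' = A.val.map g := by
    ext b
    rw [Multiset.count_map, Multiset.count_map]
    have h1 := hAn b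
    have h2 := hAn' b
    rw [Finset.card_def, Finset.filter_val] at h1 h2
    simp only [eq_comm (a := b)]
    rw [h1, h2]
  refine ⟨A, hA, A', hA', ?_, ?_⟩
  · rw [← hcount, Multiset.map_map]
    exact Multiset.map_congr rfl fun i hi => ((hg'' i (hC (hA' hi))).2).symm
  · have hsplit : ∀ (h : ℕ → β) b, (I.filter fun i => h i = b).card =
        (C.filter fun i => h i = b).card + ((I \ C).filter fun i => h i = b).card := by
      intro h b
      rw [← Finset.card_union_of_disjoint
        (Finset.disjoint_filter_filter Finset.disjoint_sdiff), ← Finset.filter_union,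
        Finset.union_sdiff_of_subset hC]
    -- Whichever of the two fibers is the smaller one, it misses the frequency `s` by at most the
    -- indices of that fiber outside `C`. Summing over all values counts each index outside `C` at
    -- most twice.
    have hle : ∀ b ∈ S, s ≤ ((A.filter fun i => g i = b).card +
        (((I \ C).filter fun i => g i = b).card + ((I \ C).filter fun i => g'' i = b).card) : ℕ) := by
      intro b hb
      have h1 := hs b hb
      have h2 := hs' (f b) (hf' hb)
      have h3 : (I.filter fun i => g' i = f b) = I.filter fun i => g'' i = b := by
        refine Finset.filter_congr fun i hi => ?_
        rw [← (hg'' i hi).2]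
        exact ⟨fun e => hf (hg'' i hi).1 hb e, fun e => by rw [e]⟩
      rw [h3, hsplit] at h2
      rw [hsplit] at h1
      rw [hAn b]
      simp only [hn]
      rcases min_choice (C.filter fun i => g i = b).card (C.filter fun i => g'' i = b).card
        with h | h <;> rw [h] <;> push_cast at h1 h2 ⊢
      · have : (0 : ℝ) ≤ ((I \ C).filter fun i => g'' i = b).card := by positivity
        linarith
      · have : (0 : ℝ) ≤ ((I \ C).filter fun i => g i = b).card := by positivity
        linarith
    have hsum := Finset.sum_le_sum hle
    rw [Finset.sum_const, nsmul_eq_mul, ← Nat.cast_sum, Finset.sum_add_distrib,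
      Finset.sum_add_distrib,
      ← Finset.card_eq_sum_card_fiberwise (fun i hi => hg i (hC (hA hi))),
      ← Finset.card_eq_sum_card_fiberwise (fun i hi => hg i (Finset.sdiff_subset hi)),
      ← Finset.card_eq_sum_card_fiberwise (fun i hi => (hg'' i (Finset.sdiff_subset hi)).1)] at hsum
    refine hsum.trans (le_of_eq ?_)
    push_cast
    ring

end Counting

end ThinFatgraph

namespace ThinFatgraph

/-! ### Pseudorandom collections are good -/

section Main

variable {k L : ℕ}

theorem mem_exts_of_red : ∀ {p : ℕ} {a : Letter k} {w : List (Letter k)}, w.length = p →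
    Red (a :: w) → w ∈ exts p a
  | 0, a, w, h, _ => by
    obtain rfl : w = [] := List.length_eq_zero_iff.1 h
    simp [exts]
  | p + 1, a, [], h, _ => by simp at h
  | p + 1, a, b :: w, h, hr => by
    obtain ⟨h1, h2⟩ := List.isChain_cons_cons.1 hr
    exact Finset.mem_biUnion.2 ⟨b, by simpa using h1, Finset.mem_image_of_mem _
      (mem_exts_of_red (by simpa using h) h2)⟩

theorem mem_redWords_of_red {p : ℕ} {w : List (Letter k)} (h : w.length = p + 1) (hr : Red w) :
    w ∈ redWords k p := by
  rcases w with _ | ⟨b, w⟩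
  · simp at h
  · exact Finset.mem_biUnion.2 ⟨b, Finset.mem_univ _, Finset.mem_image_of_mem _
      (mem_exts_of_red (by simpa using h) hr)⟩

theorem middle_coreOf (d : Letter k) {ℓ : List (Letter k)} {a n : ℕ} (h : a + (n + 2) ≤ ℓ.length) :
    (coreOf d ((ℓ.drop a).take (n + 2))).2.1 = (ℓ.drop (a + 1)).take n := by
  simp only [coreOf]
  rw [List.dropLast_eq_take, ← List.drop_one, List.drop_take, List.drop_drop, List.take_take,
    List.length_take, List.length_drop]
  congr 1
  omega

/-- The cores of length `n` with reduced words. -/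
def coreSet (d : Letter k) (n : ℕ) : Finset (Core k) := (redWords k (n + 1)).image (coreOf d)

theorem mem_coreSet {d : Letter k} {n : ℕ} {κ : Core k} :
    κ ∈ coreSet d n ↔ κ.2.1.length = n ∧ Red κ.word := by
  constructor
  · intro h
    obtain ⟨w, hw, rfl⟩ := Finset.mem_image.1 h
    obtain ⟨h1, h2⟩ := mem_redWords hw
    exact ⟨by rw [length_coreOf, h1]; omega, by rwa [word_coreOf d (by omega)]⟩
  · rintro ⟨h1, h2⟩
    refine Finset.mem_image.2 ⟨κ.word, mem_redWords_of_red ?_ h2, coreOf_word d κ⟩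
    simp [Core.word, h1]

theorem card_coreSet (d : Letter k) (n : ℕ) : (coreSet d n).card = numWords k (n + 1) := by
  rw [coreSet, Finset.card_image_of_injOn, card_redWords, numWords]
  intro w hw w' hw' e
  have h1 := (mem_redWords hw).1
  have h2 := (mem_redWords hw').1
  rw [← word_coreOf d (v := w) (by omega), e, word_coreOf d (by omega)]

/-- The estimates for the number of matched blocks `a` out of `N` blocks of length `T`, the number
`c` of slots with the right content, the number `U` of marks and the length `ℓ` of the loop. -/
theorem count_estimate {N T a c U ℓ n J : ℕ} {ε : ℝ} (hL : 0 < L) (h0 : 0 < ε)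
    (hε : 10 * (T : ℝ) ^ 2 * ε ≤ 1) (hN : 0 < N) (hTN : T ≤ N) (hnT : 8 * L + 2 * n ≤ T)
    (hTn : T ≤ 8 * L + 2 * n + 1) (hJ : J ≤ T) (haN : a ≤ N) (hℓ : ℓ < (N + 1) * T)
    (hU : (U : ℝ) ≤ ε * ℓ) (ha : (1 - ε) * N ≤ a + 2 * U)
    (hc : 14 * ((1 - ε) * N) ≤ c + J * ((N : ℝ) - a)) :
    0 < a ∧ ℓ ≤ 2 * L * c + 2 * n * a := by
  have hT1 : (1 : ℝ) ≤ T := by exact_mod_cast (by omega : 1 ≤ T)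
  have hNR : (1 : ℝ) ≤ N := by exact_mod_cast hN
  have hL1 : (1 : ℝ) ≤ L := by exact_mod_cast hL
  have haN' : (a : ℝ) ≤ N := by exact_mod_cast haN
  have hℓ' : (ℓ : ℝ) ≤ 2 * (N * T) := by
    have : ℓ ≤ 2 * (N * T) := by
      have : T ≤ N * T := Nat.le_mul_of_pos_left _ hN
      rw [Nat.add_mul, one_mul] at hℓ
      omega
    exact_mod_cast this
  have hε10 : ε ≤ 1 / 10 := by
    have : ε * 1 ≤ ε * (T : ℝ) ^ 2 := by
      gcongr
      exact one_le_pow₀ hT1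
    linarith
  -- The defect is at most `ε N + 2 U`, and `U ≤ ε ℓ ≤ 2 ε N T`, which gives `5 ε T N`. The bound on
  -- `ε` then makes `T (N - a)` at most `N / 2`.
  have h1 : (N : ℝ) - a ≤ 5 * (ε * T * N) := by
    have h2 : ε * ℓ ≤ ε * (2 * (N * T)) := by gcongr
    have h3 : ε * N * 1 ≤ ε * N * T := by gcongr
    linarith
  have h2 : (T : ℝ) * ((N : ℝ) - a) ≤ N / 2 := by
    calc (T : ℝ) * ((N : ℝ) - a) ≤ T * (5 * (ε * T * N)) := by gcongr
      _ = (10 * (T : ℝ) ^ 2 * ε) * (N / 2) := by ring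
      _ ≤ 1 * (N / 2) := by gcongr
      _ = N / 2 := one_mul _
  have h3 : (J : ℝ) * ((N : ℝ) - a) ≤ N / 2 := by
    refine le_trans ?_ h2
    have : (J : ℝ) ≤ T := by exact_mod_cast hJ
    have : 0 ≤ (N : ℝ) - a := by linarith
    gcongr
  have h4 : (2 * n : ℝ) * ((N : ℝ) - a) ≤ N / 2 := by
    refine le_trans ?_ h2
    have : (2 * n : ℝ) ≤ T := by exact_mod_cast (by omega : 2 * n ≤ T)
    have : 0 ≤ (N : ℝ) - a := by linarith
    gcongr
  refine ⟨?_, ?_⟩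
  · by_contra h
    have : a = 0 := by omega
    subst this
    have : (1 : ℝ) * N ≤ T * N := by gcongr
    push_cast at h2
    linarith
  -- Of the expected `14 N` occurrences, the factor `1 - ε` and the unmatched blocks cost less than
  -- `2 N`. The remaining `12 N` give `24 L N`, while the length outside the cores is about `8 L N`;
  -- the difference covers all errors.
  · have h5 : (12 * N : ℝ) ≤ c := by
      have : ε * N ≤ 1 / 10 * N := by gcongr
      linarith
    have h6 : (2 * L : ℝ) * (12 * N) ≤ 2 * L * c := by gcongr
    have h7 : (ℓ : ℝ) ≤ (N + 1) * T := by exact_mod_cast hℓ.le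
    have h8 : (T : ℝ) ≤ 8 * L + 2 * n + 1 := by exact_mod_cast hTn
    have h9 : (T : ℝ) ≤ N := by exact_mod_cast hTN
    have h10 : (N : ℝ) * T ≤ N * (8 * L + 2 * n + 1) := by gcongr
    have h11 : (N : ℝ) * 1 ≤ N * L := by gcongr
    have h12 : (ℓ : ℝ) ≤ 2 * L * c + 2 * n * a := by nlinarith
    exact_mod_cast h12

/-- The cores of first halves are matched with the cores of second halves that are their partners
under `f`, within the blocks free of tags. A given slot of a random core contains `y Q y` with
probability `1 / numWords k (Q.length + 1)`, so `J` slots contain it fourteen times on average. The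
length outside the matched cores is then at most `2 * L` times the number of these occurrences. -/
theorem exists_loop_of_pseudorandom (hk : 2 ≤ k) (hL : 0 < L) {y : Letter k}
    {Q : List (Letter k)} (hQ : Red (y :: (Q ++ [y]))) {f : Core k → Core k} {n T J : ℕ}
    (hn : J * (L + (Q.length + 2)) + L ≤ n) (hnT : 8 * L + 2 * n ≤ T)
    (hTn : T ≤ 8 * L + 2 * n + 1) (hJ : J = 14 * numWords k (Q.length + 1))
    (hf : Set.InjOn f {κ | κ.2.1.length = n ∧ Red κ.word})
    (hf' : Set.MapsTo f {κ | κ.2.1.length = n ∧ Red κ.word} {κ | κ.2.1.length = n ∧ Red κ.word})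
    {ε : ℝ} (h0 : 0 < ε) (hε : 10 * (T : ℝ) ^ 2 * ε ≤ 1) {γ : TaggedLoop k}
    (hsep : γ.TagsSeparated (4 * L)) (hden : γ.tagDensity ≤ ε) (hps : γ.IsPseudorandom T ε) :
    ∃ (l : List (Seg k)) (C : Multiset (Core k)), LoopOK L l ∧
      (cores l : Multiset (Core k)) = C + C.map f ∧
      (∀ κ ∈ C, κ.2.1.length = n ∧ Red κ.word) ∧
      (l.map fun u => u.2.length).sum ≤ 2 * L * (C.map fun κ => slotCount L y Q J κ.2.1).sum ∧
      hom (labels (flatSegs l)) = γ.homologyClass ∧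
      ∀ M, Good L (flatSegs l ::ₘ M) → Good L (γ.toList ::ₘ M) := by
  classical
  have hT : 0 < T := by omega
  have hT1 : (1 : ℝ) ≤ T := by exact_mod_cast hT
  have hε1 : ε < 1 := by
    have : ε * 1 ≤ ε * (T : ℝ) ^ 2 := by
      gcongr
      exact one_le_pow₀ hT1
    linarith
  have hN : 0 < γ.length / T := Nat.div_pos hps.1 hT
  have hTN := hps.le_length hk hT hε1
  have hNT := Nat.div_mul_le_self γ.length T
  have hlt : γ.length < (γ.length / T + 1) * T := Nat.lt_mul_of_div_lt (by omega) hT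
  have hJn : J ≤ T := by
    have : J * 1 ≤ J * (L + (Q.length + 2)) := Nat.mul_le_mul_left _ (by omega)
    omega
  set N := γ.length / T with hNdef
  set F := γ.toList with hF
  have hlen : (labels F).length = γ.length := by rw [length_labels, γ.length_toList]
  have hred : Red (labels F) := γ.cycRed_toList.choose_spec.choose_spec.1.red
  have hblock : ∀ i ∈ Finset.range N, i * T + T ≤ γ.length := fun i hi => by
    have := Nat.mul_le_mul_right T (Finset.mem_range.1 hi)
    rw [Nat.succ_mul] at this
    omega
  set w : ℕ → ℕ → Core k := fun o i => coreOf y (((labels F).drop (i * T + o)).take (n + 2)) with hw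
  have hwS : ∀ o, o + (n + 2) ≤ T → ∀ i ∈ Finset.range N, w o i ∈ coreSet y n := by
    intro o ho i hi
    have := hblock i hi
    refine Finset.mem_image_of_mem _ (mem_redWords_of_red ?_ ?_)
    · rw [List.length_take, List.length_drop, hlen]
      omega
    · exact (hred.drop _).take _
  set s : ℝ := (1 - ε) * N / numWords k (n + 1) with hs
  have hpos : ∀ p, (0 : ℝ) < numWords k p := by
    intro p
    have : 0 < 2 * k * (2 * k - 1) ^ p := Nat.mul_pos (by omega) (Nat.pow_pos (by omega))
    exact_mod_cast this
  have hws : ∀ o, o + (n + 2) ≤ T → ∀ κ ∈ coreSet y n,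
      s ≤ ((Finset.range N).filter fun i => w o i = κ).card := by
    intro o ho κ hκ
    obtain ⟨v, hv, rfl⟩ := Finset.mem_image.1 hκ
    obtain ⟨hv1, hv2⟩ := mem_redWords hv
    have h1 := hps.le_card_window hk hv2 (by rintro rfl; simp at hv1) (o := o) (by omega)
    rw [hv1] at h1
    rw [hs, div_le_iff₀ (hpos _)]
    refine h1.trans ?_
    have : (((Finset.range N).filter fun i =>
        ((labels F).drop (i * T + o)).take (n + 1 + 1) = v).card : ℝ) ≤
        ((Finset.range N).filter fun i => w o i = coreOf y v).card := by
      refine Nat.cast_le.2 (Finset.card_le_card fun i hi => ?_)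
      rw [Finset.mem_filter] at hi ⊢
      exact ⟨hi.1, by simp only [hw]; rw [← hi.2]⟩
    rw [Nat.add_sub_cancel]
    gcongr
  set D := (Finset.range N).filter fun i => ¬ ∃ j < T, Marked F (i * T + j) with hD
  have hDsub : D ⊆ Finset.range N := Finset.filter_subset _ _
  have hSet : ((coreSet y n : Finset (Core k)) : Set (Core k)) =
      {κ | κ.2.1.length = n ∧ Red κ.word} := by
    ext κ
    simp [mem_coreSet]
  -- The offsets are those of the core windows in the two halves of a block.
  obtain ⟨A, hA, A', hA', hAA, hcard⟩ := exists_matching (by rwa [hSet]) (by rwa [hSet]) hDsub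
    (hwS (2 * L - 1) (by omega)) (hwS (4 * L + n + (2 * L - 1)) (by omega))
    (hws (2 * L - 1) (by omega)) (hws (4 * L + n + (2 * L - 1)) (by omega))
  have hAN : A.card ≤ N := by
    simpa using Finset.card_le_card (hA.trans hDsub)
  have hAc : A'.card = A.card := by
    have := congrArg Multiset.card hAA
    simpa using this
  have hU : (((Finset.range N) \ D).card : ℝ) ≤ ε * γ.length := by
    have h1 : (Finset.range N) \ D =
        (Finset.range N).filter fun i => ∃ j < T, Marked F (i * T + j) := by
      rw [hD, ← Finset.filter_not]
      simp only [not_not]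
    rw [h1]
    have h2 := γ.card_marked_blocks (T := T) (N := N)
    have hl : (0 : ℝ) < γ.length := by exact_mod_cast γ.length_pos
    rw [TaggedLoop.tagDensity, div_le_iff₀ hl] at hden
    refine le_trans ?_ hden
    exact_mod_cast h2
  have ha : (1 - ε) * N ≤ A.card + 2 * ((Finset.range N) \ D).card := by
    rw [card_coreSet, hs, mul_div_cancel₀ _ (hpos _).ne'] at hcard
    exact hcard
  set C := A.val.map (w (2 * L - 1)) with hC
  set c := (C.map fun κ => slotCount L y Q J κ.2.1).sum with hc
  have hc' : 14 * ((1 - ε) * N) ≤ c + J * ((N : ℝ) - A.card) := by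
    -- The occurrences are counted slot by slot, since each slot is a window at a fixed place of the
    -- blocks, to which pseudorandomness applies.
    have e1 : c = ∑ j ∈ Finset.range J, (A.filter fun i =>
        ((labels F).drop (i * T + (2 * L + (j * (L + (Q.length + 2)) + L)))).take (Q.length + 2) =
          y :: (Q ++ [y])).card := by
      rw [hc, hC, Multiset.map_map]
      change ∑ i ∈ A, slotCount L y Q J (w (2 * L - 1) i).2.1 = _
      simp only [slotCount, Finset.card_filter]
      rw [Finset.sum_comm]
      refine Finset.sum_congr rfl fun j hj => Finset.sum_congr rfl fun i hi => ?_
      have h1 := hblock i (hDsub (hA hi))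
      have h2 := Nat.mul_le_mul_right (L + (Q.length + 2)) (Finset.mem_range.1 hj)
      rw [Nat.succ_mul] at h2
      simp only [hw]
      rw [middle_coreOf y (by omega), List.drop_take, List.take_take, List.drop_drop,
        min_eq_left (by omega)]
      have e2 : i * T + (2 * L - 1) + 1 + (j * (L + (Q.length + 2)) + L) =
          i * T + (2 * L + (j * (L + (Q.length + 2)) + L)) := by omega
      rw [e2]
    -- The frequency is known for all `N` blocks; restricting to the matched ones loses at most one
    -- occurrence for each unmatched block.
    have h1 : ∀ j ∈ Finset.range J, (1 - ε) * N / numWords k (Q.length + 1) - ((N : ℝ) - A.card) ≤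
        (A.filter fun i =>
        ((labels F).drop (i * T + (2 * L + (j * (L + (Q.length + 2)) + L)))).take (Q.length + 2) =
          y :: (Q ++ [y])).card := by
      intro j hj
      have h2 := Nat.mul_le_mul_right (L + (Q.length + 2)) (Finset.mem_range.1 hj)
      rw [Nat.succ_mul] at h2
      have hl : (y :: (Q ++ [y])).length = Q.length + 2 := by simp
      have h3 := hps.le_card_window hk hQ (by simp)
        (o := 2 * L + (j * (L + (Q.length + 2)) + L)) (by omega)
      rw [hl, ← div_le_iff₀ (hpos _)] at h3
      have h4 : ((Finset.range N).filter fun i =>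
          ((labels F).drop (i * T + (2 * L + (j * (L + (Q.length + 2)) + L)))).take
            (Q.length + 2) = y :: (Q ++ [y])) ⊆ (A.filter fun i =>
          ((labels F).drop (i * T + (2 * L + (j * (L + (Q.length + 2)) + L)))).take
            (Q.length + 2) = y :: (Q ++ [y])) ∪ (Finset.range N \ A) := by
        intro i hi
        rw [Finset.mem_filter] at hi
        by_cases hiA : i ∈ A
        · exact Finset.mem_union_left _ (Finset.mem_filter.2 ⟨hiA, hi.2⟩)
        · exact Finset.mem_union_right _ (Finset.mem_sdiff.2 ⟨hi.1, hiA⟩)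
      have h5 := (Finset.card_le_card h4).trans (Finset.card_union_le _ _)
      rw [Finset.card_sdiff_of_subset (hA.trans hDsub), Finset.card_range] at h5
      have h6 := (Nat.cast_le (α := ℝ)).2 h5
      rw [Nat.cast_add, Nat.cast_sub hAN] at h6
      have h7 : Q.length + 2 - 1 = Q.length + 1 := by omega
      rw [h7] at h3
      linarith
    have h2 := Finset.sum_le_sum h1
    rw [Finset.sum_const, Finset.card_range, nsmul_eq_mul, ← Nat.cast_sum, ← e1, mul_sub] at h2
    have h3 : (J : ℝ) * ((1 - ε) * N / numWords k (Q.length + 1)) = 14 * ((1 - ε) * N) := by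
      have := (hpos (Q.length + 1)).ne'
      rw [hJ]
      push_cast
      field_simp
    linarith
  obtain ⟨hA0, hfin⟩ := count_estimate hL h0 hε hN hTN hnT hTn hJn hAN hlt hU ha hc'
  obtain ⟨l, l1, l2, l3, l4, l5⟩ := exists_loop_of_blocks hL y (n := n) (T := T) (N := N) (F := F)
    (A := A) (A' := A') (by omega) (by rw [γ.length_toList]; exact hNT) (hA.trans hDsub)
    (hA'.trans hDsub) (Finset.card_pos.1 hA0)
    (fun i hi j hj hm => (Finset.mem_filter.1 (Finset.union_subset hA hA' hi)).2 ⟨j, hj, hm⟩)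
    γ.cycRed_toList (fun a b hab i j hij hi hj => by
      have := hsep.apart hab i j hij hi hj
      omega)
  refine ⟨l, C, l1, ?_, fun κ hκ => ?_, ?_, l4.trans γ.hom_toList, l5⟩
  · rw [l2, hC, ← hAA]
    simp only [hw, add_assoc]
  · obtain ⟨i, hi, rfl⟩ := Multiset.mem_map.1 hκ
    exact mem_coreSet.1 (hwS (2 * L - 1) (by omega) i (hDsub (hA hi)))
  · rw [hAc, γ.length_toList] at l3
    have e : n * (A.card + A.card) = 2 * n * A.card := by ring
    change _ ≤ 2 * L * c
    omega

theorem Good.map_of_forall {ι : Type*} (s : Multiset ι) {a b : ι → List (Letter k × Bool)}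
    (h : ∀ i M, Good L (a i ::ₘ M) → Good L (b i ::ₘ M)) : ∀ {M}, Good L (s.map a + M) →
    Good L (s.map b + M) := by
  induction s using Multiset.induction_on with
  | empty => simp
  | cons i s ih =>
    intro M hM
    rw [Multiset.map_cons, Multiset.cons_add] at hM ⊢
    refine h i _ ?_
    rw [← Multiset.add_cons] at hM ⊢
    exact ih hM

/-- Pseudorandom collections of loops with few tags bound thin fatgraphs. -/
theorem exists_good_of_pseudorandom (hk : 2 ≤ k) (hL : 0 < L) :
    ∃ T₀ : ℕ, ∀ T : ℕ, T₀ ≤ T → ∀ ε : ℝ, 0 < ε → 10 * (T : ℝ) ^ 2 * ε ≤ 1 →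
      ∀ (m : ℕ) (Γ : Fin m → TaggedLoop k), HomologicallyTrivial Γ →
        (∀ i, (Γ i).TagsSeparated (4 * L)) → (∀ i, (Γ i).tagDensity ≤ ε) →
        (∀ i, (Γ i).IsPseudorandom T ε) →
        Good L (Finset.univ.val.map fun i => (Γ i).toList) := by
  obtain ⟨x, y, Q, R, hyx, hyx', hQ, hR, hQR, habs⟩ := exists_good_of_cores (k := k) hk hL
  set J := 14 * numWords k (Q.length + 1) with hJ
  set n₀ := J * (L + (Q.length + 2)) + L with hn₀
  -- A block holds two cores with four margins of length `2 * L`; `n₀` is the length of a core with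
  -- room for all `J` slots and a last glued edge.
  refine ⟨8 * L + 2 * n₀, fun T hT ε h0 hε m Γ hΓ hsep hden hps => ?_⟩
  set n := (T - 8 * L) / 2 with hn
  obtain ⟨f, hf, hf', hfits⟩ := exists_partner hk hL hyx hyx' hQ hR hQR (J := J) (n := n) (by omega)
  have hyi : y.inv ≠ x := fun e => hyx' (by rw [← e, Letter.inv_inv])
  have rQ : Red (y :: (Q ++ [y])) :=
    ((Path.letter y).append (hQ.append (Path.letter y) hyx'.symm) hyi).red
  choose l C hl hcores hC hlen hhom hgood using fun i =>
    exists_loop_of_pseudorandom hk hL rQ (f := f) (n := n) (T := T) (J := J) (by omega) (by omega)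
      (by omega) hJ hf hf' h0 hε (hsep i) (hden i) (hps i)
  choose! μ n' hμ hμ' using hfits
  set Ct : Multiset (Core k) := ∑ i, C i with hCt
  have hCtm : ∀ κ ∈ Ct, κ.2.1.length = n ∧ Red κ.word := by
    intro κ hκ
    obtain ⟨i, -, hi⟩ := Multiset.mem_sum.1 hκ
    exact hC i κ hi
  have hmap : ∀ {β : Type} (g : Core k → β), Ct.map g = ∑ i, (C i).map g := fun g =>
    map_sum (Multiset.mapAddMonoidHom g) _ _
  set P := Ct.map fun κ => (κ, f κ, μ κ) with hP
  have hrep : ∀ X : Multiset (Core k), (∀ κ ∈ X, κ.2.1.length = n ∧ Red κ.word) → ∃ r,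
      X.bind μ = Multiset.replicate (X.map fun κ => slotCount L y Q J κ.2.1).sum (Q, R) +
        Multiset.replicate r (R, Q) := by
    intro X
    induction X using Multiset.induction_on with
    | empty => exact fun _ => ⟨0, by simp⟩
    | cons κ X ih =>
      intro h
      obtain ⟨r, hr⟩ := ih fun κ hκ => h κ (by simp [hκ])
      obtain ⟨h1, h2⟩ := h κ (by simp)
      refine ⟨n' κ + r, ?_⟩
      rw [Multiset.cons_bind, hr, hμ' κ h1 h2, Multiset.map_cons, Multiset.sum_cons,
        Multiset.replicate_add, Multiset.replicate_add]
      abel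
  obtain ⟨r, hr⟩ := hrep Ct hCtm
  have hbind : ∀ {β : Type} (g : List (Seg k) → Multiset β),
      (Finset.univ.val.map l).bind g = ∑ i, g (l i) := fun g => by
    rw [Multiset.bind_map]
    rfl
  -- All loops are glued together: the cores of each loop are paired within that loop, but the
  -- remainder is absorbed for the whole collection at once, since only the total homology vanishes.
  have key := habs P (fun p hp => by
      obtain ⟨κ, hκ, rfl⟩ := Multiset.mem_map.1 hp
      exact hμ κ (hCtm κ hκ).1 (hCtm κ hκ).2)
    (Finset.univ.val.map l) (fun u hu => by
      obtain ⟨i, -, rfl⟩ := Multiset.mem_map.1 hu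
      exact hl i)
    (by
      rw [hbind, hP, Multiset.map_map, Multiset.map_map, hmap, hmap, ← Finset.sum_add_distrib]
      refine Finset.sum_congr rfl fun i _ => ?_
      rw [hcores i]
      simp)
    (by
      rw [Multiset.map_map]
      change ∑ i, hom (labels (flatSegs (l i))) = 0
      rw [Finset.sum_congr rfl fun i _ => hhom i]
      exact hΓ)
    _ r (by
      rw [hP, Multiset.bind_map]
      exact hr)
    (by
      rw [hbind, hmap]
      have e1 := map_sum (Multiset.sumAddMonoidHom.comp
        (Multiset.mapAddMonoidHom fun u : Seg k => u.2.length))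
        (fun i => (l i : Multiset (Seg k))) Finset.univ
      have e2 := map_sum (Multiset.sumAddMonoidHom (M := ℕ))
        (fun i => (C i).map fun κ => slotCount L y Q J κ.2.1) Finset.univ
      simp only [AddMonoidHom.comp_apply, Multiset.coe_mapAddMonoidHom,
        Multiset.coe_sumAddMonoidHom, Multiset.map_coe, Multiset.sum_coe] at e1 e2
      rw [e1, e2, Finset.mul_sum, Finset.mul_sum]
      refine Finset.sum_le_sum fun i _ => ?_
      have := Nat.mul_le_mul_left 2 (hlen i)
      rw [← mul_assoc, ← mul_assoc] at this
      exact this)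
  rw [Multiset.map_map] at key
  have := Good.map_of_forall Finset.univ.val (a := flatSegs ∘ l) (b := fun i => (Γ i).toList)
    (fun i M => hgood i M) (M := 0) (by rwa [add_zero])
  rwa [add_zero] at this

theorem boundsThinFatgraph_copies (hL : 0 < L) {m : ℕ} {Γ : Fin m → TaggedLoop k}
    (h : Good L (Finset.univ.val.map fun i => (Γ i).toList)) (N : ℕ) :
    BoundsThinFatgraph L (copies N Γ) := by
  refine bounds_of_good hL (copies N Γ) ?_
  have e : (Finset.univ : Finset (Fin N × Fin m)).val.map (fun p => (copies N Γ p).toList) =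
      N • Finset.univ.val.map fun i => (Γ i).toList := by
    rw [← Finset.univ_product_univ, Finset.product_val]
    change Multiset.map _ (Multiset.product _ _) = _
    rw [Multiset.product, Multiset.map_bind]
    simp only [Multiset.map_map, Function.comp_def, copies]
    simp [Multiset.bind, Multiset.join]
  rw [e]
  exact h.nsmul N

end Main

end ThinFatgraph

theorem theorem3p3p1 (k : ℕ) (hk : 2 ≤ k) (L : ℕ) (hL : 0 < L) :
    ∃ T₀ : ℕ, ∀ T : ℕ, T₀ ≤ T →
      ∀ ρ : ℝ → ℝ, ρ =o[𝓝[>] (0 : ℝ)] (fun ε : ℝ => ε) →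
        ∃ ε₀ : ℝ, 0 < ε₀ ∧ ∀ ε : ℝ, 0 < ε → ε < ε₀ →
          ∀ (m : ℕ) (Γ : Fin m → ThinFatgraph.TaggedLoop k),
            ThinFatgraph.HomologicallyTrivial Γ →
            (∀ i, (Γ i).TagsSeparated (4 * L)) →
            (∀ i, (Γ i).tagDensity ≤ ρ ε) →
            (∀ i, (Γ i).IsPseudorandom T ε) →
              ThinFatgraph.BoundsThinFatgraph L (ThinFatgraph.copies (20 * L) Γ) ∧
              (k = 2 → ThinFatgraph.BoundsThinFatgraph L (ThinFatgraph.copies 1 Γ)) := by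
  obtain ⟨T₀, h⟩ := ThinFatgraph.exists_good_of_pseudorandom (k := k) hk hL
  refine ⟨T₀, fun T hT ρ hρ => ?_⟩
  -- Of the condition on `ρ`, only `ρ ε ≤ ε` for small `ε` enters.
  have h1 := hρ.def (c := 1) one_pos
  rw [eventually_nhdsWithin_iff, Metric.eventually_nhds_iff] at h1
  obtain ⟨ε₁, hε₁, h1⟩ := h1
  have hpos : (0 : ℝ) < 10 * (T : ℝ) ^ 2 + 1 := by positivity
  -- The second bound yields `10 T² ε ≤ 1`; the summand `1` in the denominator keeps it positive for
  -- every `T`.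
  refine ⟨min ε₁ (1 / (10 * (T : ℝ) ^ 2 + 1)), by positivity, fun ε h0 hε m Γ hΓ hs hd hp => ?_⟩
  rw [lt_min_iff, lt_div_iff₀ hpos] at hε
  have h2 := h1 (y := ε) (by rw [Real.dist_eq, sub_zero, abs_of_pos h0]; exact hε.1) h0
  rw [one_mul, Real.norm_eq_abs, Real.norm_eq_abs, abs_of_pos h0] at h2
  have hG := h T hT ε h0 (by nlinarith) m Γ hΓ hs
    (fun i => (hd i).trans ((le_abs_self _).trans h2)) hp
  exact ⟨ThinFatgraph.boundsThinFatgraph_copies hL hG _,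
    fun _ => ThinFatgraph.boundsThinFatgraph_copies hL hG _⟩
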